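/- A continuous-time Markov game $\mathcal M$ consists of a finite set $L$ of locations, partitioned into $L_r$ (controlled by a reachability player) and $L_s$ (controlled by a safety player), a finite set $\Sigma$ of actions, a rate matrix $\mathbf R:L\times\Sigma\times L\to\mathbb Q_{\ge0}$ and an initial distribution $\nu$ on $L$. An action $a$ is enabled at $l$, written $a\in\Sigma(l)$, if $\sum_{l'}\mathbf R(l,a,l')>0$; every location has an enabled action. The game is normed if $\sum_{l'}\mathbf R(l,a,l')=1$ whenever $a\in\Sigma(l)$. Its size $|\mathcal M|$ is the number of non-zero rates. Put $\mathbf Q(l,a,l')=\mathbf R(l,a,l')$ for $l'\ne l$ and $\mathbf Q(l,a,l)=-\sum_{l'\neq l}\mathbf R(l,a,l')$. Fix a goal region $G\subseteq L$ and a time bound $T\ge 0$. A memoryless (timed positional) strategy of a player is a measurable map that assigns to each of her locations $l$ and each time $t\in[0,T]$ an action in $\Sigma(l)$. A pair of strategies $(\sigma_r,\sigma_s)$ forms a scheduler $\sigma$. For an initial distribution $\mu$ on $L$, the resulting time-inhomogeneous Markov chain has the transient distributions $x(t)$ determined by $x(t,l)=\mu(l)+\int_0^t\sum_{l'}x(s,l')\,\mathbf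 Q(l',\sigma(l',s),l)\,ds$; let $\mathrm{Pr}_{\sigma_r,\sigma_s}^{\mu}(G)=\sum_{l\in G}x(T,l)$ be the probability to be in $G$ at time $T$. The optimal time-bounded reachability probability is $v^\mu=\sup_{\sigma_r}\inf_{\sigma_s}\mathrm{Pr}_{\sigma_r,\sigma_s}^{\mu}(G)$. The quality of $\sigma_r$ is $\inf_{\sigma_s}\mathrm{Pr}_{\sigma_r,\sigma_s}^{\mu}(G)$, the quality of $\sigma_s$ is $\sup_{\sigma_r}\mathrm{Pr}_{\sigma_r,\sigma_s}^{\mu}(G)$, and a strategy is $\pi$-optimal if its quality differs from $v^\mu$ by at most $\pi$. Let $\mathrm{opt}_{a\in\Sigma(l)}$ denote the maximum over $\Sigma(l)$ if $l\in L_r$ and the minimum if $l\in L_s$. For $N\geq 1$ and $\varepsilon=T/N$ the double $\varepsilon$-net is the function $p_2$ on $L\times[0,T]$ with $p_2(l,T)=1$ for $l\in G$, $p_2(l,T)=0$ for $l\notin G$, and on each interval $[t-\varepsilon,t]$ with $t=T-j\varepsilon$, $0\le j<N$, $$p_1(l,t-\tau)=p_2(l,t)+\tau\cdot \mathrm{opt}_{a\in\Sigma(l)}\sum_{l'}\mathbf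 Q(l,a,l')\,p_2(l',t),\qquad p_2(l,t-\tau)=p_2(l,t)+\int_0^\tau \mathrm{opt}_{a\in\Sigma(l)}\sum_{l'}\mathbf Q(l,a,l')\,p_1(l',t-s)\,ds .$$ **Theorem.** There are a single program for a random access machine with exact unit-cost real arithmetic and comparisons, and a constant $C$, such that the following holds for every normed Markov game $\mathcal M$, every $G\subseteq L$, every $T\ge0$ and every precision $0<\pi\le1$. Given $\mathcal M$ (as the list of its non-zero rates, ordered by source location, action and target location, together with the owners of the locations and $\nu$), $G$, $T$ and $\pi$, the program halts after at most $$C\cdot\Bigl(1+T\sqrt{T/\pi}\Bigr)\cdot\bigl(|\mathcal M|+|L|\cdot|\Sigma|\log|\Sigma|\bigr)$$ steps; in particular, its running time is in $O\bigl(|\mathcal M|\cdot T\sqrt{T/\pi}+|L|\cdot T\sqrt{T/\pi}\cdot|\Sigma|\log|\Sigma|\bigr)$ on the inputs with $T\sqrt{T/\pi}\ge1$. It outputs a number $w_l$ for each $l\in L$, a number $w_\nu$, and a finite table that describes piecewise constant memoryless strategies $\sigma_r$ and $\sigma_s$ of the two players, such that for some $N\ge1$ and the double $\varepsilon$-net with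 $\varepsilon=T/N$: 1. $w_l=p_2(l,0)$ for every $l\in L$, and at every location and every time in $[0,T]$ the action played attains the optimum that defines the gradient of $p_2$ on one of the intervals of the net containing this time; 2. for $\mu$ the point mass at $l$ and $w=w_l$, for every $l\in L$, and also for $\mu=\nu$ and $w=w_\nu$: $|w-v^\mu|\le\pi$; both $\sigma_r$ and $\sigma_s$ are $\pi$-optimal; and $w$ differs from the quality of $\sigma_r$ and from the quality of $\sigma_s$ by at most $\pi$. -/

import Mathlib

/-! ## Continuous-time Markov games -/

section wellDefined

open MeasureTheory

variable {L : Type} [Fintype L]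

/-- Linear Volterra equations with bounded measurable coefficients have a unique continuous
solution. -/
theorem volterra_aux (B : ℝ → L → L → ℝ) (hB : ∀ i j, Measurable fun s => B s i j) {K : ℝ}
    (hK : 0 ≤ K) (hBK : ∀ s i j, |B s i j| ≤ K) {T : ℝ} (hT : 0 ≤ T) (μ : L → ℝ) :
    ∃! x : C(Set.Icc 0 T, L → ℝ), ∀ (t : Set.Icc 0 T) (l : L),
      x t l = μ l + ∫ s in (0 : ℝ)..t, ∑ i, Set.IccExtend hT x s i * B s i l := by
  classical
  set c : ℝ := Fintype.card L * K with hc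
  have hc0 : 0 ≤ c := by positivity
  have hint : ∀ (x : C(Set.Icc 0 T, L → ℝ)) (l : L) (a b : ℝ), IntervalIntegrable
      (fun s => ∑ i, Set.IccExtend hT x s i * B s i l) volume a b := by
    intro x l a b
    have hx : Continuous (Set.IccExtend hT x) := x.continuous.Icc_extend'
    have hterm : ∀ i ∈ (Finset.univ : Finset L), IntervalIntegrable
        (fun s => Set.IccExtend hT x s i * B s i l) volume a b := by
      intro i _
      have h1 : IntervalIntegrable (fun s => B s i l) volume a b := by
        refine (intervalIntegrable_const (c := K)).mono_fun (hB i l).aestronglyMeasurable ?_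
        filter_upwards with s
        simpa [abs_of_nonneg hK] using hBK s i l
      exact h1.continuousOn_mul ((continuous_apply i).comp hx).continuousOn
    have h := IntervalIntegrable.sum Finset.univ hterm
    rwa [show (∑ i, fun s => Set.IccExtend hT x s i * B s i l) =
      fun s => ∑ i, Set.IccExtend hT x s i * B s i l from by ext s; simp] at h
  let Φ : C(Set.Icc 0 T, L → ℝ) → C(Set.Icc 0 T, L → ℝ) := fun x =>
    ⟨fun t l => μ l + ∫ s in (0 : ℝ)..t, ∑ i, Set.IccExtend hT x s i * B s i l, by
      refine continuous_pi fun l => ?_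
      have h := (intervalIntegral.continuous_primitive (fun a b => hint x l a b) 0).comp
        (continuous_subtype_val (p := fun t => t ∈ Set.Icc 0 T))
      exact (continuous_const (y := μ l)).add h⟩
  have hΦ : ∀ x t l, Φ x t l =
      μ l + ∫ s in (0 : ℝ)..t, ∑ i, Set.IccExtend hT x s i * B s i l := fun _ _ _ => rfl
  have key : ∀ (k : ℕ) (x y : C(Set.Icc 0 T, L → ℝ)) (t : Set.Icc 0 T) (l : L),
      |(Φ^[k] x) t l - (Φ^[k] y) t l| ≤ c ^ k * (t : ℝ) ^ k / k.factorial * dist x y := by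
    intro k
    induction k with
    | zero =>
      intro x y t l
      have h1 := ContinuousMap.dist_apply_le_dist (f := x) (g := y) t
      have h2 := dist_le_pi_dist (x t) (y t) l
      rw [Real.dist_eq] at h2
      simpa using h2.trans h1
    | succ k ih =>
      intro x y t l
      rw [Function.iterate_succ_apply', Function.iterate_succ_apply', hΦ, hΦ,
        add_sub_add_left_eq_sub, ← intervalIntegral.integral_sub (hint _ _ _ _) (hint _ _ _ _)]
      have hpt : ∀ s ∈ Set.Ioc 0 (t : ℝ),
          ‖(∑ i, Set.IccExtend hT (Φ^[k] x) s i * B s i l) -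
            ∑ i, Set.IccExtend hT (Φ^[k] y) s i * B s i l‖ ≤
          c ^ (k + 1) / k.factorial * dist x y * s ^ k := by
        intro s hs
        have hs' : s ∈ Set.Icc 0 T := ⟨hs.1.le, hs.2.trans t.2.2⟩
        rw [← Finset.sum_sub_distrib, Set.IccExtend_of_mem hT _ hs', Set.IccExtend_of_mem hT _ hs']
        refine (norm_sum_le _ _).trans ?_
        calc ∑ i, ‖(Φ^[k] x) ⟨s, hs'⟩ i * B s i l - (Φ^[k] y) ⟨s, hs'⟩ i * B s i l‖
            ≤ ∑ _i : L, (c ^ k * s ^ k / k.factorial * dist x y) * K := by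
              refine Finset.sum_le_sum fun i _ => ?_
              rw [← sub_mul, norm_mul]
              exact mul_le_mul (ih x y ⟨s, hs'⟩ i) (hBK s i l) (norm_nonneg _)
                ((abs_nonneg _).trans (ih x y ⟨s, hs'⟩ i))
          _ = c ^ (k + 1) / k.factorial * dist x y * s ^ k := by
              rw [Finset.sum_const, Finset.card_univ, nsmul_eq_mul, pow_succ, hc]; ring
      have hi : IntervalIntegrable (fun s : ℝ => c ^ (k + 1) / k.factorial * dist x y * s ^ k)
          volume 0 t := by
        apply Continuous.intervalIntegrable
        fun_prop
      have := intervalIntegral.norm_integral_le_of_norm_le t.2.1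
        (Filter.Eventually.of_forall hpt) hi
      rw [Real.norm_eq_abs] at this
      refine this.trans (le_of_eq ?_)
      rw [intervalIntegral.integral_const_mul, integral_pow, Nat.factorial_succ]
      push_cast
      field_simp
      simp
  obtain ⟨k, hk⟩ : ∃ k : ℕ, (c * T) ^ k / k.factorial < 1 / 2 :=
    ((FloorSemiring.tendsto_pow_div_factorial_atTop (c * T)).eventually
      (gt_mem_nhds (by norm_num : (0 : ℝ) < 1 / 2))).exists
  have hcontr : ContractingWith (1 / 2) (Φ^[k]) := by
    refine ⟨by rw [← NNReal.coe_lt_coe]; norm_num, LipschitzWith.of_dist_le_mul fun x y => ?_⟩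
    rw [ContinuousMap.dist_le (by positivity)]
    intro t
    rw [dist_pi_le_iff (by positivity)]
    intro l
    rw [Real.dist_eq]
    refine (key k x y t l).trans ?_
    refine mul_le_mul_of_nonneg_right ?_ dist_nonneg
    have h1 : c ^ k * (t : ℝ) ^ k ≤ (c * T) ^ k := by
      rw [← mul_pow]
      exact pow_le_pow_left₀ (mul_nonneg hc0 t.2.1) (mul_le_mul_of_nonneg_left t.2.2 hc0) k
    have h2 : c ^ k * (t : ℝ) ^ k / k.factorial ≤ (c * T) ^ k / k.factorial := by gcongr
    push_cast
    exact h2.trans hk.le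
  refine ⟨ContractingWith.fixedPoint (Φ^[k]) hcontr, ?_, ?_⟩
  · intro t l
    have h := hcontr.isFixedPt_fixedPoint_iterate
    rw [← hΦ, h]
  · intro y hy
    have h : Function.IsFixedPt Φ y := by
      ext t l; rw [hΦ]; exact (hy t l).symm
    exact hcontr.fixedPoint_unique (h.iterate k)

end wellDefined

/-- A continuous-time Markov game with locations `L` and actions `A`.  The locations in `reach`
belong to the reachability player, all the others to the safety player.  `rate` is the rate matrix.
The discrete transition matrix is determined by it (`MarkovGame.prob` below).
`init` is the initial distribution. -/
structure MarkovGame (L A : Type) [Fintype L] [Fintype A] where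
  reach : Finset L
  rate : L → A → L → ℚ
  rate_nonneg : ∀ l a l', 0 ≤ rate l a l'
  exists_enabled : ∀ l, ∃ a, 0 < ∑ l', rate l a l'
  init : L → ℝ
  init_mem : init ∈ stdSimplex ℝ L

namespace MarkovGame

section general

variable {L A : Type} [Fintype L] [Fintype A]

/-- The discrete transition matrix (it vanishes for actions that are not enabled, where the total
rate and hence every single rate is `0`). -/
def prob (M : MarkovGame L A) (l : L) (a : A) (l' : L) : ℚ :=
  M.rate l a l' / ∑ l'', M.rate l a l''

/-- The actions that are enabled in location `l`: those with positive total rate. -/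
def enabled (M : MarkovGame L A) (l : L) : Finset A :=
  Finset.univ.filter fun a => 0 < ∑ l', M.rate l a l'

theorem enabled_nonempty (M : MarkovGame L A) (l : L) : (M.enabled l).Nonempty := by
  obtain ⟨a, ha⟩ := M.exists_enabled l
  exact ⟨a, by simp [enabled, ha]⟩

/-- A game is normed if it is uniform with uniform transition rate `1`. -/
def IsNormed (M : MarkovGame L A) : Prop :=
  ∀ l, ∀ a ∈ M.enabled l, ∑ l', M.rate l a l' = 1

/-- The size of a game: the number of non-zero rates. -/
def size (M : MarkovGame L A) : ℕ :=
  (Finset.univ.filter fun e : L × A × L => M.rate e.1 e.2.1 e.2.2 ≠ 0).card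

variable [DecidableEq L]

/-- The matrix `Q`: the rates off the diagonal, and minus the exit rate on the diagonal. -/
def gen (M : MarkovGame L A) (l : L) (a : A) (l' : L) : ℝ :=
  if l' = l then -∑ l'' ∈ Finset.univ.erase l, (M.rate l a l'' : ℝ) else (M.rate l a l' : ℝ)

/-! ### Strategies and time-bounded reachability -/

/-- `σ` is a measurable timed positional (memoryless) strategy on the time interval `[0, T]` for the
player who owns the locations in `P`.  Its values at other locations or times are irrelevant. -/
def IsStrategy (M : MarkovGame L A) (P : Set L) (T : ℝ) (σ : L → ℝ → A) : Prop :=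
  ∀ l ∈ P, (∀ t ∈ Set.Icc 0 T, σ l t ∈ M.enabled l) ∧
    ∀ a, MeasurableSet {t | t ∈ Set.Icc 0 T ∧ σ l t = a}

/-- The strategies of the reachability player. -/
def ReachStrategy (M : MarkovGame L A) (T : ℝ) : Type :=
  {σ : L → ℝ → A // M.IsStrategy {l | l ∈ M.reach} T σ}

/-- The strategies of the safety player. -/
def SafeStrategy (M : MarkovGame L A) (T : ℝ) : Type :=
  {σ : L → ℝ → A // M.IsStrategy {l | l ∉ M.reach} T σ}

/-- The scheduler formed by a pair of strategies. -/
def scheduler (M : MarkovGame L A) (σr σs : L → ℝ → A) : L → ℝ → A :=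
  fun l t => if l ∈ M.reach then σr l t else σs l t

/-- `x t l` is the probability to be in `l` at time `t ∈ [0, T]` in the time-inhomogeneous Markov
chain that results from the scheduler `σ` and the initial distribution `μ`: the solution of the
Kolmogorov forward equation in integrated form (the generator is only measurable in time). -/
def IsTransient (M : MarkovGame L A) (T : ℝ) (σ : L → ℝ → A) (μ : L → ℝ) (x : ℝ → L → ℝ) : Prop :=
  ContinuousOn x (Set.Icc 0 T) ∧
    ∀ t ∈ Set.Icc 0 T, ∀ l, x t l = μ l + ∫ s in (0 : ℝ)..t, ∑ l', x s l' * M.gen l' (σ l' s) l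

open Classical in
/-- The transient distributions under the scheduler `σ`. They exist and are unique on `[0, T]` for
every measurable scheduler, see
`isTransient_transient`. -/
noncomputable def transient (M : MarkovGame L A) (T : ℝ) (σ : L → ℝ → A) (μ : L → ℝ) :
    ℝ → L → ℝ :=
  if h : ∃ x, M.IsTransient T σ μ x then h.choose else 0

/-- Under a measurable scheduler the Kolmogorov equation has a solution, unique on `[0, T]`. -/
theorem isTransient_aux (M : MarkovGame L A) {T : ℝ} (hT : 0 ≤ T) {σ : L → ℝ → A}
    (hσ : ∀ l a, MeasurableSet {t | t ∈ Set.Icc 0 T ∧ σ l t = a}) (μ : L → ℝ) :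
    ∃ x, M.IsTransient T σ μ x ∧ ∀ y, M.IsTransient T σ μ y → Set.EqOn y x (Set.Icc 0 T) := by
  classical
  let B : ℝ → L → L → ℝ := fun s i j =>
    ∑ a, Set.indicator {t | t ∈ Set.Icc 0 T ∧ σ i t = a} (fun _ => M.gen i a j) s
  have hBeq : ∀ s ∈ Set.Icc 0 T, ∀ i j, B s i j = M.gen i (σ i s) j := by
    intro s hs i j
    simp only [B]
    rw [Finset.sum_eq_single (σ i s)]
    · exact Set.indicator_of_mem (by exact ⟨hs, rfl⟩) _
    · intro b _ hb
      exact Set.indicator_of_notMem (fun h => hb h.2.symm) _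
    · simp
  have hBm : ∀ i j, Measurable fun s => B s i j := fun i j =>
    Finset.measurable_sum _ fun a _ => measurable_const.indicator (hσ i a)
  let K : ℝ := ∑ i, ∑ j, ∑ a, |M.gen i a j|
  have hK : 0 ≤ K := by positivity
  have hBK : ∀ s i j, |B s i j| ≤ K := by
    intro s i j
    calc |B s i j| ≤ ∑ a, |M.gen i a j| := by
          refine (Finset.abs_sum_le_sum_abs _ _).trans (Finset.sum_le_sum fun a _ => ?_)
          by_cases h : s ∈ {t | t ∈ Set.Icc 0 T ∧ σ i t = a}
          · rw [Set.indicator_of_mem h]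
          · rw [Set.indicator_of_notMem h]; simp
      _ ≤ ∑ j, ∑ a, |M.gen i a j| := Finset.single_le_sum
          (f := fun j => ∑ a, |M.gen i a j|) (fun _ _ => by positivity) (Finset.mem_univ j)
      _ ≤ K := Finset.single_le_sum
          (f := fun i => ∑ j, ∑ a, |M.gen i a j|) (fun _ _ => by positivity) (Finset.mem_univ i)
  have hcongr : ∀ (x : ℝ → L → ℝ) (z : C(Set.Icc 0 T, L → ℝ)),
      (∀ s (hs : s ∈ Set.Icc 0 T), x s = z ⟨s, hs⟩) → ∀ t ∈ Set.Icc 0 T, ∀ l,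
      ∫ s in (0 : ℝ)..t, ∑ i, x s i * M.gen i (σ i s) l =
        ∫ s in (0 : ℝ)..t, ∑ i, Set.IccExtend hT z s i * B s i l := by
    intro x z hxz t ht l
    refine intervalIntegral.integral_congr fun s hs => ?_
    rw [Set.uIcc_of_le ht.1] at hs
    have hs' : s ∈ Set.Icc 0 T := ⟨hs.1, hs.2.trans ht.2⟩
    refine Finset.sum_congr rfl fun i _ => ?_
    rw [hBeq s hs', Set.IccExtend_of_mem hT _ hs', hxz s hs']
  obtain ⟨z, hz, huniq⟩ := volterra_aux B hBm hK hBK hT μ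
  refine ⟨Set.IccExtend hT z, ⟨z.continuous.Icc_extend'.continuousOn, fun t ht l => ?_⟩,
    fun y hy t ht => ?_⟩
  · rw [hcongr _ z (fun s hs => Set.IccExtend_of_mem hT _ hs) t ht l,
      Set.IccExtend_of_mem hT _ ht]
    exact hz ⟨t, ht⟩ l
  · let y' : C(Set.Icc 0 T, L → ℝ) := ⟨fun t => y t, continuousOn_iff_continuous_domRestrict.1 hy.1⟩
    have h : y' = z := huniq y' fun t l => by
      rw [← hcongr y y' (fun _ _ => rfl) t t.2 l]
      exact hy.2 t t.2 l
    rw [Set.IccExtend_of_mem hT _ ht, ← h]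
    rfl

/-- The transient distributions are the unique solution of the Kolmogorov equation. -/
theorem isTransient_transient (M : MarkovGame L A) {T : ℝ} (hT : 0 ≤ T) {σ : L → ℝ → A}
    (hσ : ∀ l a, MeasurableSet {t | t ∈ Set.Icc 0 T ∧ σ l t = a}) (μ : L → ℝ) :
    M.IsTransient T σ μ (M.transient T σ μ) ∧
      ∀ y, M.IsTransient T σ μ y → Set.EqOn y (M.transient T σ μ) (Set.Icc 0 T) := by
  obtain ⟨x, hx, hu⟩ := M.isTransient_aux hT hσ μ
  have hex : ∃ x, M.IsTransient T σ μ x := ⟨x, hx⟩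
  have h : M.IsTransient T σ μ (M.transient T σ μ) := by
    rw [transient, dif_pos hex]
    exact hex.choose_spec
  exact ⟨h, fun y hy => (hu y hy).trans (hu _ h).symm⟩

/-- The probability to be in the goal region `G` at time `T`, from the initial distribution `μ`. -/
noncomputable def reachProb (M : MarkovGame L A) (G : Finset L) (T : ℝ) (μ : L → ℝ)
    (σr σs : L → ℝ → A) : ℝ :=
  ∑ l ∈ G, M.transient T (M.scheduler σr σs) μ T l

/-- The quality of a strategy of the reachability player: what it guarantees against every
strategy of the safety player. -/
noncomputable def reachQuality (M : MarkovGame L A) (G : Finset L) (T : ℝ) (μ : L → ℝ)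
    (σr : L → ℝ → A) : ℝ :=
  ⨅ σs : M.SafeStrategy T, M.reachProb G T μ σr σs.1

/-- The quality of a strategy of the safety player. -/
noncomputable def safeQuality (M : MarkovGame L A) (G : Finset L) (T : ℝ) (μ : L → ℝ)
    (σs : L → ℝ → A) : ℝ :=
  ⨆ σr : M.ReachStrategy T, M.reachProb G T μ σr.1 σs

/-- The optimal time-bounded reachability probability from the initial distribution `μ`. -/
noncomputable def value (M : MarkovGame L A) (G : Finset L) (T : ℝ) (μ : L → ℝ) : ℝ :=
  ⨆ σr : M.ReachStrategy T, M.reachQuality G T μ σr.1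

/-- From the initial distribution `μ`, the number `w` approximates the optimal time-bounded
reachability probability with precision `π`, the strategies `σr` and `σs` are `π`-optimal, and `w`
also approximates the quality of each of the two with precision `π`. -/
def IsSolution (M : MarkovGame L A) (G : Finset L) (T π : ℝ) (μ : L → ℝ)
    (σr σs : L → ℝ → A) (w : ℝ) : Prop :=
  |w - M.value G T μ| ≤ π ∧
  |M.reachQuality G T μ σr - M.value G T μ| ≤ π ∧
  |M.safeQuality G T μ σs - M.value G T μ| ≤ π ∧
  |w - M.reachQuality G T μ σr| ≤ π ∧
  |w - M.safeQuality G T μ σs| ≤ π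

/-! ### Double epsilon-nets -/

/-- `∑ l', Q(l, a, l') x(l')`. -/
def drift (M : MarkovGame L A) (l : L) (x : L → ℝ) (a : A) : ℝ :=
  ∑ l', M.gen l a l' * x l'

/-- `opt` over the enabled actions: the maximum at locations of the reachability player, the minimum
at locations of the safety player. -/
noncomputable def opt (M : MarkovGame L A) (l : L) (q : A → ℝ) : ℝ :=
  if l ∈ M.reach then (M.enabled l).sup' (M.enabled_nonempty l) q
  else (M.enabled l).inf' (M.enabled_nonempty l) q

/-- The linear approximation `p₁` at `τ` time units before the end of an interval at whose end the
values are `x`. -/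
noncomputable def linStep (M : MarkovGame L A) (x : L → ℝ) (τ : ℝ) (l : L) : ℝ :=
  x l + τ * M.opt l (M.drift l x)

/-- The approximation `p₂` at `τ` time units before the end of an interval at whose end the values
are `x`: the gradient is taken from `p₁`. -/
noncomputable def quadStep (M : MarkovGame L A) (x : L → ℝ) (τ : ℝ) (l : L) : ℝ :=
  x l + ∫ s in (0 : ℝ)..τ, M.opt l (M.drift l (M.linStep x s))

/-- The double `ε`-net at the grid points: `doubleNet G ε j` is `p₂` at time `T - j * ε`. -/
noncomputable def doubleNet (M : MarkovGame L A) (G : Finset L) (ε : ℝ) : ℕ → L → ℝ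
  | 0 => fun l => if l ∈ G then 1 else 0
  | j + 1 => M.quadStep (M.doubleNet G ε j) ε

/-- The scheduler `σ` plays, at every location and time, an enabled action that is optimal for the
gradient of the double net with `N` intervals of length `T / N`. -/
def FollowsDoubleNet (M : MarkovGame L A) (G : Finset L) (T : ℝ) (N : ℕ) (σ : L → ℝ → A) : Prop :=
  ∀ l, ∀ t ∈ Set.Icc 0 T, σ l t ∈ M.enabled l ∧
    ∃ j < N, ∃ τ ∈ Set.Icc 0 (T / N), t = T - j * (T / N) - τ ∧
      M.drift l (M.linStep (M.doubleNet G (T / N) j) τ) (σ l t) =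
        M.opt l (M.drift l (M.linStep (M.doubleNet G (T / N) j) τ))

end general

end MarkovGame

/-! ## A random access machine with real arithmetic

Programs are structured programs over finitely many unbounded arrays, each of natural numbers or of
real numbers.  Natural numbers can be added, subtracted (truncated), compared and used as indices;
real numbers can be added, subtracted, multiplied, divided and compared, and cannot be used as
indices.  There is no rounding.  Every operation, memory access and test takes one step. -/

namespace RealRAM

/-- A memory: `nat a i` and `real a i` are the `i`-th cells of the arrays with number `a`. -/
structure State where
  nat : ℕ → ℕ → ℕ
  real : ℕ → ℕ → ℝ

/-- Index expressions. -/
inductive NExpr where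
  | lit (k : ℕ)
  | get (a : ℕ) (i : NExpr)
  | add (e f : NExpr)
  | sub (e f : NExpr)

/-- Real expressions. -/
inductive RExpr where
  | lit (q : ℚ)
  | get (a : ℕ) (i : NExpr)
  | add (e f : RExpr)
  | sub (e f : RExpr)
  | mul (e f : RExpr)
  | div (e f : RExpr)

/-- Tests. -/
inductive Test where
  | natLt (e f : NExpr)
  | realLt (e f : RExpr)
  | not (b : Test)
  | and (b c : Test)

/-- Programs. -/
inductive Prog where
  | skip
  | setNat (a : ℕ) (i e : NExpr)
  | setReal (a : ℕ) (i : NExpr) (e : RExpr)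
  | seq (p q : Prog)
  | ite (b : Test) (p q : Prog)
  | loop (b : Test) (p : Prog)

def NExpr.eval (s : State) : NExpr → ℕ
  | .lit k => k
  | .get a i => s.nat a (i.eval s)
  | .add e f => e.eval s + f.eval s
  | .sub e f => e.eval s - f.eval s

def NExpr.cost : NExpr → ℕ
  | .lit _ => 1
  | .get _ i => i.cost + 1
  | .add e f => e.cost + f.cost + 1
  | .sub e f => e.cost + f.cost + 1

noncomputable def RExpr.eval (s : State) : RExpr → ℝ
  | .lit q => (q : ℝ)
  | .get a i => s.real a (i.eval s)
  | .add e f => e.eval s + f.eval s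
  | .sub e f => e.eval s - f.eval s
  | .mul e f => e.eval s * f.eval s
  | .div e f => e.eval s / f.eval s

def RExpr.cost : RExpr → ℕ
  | .lit _ => 1
  | .get _ i => i.cost + 1
  | .add e f => e.cost + f.cost + 1
  | .sub e f => e.cost + f.cost + 1
  | .mul e f => e.cost + f.cost + 1
  | .div e f => e.cost + f.cost + 1

def Test.Holds (s : State) : Test → Prop
  | .natLt e f => e.eval s < f.eval s
  | .realLt e f => e.eval s < f.eval s
  | .not b => ¬ b.Holds s
  | .and b c => b.Holds s ∧ c.Holds s

def Test.cost : Test → ℕ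
  | .natLt e f => e.cost + f.cost + 1
  | .realLt e f => e.cost + f.cost + 1
  | .not b => b.cost + 1
  | .and b c => b.cost + c.cost + 1

/-- The memory after writing `v` into a cell of an array of natural numbers. -/
def State.writeNat (s : State) (a i v : ℕ) : State :=
  { s with nat := Function.update s.nat a (Function.update (s.nat a) i v) }

/-- The memory after writing `v` into a cell of an array of real numbers. -/
def State.writeReal (s : State) (a i : ℕ) (v : ℝ) : State :=
  { s with real := Function.update s.real a (Function.update (s.real a) i v) }

/-- `Exec p s s' c`: started in the memory `s`, the program `p` halts with the memory `s'` after
exactly `c` steps. -/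
inductive Exec : Prog → State → State → ℕ → Prop where
  | skip (s : State) : Exec .skip s s 1
  | setNat (s : State) (a : ℕ) (i e : NExpr) :
      Exec (.setNat a i e) s (s.writeNat a (i.eval s) (e.eval s)) (i.cost + e.cost + 1)
  | setReal (s : State) (a : ℕ) (i : NExpr) (e : RExpr) :
      Exec (.setReal a i e) s (s.writeReal a (i.eval s) (e.eval s)) (i.cost + e.cost + 1)
  | seq {p q : Prog} {s s' s'' : State} {c d : ℕ} (hp : Exec p s s' c) (hq : Exec q s' s'' d) :
      Exec (.seq p q) s s'' (c + d)
  | iteTrue {b : Test} {p q : Prog} {s s' : State} {c : ℕ} (hb : b.Holds s) (hp : Exec p s s' c) :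
      Exec (.ite b p q) s s' (b.cost + c)
  | iteFalse {b : Test} {p q : Prog} {s s' : State} {c : ℕ} (hb : ¬ b.Holds s)
      (hq : Exec q s s' c) : Exec (.ite b p q) s s' (b.cost + c)
  | loopDone {b : Test} {p : Prog} {s : State} (hb : ¬ b.Holds s) :
      Exec (.loop b p) s s b.cost
  | loopStep {b : Test} {p : Prog} {s s' s'' : State} {c d : ℕ} (hb : b.Holds s)
      (hp : Exec p s s' c) (hq : Exec (.loop b p) s' s'' d) :
      Exec (.loop b p) s s'' (b.cost + c + d)

end RealRAM

/-! ## Input and output formats -/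

namespace MarkovGame

variable {n m : ℕ}

/-- The triples with a non-zero rate, in lexicographic order. -/
def transitions (M : MarkovGame (Fin n) (Fin m)) : List (Fin n × Fin m × Fin n) :=
  (List.finRange n ×ˢ List.finRange m ×ˢ List.finRange n).filter
    fun e => M.rate e.1 e.2.1 e.2.2 ≠ 0

/-- The memory that holds the input; all cells that are not mentioned are `0`.
* array `0` of natural numbers: the numbers of locations, of actions, and of non-zero rates;
* arrays `1`, `2`, `3` of natural numbers and `1` of real numbers: source location, action, target
  location and rate of each non-zero entry of the rate matrix;
* array `4` of natural numbers: `1` for the locations of the reachability player;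
* array `5` of natural numbers: `1` for the goal locations;
* array `0` of real numbers: the time bound and the precision;
* array `2` of real numbers: the initial distribution. -/
noncomputable def input (M : MarkovGame (Fin n) (Fin m)) (G : Finset (Fin n)) (T π : ℝ) :
    RealRAM.State where
  nat a i :=
    match a with
    | 0 => [n, m, M.transitions.length].getD i 0
    | 1 => (M.transitions.map fun e => (e.1 : ℕ)).getD i 0
    | 2 => (M.transitions.map fun e => (e.2.1 : ℕ)).getD i 0
    | 3 => (M.transitions.map fun e => (e.2.2 : ℕ)).getD i 0
    | 4 => if h : i < n then (if ⟨i, h⟩ ∈ M.reach then 1 else 0) else 0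
    | 5 => if h : i < n then (if ⟨i, h⟩ ∈ G then 1 else 0) else 0
    | _ => 0
  real a i :=
    match a with
    | 0 => [T, π].getD i 0
    | 1 => (M.transitions.map fun e => (M.rate e.1 e.2.1 e.2.2 : ℝ)).getD i 0
    | 2 => if h : i < n then M.init ⟨i, h⟩ else 0
    | _ => 0

/-- The output describes a scheduler on `[0, T]` by a table: cell `0` of array `6` of natural numbers
is the number of rows; row `k` says that at the location in array `7` the action in array `8` is
played between the times in arrays `4` and `5` of real numbers.  The first row that applies
counts, and for every location and every time in `[0, T]` some row applies. -/
def OutputsScheduler (s : RealRAM.State) (T : ℝ) (σ : Fin n → ℝ → Fin m) : Prop :=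
  ∀ (l : Fin n), ∀ t ∈ Set.Icc 0 T, ∃ k < s.nat 6 0,
    (s.nat 7 k = l ∧ t ∈ Set.Icc (s.real 4 k) (s.real 5 k)) ∧ s.nat 8 k = σ l t ∧
    ∀ k' < k, ¬ (s.nat 7 k' = l ∧ t ∈ Set.Icc (s.real 4 k') (s.real 5 k'))

/-- The output value for the initial location `l`. -/
def outputAt (s : RealRAM.State) (l : Fin n) : ℝ := s.real 3 l

/-- The output value for the initial distribution of the game. -/
def outputInit (s : RealRAM.State) : ℝ := s.real 6 0

end MarkovGame

/-! Precision. Let `x` be the transient distribution of any scheduler and let `p` be the double net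
along one interval, so that `p'` is minus the optimal gradient at the linear approximation. By
duality (`IsTransient.sum_mul_sub`) the derivative of `∑ x p` is `∑ x (Q p + p')`. The linear and
the quadratic approximation differ by at most `2 * τ ^ 2`, and gradients of a normed game are
2-Lipschitz. If one player follows the net, the integrand therefore has the sign that favours this
player, up to `4 * ε ^ 2`, whatever the opponent does. Summed over `N` intervals the loss is at most
`δ = 4 * T ^ 3 / N ^ 2` (`sum_mul_doubleNet_le`). Applied to both players this gives `w - δ ≤
reachQuality ≤ value ≤ safeQuality ≤ w + δ`, so no separate determinacy result is needed. All errors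
are at most `2 * δ ≤ π` once `8 * T ^ 3 ≤ N ^ 2 * π`, and the least such `N` is of order `1 + T *
√(T / π)`.

Computation. Along one interval `p₁` is affine in `τ`, so the gradient of each action is a line in
`τ` plus a term common to all actions of the location (`IsNormed.drift_linStep_eq`). After a change
of sign at the safety player's locations, optimising means finding the upper envelope of these
lines. Sorting them by slope and scanning with a stack yields the envelope; integrating its pieces
yields `p₂` exactly (`quadStep_eq_of_pieces`), and the pieces are the rows of the strategy table
(`IsNormed.optimal_of_hullInv`). An interval costs a pass over the transitions for the coefficients
and `W * log W` per location for sorting, where `W` is the least power of two that is at least the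
number of actions.

Verification. `Runs` gives Hoare triples with a step bound, and `Agree` is the frame rule. The
algorithms are proved on pure invariants, `MergeInv` and `HullInv`, to which the memory is then
matched. The pieces are assembled in `runs_stepProg` and `runs_solverProg`. -/

namespace MarkovGame

/-! ### Optimal gradients and a priori bounds for double nets -/

section analysis

open MeasureTheory

variable {L A : Type} [Fintype L] [Fintype A]

theorem rate_cast_nonneg (M : MarkovGame L A) (l : L) (a : A) (l' : L) :
    (0 : ℝ) ≤ M.rate l a l' := by
  exact_mod_cast M.rate_nonneg l a l'

theorem IsNormed.sum_rate {M : MarkovGame L A} (hM : M.IsNormed) {l : L} {a : A}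
    (ha : a ∈ M.enabled l) : ∑ l', (M.rate l a l' : ℝ) = 1 := by
  exact_mod_cast hM l a ha

theorem IsNormed.sum_rate_mul_le {M : MarkovGame L A} (hM : M.IsNormed) {l : L} {a : A}
    (ha : a ∈ M.enabled l) {x : L → ℝ} {d : ℝ} (h : ∀ l', x l' ≤ d) :
    ∑ l', (M.rate l a l' : ℝ) * x l' ≤ d := by
  calc ∑ l', (M.rate l a l' : ℝ) * x l' ≤ ∑ l', (M.rate l a l' : ℝ) * d :=
        Finset.sum_le_sum fun l' _ => mul_le_mul_of_nonneg_left (h l') (M.rate_cast_nonneg _ _ _)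
    _ = d := by rw [← Finset.sum_mul, hM.sum_rate ha, one_mul]

variable [DecidableEq L]

theorem exists_eq_opt (M : MarkovGame L A) (l : L) (q : A → ℝ) :
    ∃ a ∈ M.enabled l, q a = M.opt l q := by
  unfold opt
  split_ifs
  · obtain ⟨a, ha, h⟩ := Finset.exists_mem_eq_sup' (M.enabled_nonempty l) q
    exact ⟨a, ha, h.symm⟩
  · obtain ⟨a, ha, h⟩ := Finset.exists_mem_eq_inf' (M.enabled_nonempty l) q
    exact ⟨a, ha, h.symm⟩

theorem le_opt (M : MarkovGame L A) {l : L} (hl : l ∈ M.reach) (q : A → ℝ) {a : A}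
    (ha : a ∈ M.enabled l) : q a ≤ M.opt l q := by
  rw [opt, if_pos hl]
  exact Finset.le_sup' q ha

theorem opt_le (M : MarkovGame L A) {l : L} (hl : l ∉ M.reach) (q : A → ℝ) {a : A}
    (ha : a ∈ M.enabled l) : M.opt l q ≤ q a := by
  rw [opt, if_neg hl]
  exact Finset.inf'_le q ha

/-- Treats maximum and minimum at once: compare at an optimiser of `q` for the reachability player
and at an optimiser of `q'` for the safety player. All later estimates of `opt` choose a suitable
affine `f`. -/
theorem map_opt_le (M : MarkovGame L A) {l : L} {f : ℝ → ℝ} (hf : Monotone f) {q q' : A → ℝ}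
    (h : ∀ a ∈ M.enabled l, f (q a) ≤ q' a) : f (M.opt l q) ≤ M.opt l q' := by
  by_cases hl : l ∈ M.reach
  · obtain ⟨a, ha, hq⟩ := M.exists_eq_opt l q
    rw [← hq]
    exact (h a ha).trans (M.le_opt hl q' ha)
  · obtain ⟨a, ha, hq⟩ := M.exists_eq_opt l q'
    rw [← hq]
    exact (hf (M.opt_le hl q ha)).trans (h a ha)

theorem opt_le_map (M : MarkovGame L A) {l : L} {f : ℝ → ℝ} (hf : Monotone f) {q q' : A → ℝ}
    (h : ∀ a ∈ M.enabled l, q' a ≤ f (q a)) : M.opt l q' ≤ f (M.opt l q) := by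
  by_cases hl : l ∈ M.reach
  · obtain ⟨a, ha, hq⟩ := M.exists_eq_opt l q'
    rw [← hq]
    exact (h a ha).trans (hf (M.le_opt hl q ha))
  · obtain ⟨a, ha, hq⟩ := M.exists_eq_opt l q
    rw [← hq]
    exact (M.opt_le hl q' ha).trans (h a ha)

theorem sum_gen (M : MarkovGame L A) (l : L) (a : A) : ∑ l', M.gen l a l' = 0 := by
  rw [← Finset.add_sum_erase _ _ (Finset.mem_univ l), gen, if_pos rfl, neg_add_eq_zero]
  refine Finset.sum_congr rfl fun l' h => ?_
  rw [gen, if_neg (Finset.ne_of_mem_erase h)]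

theorem IsNormed.gen_eq {M : MarkovGame L A} (hM : M.IsNormed) {l : L} {a : A}
    (ha : a ∈ M.enabled l) (l' : L) :
    M.gen l a l' = (M.rate l a l' : ℝ) - if l' = l then 1 else 0 := by
  unfold gen
  split_ifs with h
  · subst h
    have h1 := hM l' a ha
    rw [← Finset.add_sum_erase _ _ (Finset.mem_univ l')] at h1
    have h2 : (M.rate l' a l' : ℝ) + ∑ l'' ∈ Finset.univ.erase l', (M.rate l' a l'' : ℝ) = 1 := by
      exact_mod_cast h1
    linarith
  · simp

theorem IsNormed.drift_eq {M : MarkovGame L A} (hM : M.IsNormed) {l : L} {a : A}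
    (ha : a ∈ M.enabled l) (x : L → ℝ) :
    M.drift l x a = ∑ l', (M.rate l a l' : ℝ) * x l' - x l := by
  simp [drift, hM.gen_eq ha, sub_mul, Finset.sum_sub_distrib]

theorem drift_sub (M : MarkovGame L A) (l : L) (x y : L → ℝ) (a : A) :
    M.drift l (x - y) a = M.drift l x a - M.drift l y a := by
  simp [drift, mul_sub, Finset.sum_sub_distrib]

/-- In a normed game the drift is a weighted average of `x` minus `x l`. Each of the two terms is
1-Lipschitz in the sup distance, hence the factor 2. -/
theorem IsNormed.abs_drift_sub_le {M : MarkovGame L A} (hM : M.IsNormed) {l : L} {a : A}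
    (ha : a ∈ M.enabled l) {x y : L → ℝ} {d : ℝ} (h : ∀ l', |x l' - y l'| ≤ d) :
    |M.drift l x a - M.drift l y a| ≤ 2 * d := by
  rw [← drift_sub, hM.drift_eq ha]
  have h1 := hM.sum_rate_mul_le ha (x := x - y) (d := d) fun l' => (abs_le.1 (h l')).2
  have h2 := hM.sum_rate_mul_le ha (x := -(x - y)) (d := d) fun l' => by
    simpa using neg_le.1 (abs_le.1 (h l')).1
  have h3 : ∑ l', (M.rate l a l' : ℝ) * (-(x - y)) l' =
      -∑ l', (M.rate l a l' : ℝ) * (x - y) l' := by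
    simp only [Pi.neg_apply, mul_neg, Finset.sum_neg_distrib]
  have h4 := abs_le.1 (h l)
  rw [Pi.sub_apply, abs_le]
  constructor <;> linarith

theorem IsNormed.abs_opt_drift_sub_le {M : MarkovGame L A} (hM : M.IsNormed) {l : L}
    {x y : L → ℝ} {d : ℝ} (h : ∀ l', |x l' - y l'| ≤ d) :
    |M.opt l (M.drift l x) - M.opt l (M.drift l y)| ≤ 2 * d := by
  have h1 := M.map_opt_le (l := l) (f := fun z => z - 2 * d) (q := M.drift l y) (q' := M.drift l x)
    (fun _ _ hab => sub_le_sub_right hab _) fun a ha => by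
      have := (abs_le.1 (hM.abs_drift_sub_le ha h)).1
      show _ - _ ≤ _
      linarith
  have h2 := M.opt_le_map (l := l) (f := fun z => z + 2 * d) (q := M.drift l y) (q' := M.drift l x)
    (fun _ _ hab => add_le_add_left hab _) fun a ha => by
      have := (abs_le.1 (hM.abs_drift_sub_le ha h)).2
      show _ ≤ _ + _
      linarith
  rw [abs_le]
  constructor <;> linarith

theorem continuous_opt_drift_linStep (M : MarkovGame L A) (x : L → ℝ) (l : L) :
    Continuous fun s => M.opt l (M.drift l (M.linStep x s)) := by
  have h : ∀ a, Continuous fun s => M.drift l (M.linStep x s) a := by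
    intro a
    unfold drift linStep
    fun_prop
  unfold opt
  split_ifs
  · exact Continuous.finset_sup'_apply _ fun a _ => h a
  · exact Continuous.finset_inf'_apply _ fun a _ => h a

/-- For values in `[0, 1]` the gradient lies in `[-x l, 1 - x l]`. -/
theorem IsNormed.opt_drift_mem {M : MarkovGame L A} (hM : M.IsNormed) {x : L → ℝ}
    (hx : ∀ l, x l ∈ Set.Icc 0 1) (l : L) :
    M.opt l (M.drift l x) ∈ Set.Icc (-x l) (1 - x l) := by
  obtain ⟨a, ha, h⟩ := M.exists_eq_opt l (M.drift l x)
  rw [← h, hM.drift_eq ha]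
  have h1 := hM.sum_rate_mul_le ha (x := x) (d := 1) fun l' => (hx l').2
  have h2 : 0 ≤ ∑ l', (M.rate l a l' : ℝ) * x l' :=
    Finset.sum_nonneg fun l' _ => mul_nonneg (M.rate_cast_nonneg _ _ _) (hx l').1
  constructor <;> linarith

/-- The values of `linStep x s` lie between `(1 - s) * x` and `(1 - s) * x + s`, so the same holds
for their averages. Adding `x l` to a drift recovers the average of `x`, which explains the affine
maps `f` below. -/
theorem IsNormed.opt_drift_linStep_bounds {M : MarkovGame L A} (hM : M.IsNormed) {x : L → ℝ}
    (hx : ∀ l, x l ∈ Set.Icc 0 1) (l : L) {s : ℝ} (hs : s ∈ Set.Icc 0 1) :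
    (1 - 2 * s) * M.opt l (M.drift l x) - s * x l ≤ M.opt l (M.drift l (M.linStep x s)) ∧
    M.opt l (M.drift l (M.linStep x s)) ≤
      (1 - 2 * s) * M.opt l (M.drift l x) + s * (1 - x l) := by
  set u := M.opt l (M.drift l x) with hu
  have hs1 : 0 ≤ 1 - s := by linarith [hs.2]
  have hlo : ∀ l', (1 - s) * x l' ≤ M.linStep x s l' := fun l' => by
    have h := mul_le_mul_of_nonneg_left (hM.opt_drift_mem hx l').1 hs.1
    unfold linStep
    linarith
  have hhi : ∀ l', M.linStep x s l' ≤ (1 - s) * x l' + s := fun l' => by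
    have h := mul_le_mul_of_nonneg_left (hM.opt_drift_mem hx l').2 hs.1
    unfold linStep
    linarith
  have hl : M.linStep x s l = x l + s * u := rfl
  constructor
  · have h := M.map_opt_le (l := l) (f := fun z => (1 - s) * (z + x l) - (x l + s * u))
      (q := M.drift l x) (q' := M.drift l (M.linStep x s))
      (fun z z' hz => by
        have := mul_le_mul_of_nonneg_left hz hs1
        show _ - _ ≤ _ - _
        linarith) fun a ha => by
        rw [hM.drift_eq ha, hM.drift_eq ha, hl]
        simp only [sub_add_cancel]
        rw [Finset.mul_sum]
        refine sub_le_sub_right (Finset.sum_le_sum fun l' _ => ?_) _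
        have := mul_le_mul_of_nonneg_left (hlo l') (M.rate_cast_nonneg l a l')
        linarith
    simp only [← hu] at h
    linarith
  · have h := M.opt_le_map (l := l) (f := fun z => (1 - s) * (z + x l) + s - (x l + s * u))
      (q := M.drift l x) (q' := M.drift l (M.linStep x s))
      (fun z z' hz => by
        have := mul_le_mul_of_nonneg_left hz hs1
        show _ - _ ≤ _ - _
        linarith) fun a ha => by
        rw [hM.drift_eq ha, hM.drift_eq ha, hl]
        simp only [sub_add_cancel]
        have h1 : s = ∑ l', (M.rate l a l' : ℝ) * s := by
          rw [← Finset.sum_mul, hM.sum_rate ha, one_mul]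
        refine sub_le_sub_right ?_ _
        conv_rhs => rw [Finset.mul_sum, h1, ← Finset.sum_add_distrib]
        refine Finset.sum_le_sum fun l' _ => ?_
        rw [← h1]
        have := mul_le_mul_of_nonneg_left (hhi l') (M.rate_cast_nonneg l a l')
        linarith
    simp only [← hu] at h
    linarith

/-- The bounds on the gradient integrate to quadratic polynomials in `τ`. With the gradient at `x`
in `[-x l, 1 - x l]`, the distances to `0` and `1` are at least `x l` and `1 - x l` times `1 - τ + τ
^ 2 / 2`, which is positive. -/
theorem IsNormed.quadStep_mem {M : MarkovGame L A} (hM : M.IsNormed) {x : L → ℝ}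
    (hx : ∀ l, x l ∈ Set.Icc 0 1) {τ : ℝ} (hτ : τ ∈ Set.Icc 0 1) (l : L) :
    M.quadStep x τ l ∈ Set.Icc 0 1 := by
  have hi : ∀ c d : ℝ, ∫ s in (0 : ℝ)..τ, ((1 - 2 * s) * c + s * d) =
      (τ - τ ^ 2) * c + τ ^ 2 / 2 * d := by
    intro c d
    rw [intervalIntegral.integral_add (by apply Continuous.intervalIntegrable; fun_prop)
      (by apply Continuous.intervalIntegrable; fun_prop), intervalIntegral.integral_mul_const,
      intervalIntegral.integral_mul_const, intervalIntegral.integral_sub (by simp)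
      (by apply Continuous.intervalIntegrable; fun_prop), intervalIntegral.integral_const_mul,
      integral_id]
    simp only [intervalIntegral.integral_const, smul_eq_mul]
    ring
  have hc := (M.continuous_opt_drift_linStep x l).intervalIntegrable (μ := volume) 0 τ
  have h1 := intervalIntegral.integral_mono_on hτ.1
    (f := fun s => (1 - 2 * s) * M.opt l (M.drift l x) + s * (-x l))
    (by apply Continuous.intervalIntegrable; fun_prop) hc fun s hs => by
      have := (hM.opt_drift_linStep_bounds hx l ⟨hs.1, hs.2.trans hτ.2⟩).1
      linarith
  have h2 := intervalIntegral.integral_mono_on hτ.1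
    (g := fun s => (1 - 2 * s) * M.opt l (M.drift l x) + s * (1 - x l)) hc
    (by apply Continuous.intervalIntegrable; fun_prop) fun s hs =>
      (hM.opt_drift_linStep_bounds hx l ⟨hs.1, hs.2.trans hτ.2⟩).2
  rw [hi] at h1 h2
  have hu := hM.opt_drift_mem hx l
  -- This is where `τ ≤ 1` is used: the coefficient of the gradient must not be negative.
  have hτ2 : 0 ≤ τ - τ ^ 2 := by nlinarith [hτ.1, hτ.2]
  have h3 := mul_le_mul_of_nonneg_left hu.1 hτ2
  have h4 := mul_le_mul_of_nonneg_left hu.2 hτ2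
  have hx0 := (hx l).1
  have hx1 := sub_nonneg.2 (hx l).2
  have hq : 0 ≤ 1 - τ + τ ^ 2 / 2 := by nlinarith [sq_nonneg (τ - 1)]
  have h5 := mul_nonneg hx0 hq
  have h6 := mul_nonneg hx1 hq
  unfold quadStep
  constructor <;> linarith

theorem IsNormed.doubleNet_mem {M : MarkovGame L A} (hM : M.IsNormed) (G : Finset L) {ε : ℝ}
    (hε : ε ∈ Set.Icc 0 1) (j : ℕ) (l : L) : M.doubleNet G ε j l ∈ Set.Icc 0 1 := by
  induction j generalizing l with
  | zero => unfold doubleNet; split_ifs <;> simp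
  | succ j ih => exact hM.quadStep_mem ih hε l

/-- The two approximations of a double net differ by a quantity of second order. -/
theorem IsNormed.abs_quadStep_sub_linStep_le {M : MarkovGame L A} (hM : M.IsNormed) {x : L → ℝ}
    (hx : ∀ l, x l ∈ Set.Icc 0 1) {τ : ℝ} (hτ : 0 ≤ τ) (l : L) :
    |M.quadStep x τ l - M.linStep x τ l| ≤ 2 * τ ^ 2 := by
  -- The gradient at `x` has modulus at most 1, so `linStep` moves by at most `τ`. The 2-Lipschitz
  -- bound and an integration over length `τ` then give `2 * τ ^ 2`.
  have h1 : ∀ s ∈ Set.Icc 0 τ, ∀ l', |M.linStep x s l' - x l'| ≤ τ := by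
    intro s hs l'
    have hu := hM.opt_drift_mem hx l'
    have hl := hx l'
    rw [linStep, add_sub_cancel_left, abs_mul, abs_of_nonneg hs.1]
    have : |M.opt l' (M.drift l' x)| ≤ 1 := by
      rw [abs_le]
      constructor <;> linarith [hu.1, hu.2, hl.1, hl.2]
    nlinarith [hs.1, hs.2]
  have h2 : M.quadStep x τ l - M.linStep x τ l =
      ∫ s in (0 : ℝ)..τ, (M.opt l (M.drift l (M.linStep x s)) - M.opt l (M.drift l x)) := by
    rw [intervalIntegral.integral_sub
      ((M.continuous_opt_drift_linStep x l).intervalIntegrable 0 τ) (by simp)]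
    simp [quadStep, linStep]
  rw [h2]
  have h3 := intervalIntegral.norm_integral_le_of_norm_le_const (a := 0) (b := τ) (C := 2 * τ)
    (f := fun s => M.opt l (M.drift l (M.linStep x s)) - M.opt l (M.drift l x)) fun s hs => by
      rw [Set.uIoc_of_le hτ] at hs
      exact hM.abs_opt_drift_sub_le (h1 s ⟨hs.1.le, hs.2⟩)
  rw [sub_zero, abs_of_nonneg hτ, Real.norm_eq_abs] at h3
  linarith

end analysis

end MarkovGame

/-! ### Transient distributions: duality, conservation of mass, nonnegativity -/

namespace MarkovGame

section transient

open MeasureTheory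

/-- The product rule for primitives of integrable functions. -/
theorem mul_sub_mul_eq_integral {f g f' g' : ℝ → ℝ} {a b : ℝ} (hab : a ≤ b)
    (hf' : IntervalIntegrable f' volume a b) (hg' : IntervalIntegrable g' volume a b)
    (hf : ∀ t ∈ Set.Icc a b, f t = f a + ∫ s in a..t, f' s)
    (hg : ∀ t ∈ Set.Icc a b, g t = g a + ∫ s in a..t, g' s) :
    f b * g b - f a * g a = ∫ s in a..b, (f' s * g s + f s * g' s) := by
  -- The integrands are merely integrable, so the product rule is available only almost everywhere.
  -- Absolute continuity of the primitives makes this sufficient.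
  have hAC : ∀ (c : ℝ) {h : ℝ → ℝ}, IntervalIntegrable h volume a b →
      AbsolutelyContinuousOnInterval (fun t => c + ∫ s in a..t, h s) a b := fun c h hh =>
    ((LipschitzWith.const c).lipschitzOnWith.absolutelyContinuousOnInterval).fun_add
      (hh.absolutelyContinuousOnInterval_intervalIntegral Set.left_mem_uIcc)
  have hd : ∀ (c : ℝ) {h : ℝ → ℝ}, IntervalIntegrable h volume a b →
      ∀ᵐ x, x ∈ Set.uIcc a b → deriv (fun t => c + ∫ s in a..t, h s) x = h x := fun c h hh => by
    filter_upwards [hh.ae_hasDerivAt_integral] with x hx hxab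
    exact ((hx hxab a Set.left_mem_uIcc).const_add c).deriv
  have hend : ∀ t ∈ Set.Icc a b, f t * g t =
      (f a + ∫ s in a..t, f' s) * (g a + ∫ s in a..t, g' s) := fun t ht => by
    rw [hf t ht, hg t ht]
  rw [hend b ⟨hab, le_rfl⟩, hend a ⟨le_rfl, hab⟩,
    ← (hAC (f a) hf').integral_deriv_mul_eq_sub (hAC (g a) hg')]
  refine intervalIntegral.integral_congr_ae ?_
  filter_upwards [hd (f a) hf', hd (g a) hg'] with x h1 h2 hx
  have hx' := Set.uIoc_subset_uIcc hx
  have hx'' : x ∈ Set.Icc a b := by rwa [Set.uIcc_of_le hab] at hx'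
  rw [h1 hx', h2 hx', hf x hx'', hg x hx'']

variable {L A : Type} [Fintype L] [Fintype A]

theorem IsStrategy.intervalIntegrable_comp {M : MarkovGame L A} {P : Set L} {T : ℝ}
    {σ : L → ℝ → A} (hσ : M.IsStrategy P T σ) {l : L} (hl : l ∈ P) (φ : A → ℝ) {a b : ℝ}
    (ha : 0 ≤ a) (hab : a ≤ b) (hb : b ≤ T) :
    IntervalIntegrable (fun s => φ (σ l s)) volume a b := by
  classical
  have h : IntegrableOn (fun s => φ (σ l s)) (Set.Icc 0 T) := by
    -- A strategy is measurable through its fibres; the composition is a finite sum of indicators of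
    -- these.
    have h1 : IntegrableOn (fun s => ∑ c, Set.indicator {t | t ∈ Set.Icc 0 T ∧ σ l t = c}
        (fun _ => φ c) s) (Set.Icc 0 T) :=
      integrable_finsetSum _ fun c _ => Integrable.indicator (by simp) ((hσ l hl).2 c)
    refine h1.congr_fun (fun s hs => ?_) measurableSet_Icc
    simp only
    rw [Finset.sum_eq_single (σ l s)]
    · exact Set.indicator_of_mem (by exact ⟨hs, rfl⟩) _
    · intro c _ hc
      exact Set.indicator_of_notMem (fun h => hc h.2.symm) _
    · simp
  rw [intervalIntegrable_iff_integrableOn_Icc_of_le hab]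
  exact h.mono_set (Set.Icc_subset_Icc ha hb)

variable [DecidableEq L]

theorem IsStrategy.scheduler {M : MarkovGame L A} {T : ℝ} {σr σs : L → ℝ → A}
    (hr : M.IsStrategy {l | l ∈ M.reach} T σr) (hs : M.IsStrategy {l | l ∉ M.reach} T σs) :
    M.IsStrategy Set.univ T (M.scheduler σr σs) := by
  intro l _
  by_cases hl : l ∈ M.reach
  · simpa [MarkovGame.scheduler, hl] using hr l hl
  · simpa [MarkovGame.scheduler, hl] using hs l hl

theorem IsStrategy.isTransient {M : MarkovGame L A} {T : ℝ} (hT : 0 ≤ T) {σ : L → ℝ → A}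
    (hσ : M.IsStrategy Set.univ T σ) (μ : L → ℝ) : M.IsTransient T σ μ (M.transient T σ μ) :=
  (M.isTransient_transient hT (fun l => (hσ l trivial).2) μ).1

theorem IsTransient.continuousOn_apply {M : MarkovGame L A} {T : ℝ} {σ : L → ℝ → A} {μ : L → ℝ}
    {x : ℝ → L → ℝ} (hx : M.IsTransient T σ μ x) (l : L) :
    ContinuousOn (fun t => x t l) (Set.Icc 0 T) :=
  (continuous_apply l).comp_continuousOn hx.1

theorem IsTransient.intervalIntegrable {M : MarkovGame L A} {T : ℝ} {σ : L → ℝ → A} {μ : L → ℝ}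
    {x : ℝ → L → ℝ} (hσ : M.IsStrategy Set.univ T σ) (hx : M.IsTransient T σ μ x) (l : L)
    {a b : ℝ} (ha : 0 ≤ a) (hab : a ≤ b) (hb : b ≤ T) :
    IntervalIntegrable (fun s => ∑ l', x s l' * M.gen l' (σ l' s) l) volume a b := by
  have h := IntervalIntegrable.sum (μ := volume) (a := a) (b := b) Finset.univ
    (f := fun l' s => x s l' * M.gen l' (σ l' s) l) fun l' _ =>
      (hσ.intervalIntegrable_comp (l := l') trivial (fun c => M.gen l' c l) ha hab hb
        ).continuousOn_mul ((hx.continuousOn_apply l').mono (by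
          rw [Set.uIcc_of_le hab]; exact Set.Icc_subset_Icc ha hb))
  refine h.congr fun s _ => ?_
  simp

theorem IsTransient.eq_add_integral {M : MarkovGame L A} {T : ℝ} {σ : L → ℝ → A} {μ : L → ℝ}
    {x : ℝ → L → ℝ} (hσ : M.IsStrategy Set.univ T σ) (hx : M.IsTransient T σ μ x) (l : L)
    {a t : ℝ} (ha : 0 ≤ a) (hat : a ≤ t) (ht : t ≤ T) :
    x t l = x a l + ∫ s in a..t, ∑ l', x s l' * M.gen l' (σ l' s) l := by
  rw [hx.2 t ⟨ha.trans hat, ht⟩ l, hx.2 a ⟨ha, hat.trans ht⟩ l, add_assoc,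
    intervalIntegral.integral_add_adjacent_intervals
      (hx.intervalIntegrable hσ l le_rfl ha (hat.trans ht))
      (hx.intervalIntegrable hσ l ha hat ht)]

/-- Duality between the forward equation of the transient distributions and functions with a given
derivative. -/
theorem IsTransient.sum_mul_sub {M : MarkovGame L A} {T : ℝ} {σ : L → ℝ → A} {μ : L → ℝ}
    {x : ℝ → L → ℝ} (hσ : M.IsStrategy Set.univ T σ) (hx : M.IsTransient T σ μ x)
    {a b : ℝ} (ha : 0 ≤ a) (hab : a ≤ b) (hb : b ≤ T) {p p' : ℝ → L → ℝ}
    (hp' : ∀ l, IntervalIntegrable (fun s => p' s l) volume a b)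
    (hp : ∀ l, ∀ t ∈ Set.Icc a b, p t l = p a l + ∫ s in a..t, p' s l) :
    (∑ l, x b l * p b l) - ∑ l, x a l * p a l =
      ∫ s in a..b, ∑ l, x s l * (M.drift l (p s) (σ l s) + p' s l) := by
  have hsub : Set.uIcc a b ⊆ Set.Icc 0 T := by
    rw [Set.uIcc_of_le hab]; exact Set.Icc_subset_Icc ha hb
  have hpc : ∀ l, ContinuousOn (fun s => p s l) (Set.uIcc a b) := fun l => by
    have h := (continuousOn_const (c := p a l)).add
      (intervalIntegral.continuousOn_primitive_interval ((intervalIntegrable_iff' (by simp)).1 (hp' l)))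
    rw [Set.uIcc_of_le hab] at h ⊢
    exact h.congr (hp l)
  rw [← Finset.sum_sub_distrib]
  have h1 : ∀ l, x b l * p b l - x a l * p a l = ∫ s in a..b,
      ((∑ l', x s l' * M.gen l' (σ l' s) l) * p s l + x s l * p' s l) := fun l =>
    mul_sub_mul_eq_integral (f := fun s => x s l) (g := fun s => p s l) hab
      (hx.intervalIntegrable hσ l ha hab hb) (hp' l)
      (fun t ht => hx.eq_add_integral hσ l ha ht.1 (ht.2.trans hb)) (hp l)
  rw [Finset.sum_congr rfl fun l _ => h1 l, ← intervalIntegral.integral_finsetSum fun l _ =>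
    ((hx.intervalIntegrable hσ l ha hab hb).mul_continuousOn (hpc l)).add
      ((hp' l).continuousOn_mul ((hx.continuousOn_apply l).mono hsub))]
  refine intervalIntegral.integral_congr fun s _ => ?_
  simp only [drift, mul_add, Finset.sum_add_distrib, Finset.sum_mul, Finset.mul_sum]
  rw [Finset.sum_comm]
  simp only [mul_assoc]

/-- Duality with the constant test function 1, on which `Q` vanishes because its rows sum to zero.
-/
theorem IsTransient.sum_eq {M : MarkovGame L A} {T : ℝ} {σ : L → ℝ → A} {μ : L → ℝ}
    {x : ℝ → L → ℝ} (hσ : M.IsStrategy Set.univ T σ) (hx : M.IsTransient T σ μ x)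
    {t : ℝ} (ht : t ∈ Set.Icc 0 T) : ∑ l, x t l = ∑ l, μ l := by
  have h := hx.sum_mul_sub hσ le_rfl ht.1 ht.2 (p := fun _ _ => 1) (p' := fun _ _ => 0)
    (by simp) (by simp)
  have h0 : ∀ l, x 0 l = μ l := fun l => by
    rw [hx.2 0 ⟨le_rfl, ht.1.trans ht.2⟩ l]; simp
  simpa [drift, sum_gen, sub_eq_zero, h0] using h

/-- In a normed game `Q` is the rate matrix minus the identity. Multiplication by `exp t` removes
the identity and leaves an equation with nonnegative coefficients, for which the negative part can
be controlled by a Gronwall argument. -/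
theorem IsTransient.nonneg {M : MarkovGame L A} (hM : M.IsNormed) {T : ℝ} {σ : L → ℝ → A}
    {μ : L → ℝ} (hμ : ∀ l, 0 ≤ μ l) {x : ℝ → L → ℝ} (hσ : M.IsStrategy Set.univ T σ)
    (hx : M.IsTransient T σ μ x) {t : ℝ} (ht : t ∈ Set.Icc 0 T) (l : L) : 0 ≤ x t l := by
  have hT : 0 ≤ T := ht.1.trans ht.2
  set y : ℝ → L → ℝ := fun t l => Real.exp t * x t l with hy
  have hyc : ∀ l, ContinuousOn (fun t => y t l) (Set.Icc 0 T) := fun l =>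
    Real.continuous_exp.continuousOn.mul (hx.continuousOn_apply l)
  have hint : ∀ (z : ℝ → L → ℝ), (∀ l, ContinuousOn (fun t => z t l) (Set.Icc 0 T)) →
      ∀ t ∈ Set.Icc 0 T, ∀ l, IntervalIntegrable
        (fun s => ∑ l', z s l' * (M.rate l' (σ l' s) l : ℝ)) volume 0 t := by
    intro z hz t ht l
    have h := IntervalIntegrable.sum (μ := volume) (a := 0) (b := t) Finset.univ
      (f := fun l' s => z s l' * (M.rate l' (σ l' s) l : ℝ)) fun l' _ =>
        (hσ.intervalIntegrable_comp (l := l') trivial (fun c => (M.rate l' c l : ℝ)) le_rfl ht.1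
          ht.2).continuousOn_mul ((hz l').mono (by
            rw [Set.uIcc_of_le ht.1]; exact Set.Icc_subset_Icc le_rfl ht.2))
    refine h.congr fun s _ => ?_
    simp
  have hyint : ∀ t ∈ Set.Icc 0 T, ∀ l,
      y t l = μ l + ∫ s in (0 : ℝ)..t, ∑ l', y s l' * (M.rate l' (σ l' s) l : ℝ) := by
    intro t ht l
    have h := mul_sub_mul_eq_integral (f := Real.exp) (f' := Real.exp) (g := fun s => x s l) ht.1
      (Real.continuous_exp.intervalIntegrable 0 t) (hx.intervalIntegrable hσ l le_rfl ht.1 ht.2)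
      (by simp) (fun r hr => hx.eq_add_integral hσ l le_rfl hr.1 (hr.2.trans ht.2))
    have h0 : x 0 l = μ l := by rw [hx.2 0 ⟨le_rfl, hT⟩ l]; simp
    rw [Real.exp_zero, one_mul, h0] at h
    have h2 : y t l - μ l = ∫ s in (0 : ℝ)..t, ∑ l', y s l' * (M.rate l' (σ l' s) l : ℝ) := by
      rw [hy]
      simp only
      rw [h]
      refine intervalIntegral.integral_congr fun s hs => ?_
      rw [Set.uIcc_of_le ht.1] at hs
      have hs' : s ∈ Set.Icc 0 T := ⟨hs.1, hs.2.trans ht.2⟩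
      simp only [hM.gen_eq ((hσ _ trivial).1 s hs'), mul_sub, Finset.sum_sub_distrib]
      simp [Finset.mul_sum, mul_assoc]
    linarith
  -- The negative part of `y` is bounded by the integral of its own image under the rates. Since
  -- rates out of a location sum to 1, its total `n` satisfies `n t ≤ ∫ n`.
  set z : ℝ → L → ℝ := fun t l => max 0 (-y t l) with hz
  have hzc : ∀ l, ContinuousOn (fun t => z t l) (Set.Icc 0 T) := fun l =>
    continuousOn_const.sup (hyc l).neg
  have hz0 : ∀ t l, 0 ≤ z t l := fun t l => le_max_left _ _
  have hzle : ∀ t ∈ Set.Icc 0 T, ∀ l,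
      z t l ≤ ∫ s in (0 : ℝ)..t, ∑ l', z s l' * (M.rate l' (σ l' s) l : ℝ) := by
    intro t ht l
    refine max_le (intervalIntegral.integral_nonneg ht.1 fun s _ => Finset.sum_nonneg fun l' _ =>
      mul_nonneg (hz0 _ _) (M.rate_cast_nonneg _ _ _)) ?_
    have h := intervalIntegral.integral_mono_on ht.1 (hint y hyc t ht l).neg (hint z hzc t ht l)
      fun s _ => by
        simp only [Pi.neg_apply]
        rw [← Finset.sum_neg_distrib]
        refine Finset.sum_le_sum fun l' _ => ?_
        rw [← neg_mul]
        exact mul_le_mul_of_nonneg_right (le_max_right _ _) (M.rate_cast_nonneg _ _ _)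
    have h2 : (∫ s in (0 : ℝ)..t, (-fun s => ∑ l', y s l' * (M.rate l' (σ l' s) l : ℝ)) s) =
        -∫ s in (0 : ℝ)..t, ∑ l', y s l' * (M.rate l' (σ l' s) l : ℝ) := by
      rw [← intervalIntegral.integral_neg]; rfl
    rw [h2] at h
    rw [hyint t ht l]
    linarith [hμ l]
  set n : ℝ → ℝ := Set.IccExtend hT (fun t : Set.Icc 0 T => ∑ l, z t l) with hn
  have hnt : ∀ t ∈ Set.Icc 0 T, n t = ∑ l, z t l := fun t ht => by
    rw [hn, Set.IccExtend_of_mem hT _ ht]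
  have hnc : Continuous n := by
    refine Continuous.Icc_extend' (continuous_finsetSum _ fun l _ => ?_)
    exact continuousOn_iff_continuous_domRestrict.1 (hzc l)
  have hn0 : ∀ t, 0 ≤ n t := fun t => Finset.sum_nonneg fun l _ => hz0 _ l
  have hnle : ∀ t ∈ Set.Icc 0 T, n t ≤ ∫ s in (0 : ℝ)..t, n s := by
    intro t ht
    rw [hnt t ht]
    refine (Finset.sum_le_sum fun l _ => hzle t ht l).trans (le_of_eq ?_)
    rw [← intervalIntegral.integral_finsetSum fun l _ => hint z hzc t ht l]
    refine intervalIntegral.integral_congr fun s hs => ?_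
    rw [Set.uIcc_of_le ht.1] at hs
    have hs' : s ∈ Set.Icc 0 T := ⟨hs.1, hs.2.trans ht.2⟩
    rw [Finset.sum_comm, hnt s hs']
    refine Finset.sum_congr rfl fun l' _ => ?_
    rw [← Finset.mul_sum, hM.sum_rate ((hσ l' trivial).1 s hs'), mul_one]
  -- Gronwall for the primitive of `n`, which starts at 0 and has derivative at most itself: it
  -- vanishes, and with it the negative part.
  have hI := norm_le_gronwallBound_of_norm_deriv_right_le (E := ℝ) (δ := 0) (K := 1) (ε := 0)
    (f := fun t => ∫ s in (0 : ℝ)..t, n s) (f' := n) (a := 0) (b := T)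
    (intervalIntegral.continuous_primitive (fun a b => hnc.intervalIntegrable a b) 0).continuousOn
    (fun t _ => (intervalIntegral.integral_hasDerivAt_right (hnc.intervalIntegrable 0 t)
      (hnc.stronglyMeasurableAtFilter _ _) hnc.continuousAt).hasDerivWithinAt) (by simp)
    (fun t ht => by
      have h1 := hnle t ⟨ht.1, ht.2.le⟩
      rw [Real.norm_of_nonneg (hn0 t), Real.norm_of_nonneg ((hn0 t).trans h1)]
      linarith) t ht
  rw [gronwallBound_ε0_δ0] at hI
  have h1 := (hnle t ht).trans ((le_abs_self _).trans hI)
  rw [hnt t ht] at h1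
  have h2 : z t l ≤ 0 :=
    (Finset.single_le_sum (f := fun l => z t l) (fun l _ => hz0 t l) (Finset.mem_univ l)).trans h1
  have h3 : -y t l ≤ 0 := (le_max_right _ _).trans h2
  have h4 : 0 ≤ Real.exp t * x t l := by linarith
  exact nonneg_of_mul_nonneg_right h4 (Real.exp_pos t)

end transient

end MarkovGame

/-! ### Error analysis of the double net -/

namespace MarkovGame

section precision

open MeasureTheory

variable {L A : Type} [Fintype L] [Fintype A] [DecidableEq L]

/-- Along one interval of a double net, a scheduler whose choices are at least as good as the optimal
ones (for the reachability player if `κ = 1`, for the safety player if `κ = -1`) loses at most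
`4 * ε ^ 3`. -/
theorem IsTransient.sum_mul_quadStep_le {M : MarkovGame L A} (hM : M.IsNormed) {T : ℝ}
    {σ : L → ℝ → A} {μ : L → ℝ} (hμ : μ ∈ stdSimplex ℝ L) {x : ℝ → L → ℝ}
    (hσ : M.IsStrategy Set.univ T σ) (hx : M.IsTransient T σ μ x) {v : L → ℝ}
    (hv : ∀ l, v l ∈ Set.Icc 0 1) {b ε κ : ℝ} (hε : 0 ≤ ε) (hb : b ∈ Set.Icc 0 T)
    (ha : 0 ≤ b - ε) (hκ : κ = 1 ∨ κ = -1)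
    (hopt : ∀ s ∈ Set.Ioo (b - ε) b, ∀ l, κ * M.opt l (M.drift l (M.linStep v (b - s))) ≤
      κ * M.drift l (M.linStep v (b - s)) (σ l s)) :
    κ * (∑ l, x (b - ε) l * M.quadStep v ε l) - 4 * ε ^ 3 ≤ κ * ∑ l, x b l * v l := by
  have hab : b - ε ≤ b := by linarith
  have hc : ∀ l, Continuous fun s => -M.opt l (M.drift l (M.linStep v (b - s))) := fun l =>
    ((M.continuous_opt_drift_linStep v l).comp (continuous_const.sub continuous_id)).neg
  have hi : ∀ l t, ∫ s in (b - ε)..t, -M.opt l (M.drift l (M.linStep v (b - s))) =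
      -∫ s in (b - t)..ε, M.opt l (M.drift l (M.linStep v s)) := by
    intro l t
    rw [intervalIntegral.integral_neg, intervalIntegral.integral_comp_sub_left
      (fun s => M.opt l (M.drift l (M.linStep v s))), sub_sub_cancel]
  -- The test function is the net itself, run backwards from the value `v` at time `b`.
  have h := hx.sum_mul_sub hσ ha hab hb.2 (p := fun s => M.quadStep v (b - s))
    (p' := fun s l => -M.opt l (M.drift l (M.linStep v (b - s))))
    (fun l => (hc l).intervalIntegrable _ _) fun l t _ => by
      rw [hi, quadStep, quadStep, sub_sub_cancel]
      have hci := fun c d => (M.continuous_opt_drift_linStep v l).intervalIntegrable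
        (μ := volume) c d
      rw [← intervalIntegral.integral_add_adjacent_intervals (hci 0 (b - t)) (hci (b - t) ε)]
      ring
  have hq0 : M.quadStep v (b - b) = v := by ext l; simp [quadStep]
  simp only [sub_sub_cancel] at h
  rw [hq0] at h
  have hlow : -(4 * ε ^ 3) ≤ κ * ∫ s in (b - ε)..b, ∑ l, x s l *
      (M.drift l (M.quadStep v (b - s)) (σ l s) +
        -M.opt l (M.drift l (M.linStep v (b - s)))) := by
    rw [← intervalIntegral.integral_const_mul]
    -- Integrability need not be proved: otherwise the integral is 0 by convention and the bound is
    -- trivial.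
    by_cases hint : IntervalIntegrable (fun s => κ * ∑ l, x s l *
      (M.drift l (M.quadStep v (b - s)) (σ l s) +
        -M.opt l (M.drift l (M.linStep v (b - s))))) volume (b - ε) b
    · have h1 := intervalIntegral.integral_mono_on_of_le_Ioo hab
        (f := fun _ => -(4 * ε ^ 2)) (by simp) hint fun s hs => by
          have hs' : s ∈ Set.Icc 0 T := ⟨ha.trans hs.1.le, hs.2.le.trans hb.2⟩
          have hτ : 0 ≤ b - s := by linarith [hs.2]
          have hτ2 : (b - s) ^ 2 ≤ ε ^ 2 := pow_le_pow_left₀ hτ (by linarith [hs.1]) 2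
          calc -(4 * ε ^ 2) = ∑ l, x s l * -(4 * ε ^ 2) := by
                rw [← Finset.sum_mul, hx.sum_eq hσ hs', hμ.2, one_mul]
            _ ≤ ∑ l, x s l * (κ * (M.drift l (M.quadStep v (b - s)) (σ l s) +
                  -M.opt l (M.drift l (M.linStep v (b - s))))) := by
                refine Finset.sum_le_sum fun l _ => mul_le_mul_of_nonneg_left ?_
                  (hx.nonneg hM hμ.1 hσ hs' l)
                have h2 := hopt s hs l
                -- Replacing `quadStep` by `linStep` in the drift costs at most `2 * (2 * τ ^ 2)`.
                -- After that, `hopt` gives the sign.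
                have h3 := abs_le.1 (hM.abs_drift_sub_le ((hσ l trivial).1 s hs')
                  (fun l' => hM.abs_quadStep_sub_linStep_le hv hτ l'))
                rcases hκ with rfl | rfl <;> linarith [h3.1, h3.2]
            _ = _ := by
                rw [Finset.mul_sum]
                exact Finset.sum_congr rfl fun l _ => by ring
      refine le_trans (le_of_eq ?_) h1
      rw [intervalIntegral.integral_const, smul_eq_mul]
      ring
    · rw [intervalIntegral.integral_undef hint]
      have : 0 ≤ ε ^ 3 := by positivity
      linarith
  rw [← h, mul_sub] at hlow
  linarith

/-- A scheduler that is at least as good as the optimal choices of a double net, reaches the goal with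
the probability given by the net, up to the accumulated error. -/
theorem sum_mul_doubleNet_le {M : MarkovGame L A} (hM : M.IsNormed) {T : ℝ} (hT : 0 ≤ T)
    (G : Finset L) {σ : L → ℝ → A} {μ : L → ℝ} (hμ : μ ∈ stdSimplex ℝ L)
    (hσ : M.IsStrategy Set.univ T σ) {N : ℕ} (hN : 0 < N) (hTN : T ≤ N) {κ : ℝ}
    (hκ : κ = 1 ∨ κ = -1)
    (hopt : ∀ j < N, ∀ s ∈ Set.Ioo (T - j * (T / N) - T / N) (T - j * (T / N)), ∀ l,
      κ * M.opt l (M.drift l (M.linStep (M.doubleNet G (T / N) j) (T - j * (T / N) - s))) ≤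
      κ * M.drift l (M.linStep (M.doubleNet G (T / N) j) (T - j * (T / N) - s)) (σ l s)) :
    κ * (∑ l, μ l * M.doubleNet G (T / N) N l) - 4 * T ^ 3 / N ^ 2 ≤
      κ * ∑ l ∈ G, M.transient T σ μ T l := by
  have hN' : (0 : ℝ) < N := by exact_mod_cast hN
  set ε := T / N with hεdef
  have hNε : N * ε = T := by rw [hεdef]; field_simp
  have hε : 0 ≤ ε := by positivity
  have hε1 : ε ≤ 1 := by rw [hεdef, div_le_one hN']; exact hTN
  have hx := hσ.isTransient hT μ
  -- Going backwards from the goal indicator at time `T`, each interval adds one loss of `4 * ε ^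
  -- 3`; the end is the pairing of `μ` with the net at time 0.
  have hind : ∀ j ≤ N, κ * (∑ l, M.transient T σ μ (T - j * ε) l * M.doubleNet G ε j l) -
      j * (4 * ε ^ 3) ≤ κ * ∑ l, M.transient T σ μ T l * M.doubleNet G ε 0 l := by
    intro j
    induction j with
    | zero => simp
    | succ j ih =>
      intro hj
      have hjN : ((j : ℝ) + 1) * ε ≤ T := by
        rw [← hNε]
        exact mul_le_mul_of_nonneg_right (by exact_mod_cast hj) hε
      have hj0 : 0 ≤ j * ε := by positivity
      have h := hx.sum_mul_quadStep_le hM hμ hσ (hM.doubleNet_mem G ⟨hε, hε1⟩ j)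
        (b := T - j * ε) hε ⟨by linarith, by linarith⟩ (by linarith) hκ (hopt j hj)
      have h' := ih (by omega)
      have e : T - (j : ℝ) * ε - ε = T - ((j + 1 : ℕ) : ℝ) * ε := by push_cast; ring
      rw [e] at h
      have e' : M.doubleNet G ε (j + 1) = M.quadStep (M.doubleNet G ε j) ε := rfl
      rw [e']
      push_cast at h ⊢
      linarith
  have h := hind N le_rfl
  rw [hNε, sub_self] at h
  have h0 : ∀ l, M.transient T σ μ 0 l = μ l := fun l => by
    rw [hx.2 0 ⟨le_rfl, hT⟩ l]; simp
  simp only [h0] at h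
  have h1 : ∑ l, M.transient T σ μ T l * M.doubleNet G ε 0 l =
      ∑ l ∈ G, M.transient T σ μ T l := by
    simp [doubleNet]
  rw [h1] at h
  have h2 : (N : ℝ) * (4 * ε ^ 3) = 4 * T ^ 3 / N ^ 2 := by
    rw [hεdef]; field_simp
  rw [h2] at h
  exact h

/-- Closed grid intervals meet only at their ends, so at an interior time the interval whose
existence is asserted by `FollowsDoubleNet` must be the given one. -/
theorem FollowsDoubleNet.drift_eq_opt {M : MarkovGame L A} {G : Finset L} {T : ℝ} {N : ℕ}
    {σ : L → ℝ → A} (h : M.FollowsDoubleNet G T N σ) {j : ℕ} {s : ℝ} (hs0 : s ∈ Set.Icc 0 T)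
    (hs : s ∈ Set.Ioo (T - j * (T / N) - T / N) (T - j * (T / N))) (l : L) :
    M.drift l (M.linStep (M.doubleNet G (T / N) j) (T - j * (T / N) - s)) (σ l s) =
      M.opt l (M.drift l (M.linStep (M.doubleNet G (T / N) j) (T - j * (T / N) - s))) := by
  obtain ⟨-, i, -, τ, hτ, hst, heq⟩ := h l s hs0
  have hε : 0 < T / N := by linarith [hs.1, hs.2]
  have h1 : (i : ℝ) < j + 1 := by
    by_contra hc
    have := mul_le_mul_of_nonneg_right (not_lt.1 hc) hε.le
    linarith [hs.1, hτ.1]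
  have h2 : (j : ℝ) < i + 1 := by
    by_contra hc
    have := mul_le_mul_of_nonneg_right (not_lt.1 hc) hε.le
    linarith [hs.2, hτ.2]
  have hij : i = j := by
    have h1' : i < j + 1 := by exact_mod_cast h1
    have h2' : j < i + 1 := by exact_mod_cast h2
    omega
  subst hij
  have : T - i * (T / N) - s = τ := by linarith
  rw [this]
  exact heq

theorem reachProb_mem {M : MarkovGame L A} (hM : M.IsNormed) {T : ℝ} (hT : 0 ≤ T)
    (G : Finset L) {μ : L → ℝ} (hμ : μ ∈ stdSimplex ℝ L) {σr σs : L → ℝ → A}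
    (hr : M.IsStrategy {l | l ∈ M.reach} T σr) (hs : M.IsStrategy {l | l ∉ M.reach} T σs) :
    M.reachProb G T μ σr σs ∈ Set.Icc 0 1 := by
  have hσ := hr.scheduler hs
  have hx := hσ.isTransient hT μ
  have h0 := hx.nonneg hM hμ.1 hσ ⟨hT, le_rfl⟩
  refine ⟨Finset.sum_nonneg fun l _ => h0 l, ?_⟩
  rw [← hμ.2, ← hx.sum_eq hσ ⟨hT, le_rfl⟩]
  exact Finset.sum_le_sum_of_subset_of_nonneg (Finset.subset_univ G) fun l _ _ => h0 l

/-- The strategies that follow a sufficiently fine double net are nearly optimal, and the net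
approximates the value of the game. -/
theorem IsNormed.isSolution_of_followsDoubleNet {M : MarkovGame L A} (hM : M.IsNormed)
    {G : Finset L} {T π : ℝ} (hT : 0 ≤ T) (hπ1 : π ≤ 1) {N : ℕ} (hN : 0 < N)
    (hNπ : 8 * T ^ 3 ≤ N ^ 2 * π) {σ : L → ℝ → A}
    (hr : M.IsStrategy {l | l ∈ M.reach} T σ) (hs : M.IsStrategy {l | l ∉ M.reach} T σ)
    (hσ : M.FollowsDoubleNet G T N σ) {μ : L → ℝ} (hμ : μ ∈ stdSimplex ℝ L) :
    M.IsSolution G T π μ σ σ (∑ l, μ l * M.doubleNet G (T / N) N l) := by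
  have hN1 : (1 : ℝ) ≤ N := by exact_mod_cast hN
  -- Intervals of length at most 1 keep the net in `[0, 1]`. For `T ≥ 1` this follows from `T ^ 2 ≤
  -- 8 * T ^ 3 ≤ N ^ 2 * π ≤ N ^ 2`, which uses `π ≤ 1`.
  have hTN : T ≤ N := by
    rcases le_total T 1 with h | h
    · exact h.trans hN1
    · have h3 : T ^ 2 ≤ T ^ 3 := pow_le_pow_right₀ h (by norm_num)
      have h4 : (N : ℝ) ^ 2 * π ≤ N ^ 2 := mul_le_of_le_one_right (by positivity) hπ1
      have h5 : 0 ≤ T ^ 3 := by positivity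
      exact le_of_sq_le_sq (by linarith) (by positivity)
  set w := ∑ l, μ l * M.doubleNet G (T / N) N l with hw
  have hδ : 4 * T ^ 3 / N ^ 2 ≤ π / 2 := by
    rw [div_le_iff₀ (by positivity)]
    linarith
  set δ := 4 * T ^ 3 / (N : ℝ) ^ 2 with hδdef
  have hδ0 : 0 ≤ δ := by positivity
  have hmem : ∀ {j s}, j < N → s ∈ Set.Ioo (T - j * (T / N) - T / N) (T - j * (T / N)) →
      s ∈ Set.Icc 0 T := by
    intro j s hj hjs
    have hε : 0 ≤ T / N := by positivity
    have h1 : ((j : ℝ) + 1) * (T / N) ≤ N * (T / N) :=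
      mul_le_mul_of_nonneg_right (by exact_mod_cast hj) hε
    rw [mul_div_cancel₀ _ (by positivity)] at h1
    have h2 : 0 ≤ j * (T / N) := by positivity
    constructor <;> linarith [hjs.1, hjs.2]
  have hlow : ∀ τ : M.SafeStrategy T, w - δ ≤ M.reachProb G T μ σ τ.1 := by
    intro τ
    have h := sum_mul_doubleNet_le hM hT G hμ (hr.scheduler τ.2) hN hTN (κ := 1) (Or.inl rfl)
      fun j hj s hjs l => by
        by_cases hl : l ∈ M.reach
        · rw [scheduler, if_pos hl, hσ.drift_eq_opt (hmem hj hjs) hjs l]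
        · rw [scheduler, if_neg hl, one_mul, one_mul]
          exact M.opt_le hl _ ((τ.2 l hl).1 s (hmem hj hjs))
    rw [one_mul, one_mul] at h
    exact h
  have hup : ∀ τ : M.ReachStrategy T, M.reachProb G T μ τ.1 σ ≤ w + δ := by
    intro τ
    have h := sum_mul_doubleNet_le hM hT G hμ (τ.2.scheduler hs) hN hTN (κ := -1) (Or.inr rfl)
      fun j hj s hjs l => by
        by_cases hl : l ∈ M.reach
        · rw [scheduler, if_pos hl, neg_one_mul, neg_one_mul, neg_le_neg_iff]
          exact M.le_opt hl _ ((τ.2 l hl).1 s (hmem hj hjs))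
        · rw [scheduler, if_neg hl, hσ.drift_eq_opt (hmem hj hjs) hjs l]
    change _ ≤ -1 * M.reachProb G T μ τ.1 σ at h
    linarith
  let σr : M.ReachStrategy T := ⟨σ, hr⟩
  let σs : M.SafeStrategy T := ⟨σ, hs⟩
  have : Nonempty (M.ReachStrategy T) := ⟨σr⟩
  have : Nonempty (M.SafeStrategy T) := ⟨σs⟩
  have hbelow : ∀ τ : M.ReachStrategy T,
      BddBelow (Set.range fun τ' : M.SafeStrategy T => M.reachProb G T μ τ.1 τ'.1) := fun τ =>
    ⟨0, by rintro _ ⟨τ', rfl⟩; exact (reachProb_mem hM hT G hμ τ.2 τ'.2).1⟩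
  have hqle : ∀ τ : M.ReachStrategy T, M.reachQuality G T μ τ.1 ≤ M.reachProb G T μ τ.1 σ :=
    fun τ => ciInf_le (hbelow τ) σs
  have hq1 : ∀ τ : M.ReachStrategy T, M.reachQuality G T μ τ.1 ≤ w + δ := fun τ =>
    (hqle τ).trans (hup τ)
  have habove : BddAbove (Set.range fun τ : M.ReachStrategy T => M.reachQuality G T μ τ.1) :=
    ⟨w + δ, by rintro _ ⟨τ, rfl⟩; exact hq1 τ⟩
  have hsabove : BddAbove (Set.range fun τ : M.ReachStrategy T => M.reachProb G T μ τ.1 σ) :=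
    ⟨w + δ, by rintro _ ⟨τ, rfl⟩; exact hup τ⟩
  -- The four inequalities form a chain from `w - δ` to `w + δ`, the third being weak duality. Any
  -- two members differ by at most `2 * δ ≤ π`.
  have h1 : w - δ ≤ M.reachQuality G T μ σ := le_ciInf hlow
  have h2 : M.reachQuality G T μ σ ≤ M.value G T μ := le_ciSup habove σr
  have h3 : M.value G T μ ≤ M.safeQuality G T μ σ :=
    ciSup_mono hsabove fun τ => hqle τ
  have h4 : M.safeQuality G T μ σ ≤ w + δ := ciSup_le hup
  refine ⟨?_, ?_, ?_, ?_, ?_⟩ <;> rw [abs_le] <;> constructor <;> linarith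

end precision

end MarkovGame

namespace RealRAM

/-! ### Reasoning about programs -/

@[simp] theorem State.writeNat_nat (s : State) (a i v b k : ℕ) :
    (s.writeNat a i v).nat b k = if b = a ∧ k = i then v else s.nat b k := by
  by_cases hb : b = a
  · subst hb
    by_cases hk : k = i
    · subst hk; simp [State.writeNat]
    · simp [State.writeNat, hk]
  · simp [State.writeNat, hb]

theorem State.writeNat_nat_self (s : State) (a i v : ℕ) :
    (s.writeNat a i v).nat a = Function.update (s.nat a) i v := by
  simp [State.writeNat]

theorem State.writeNat_nat_ne (s : State) {a b : ℕ} (i v : ℕ) (h : b ≠ a) :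
    (s.writeNat a i v).nat b = s.nat b := by
  simp [State.writeNat, h]

@[simp] theorem State.writeNat_real (s : State) (a i v : ℕ) : (s.writeNat a i v).real = s.real :=
  rfl

@[simp] theorem State.writeReal_real (s : State) (a i : ℕ) (v : ℝ) (b k : ℕ) :
    (s.writeReal a i v).real b k = if b = a ∧ k = i then v else s.real b k := by
  by_cases hb : b = a
  · subst hb
    by_cases hk : k = i
    · subst hk; simp [State.writeReal]
    · simp [State.writeReal, hk]
  · simp [State.writeReal, hb]

theorem State.writeReal_real_self (s : State) (a i : ℕ) (v : ℝ) :
    (s.writeReal a i v).real a = Function.update (s.real a) i v := by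
  simp [State.writeReal]

theorem State.writeReal_real_ne (s : State) {a b : ℕ} (i : ℕ) (v : ℝ) (h : b ≠ a) :
    (s.writeReal a i v).real b = s.real b := by
  simp [State.writeReal, h]

@[simp] theorem State.writeReal_nat (s : State) (a i : ℕ) (v : ℝ) :
    (s.writeReal a i v).nat = s.nat := rfl

/-- The arrays of natural numbers that a program may write to. -/
def Prog.natMods : Prog → List ℕ
  | .skip => []
  | .setNat a _ _ => [a]
  | .setReal _ _ _ => []
  | .seq p q => p.natMods ++ q.natMods
  | .ite _ p q => p.natMods ++ q.natMods
  | .loop _ p => p.natMods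

/-- The arrays of real numbers that a program may write to. -/
def Prog.realMods : Prog → List ℕ
  | .skip => []
  | .setNat _ _ _ => []
  | .setReal a _ _ => [a]
  | .seq p q => p.realMods ++ q.realMods
  | .ite _ p q => p.realMods ++ q.realMods
  | .loop _ p => p.realMods

/-- The memories agree on the arrays that `p` does not write to. -/
def Agree (p : Prog) (s t : State) : Prop :=
  (∀ a ∉ p.natMods, t.nat a = s.nat a) ∧ ∀ a ∉ p.realMods, t.real a = s.real a

theorem Agree.refl (p : Prog) (s : State) : Agree p s s := ⟨fun _ _ => rfl, fun _ _ => rfl⟩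

theorem Agree.trans {p : Prog} {s t u : State} (h : Agree p s t) (h' : Agree p t u) :
    Agree p s u :=
  ⟨fun a ha => (h'.1 a ha).trans (h.1 a ha), fun a ha => (h'.2 a ha).trans (h.2 a ha)⟩

theorem Agree.mono {p q : Prog} {s t : State} (h : Agree p s t)
    (hn : ∀ a ∈ p.natMods, a ∈ q.natMods) (hr : ∀ a ∈ p.realMods, a ∈ q.realMods) :
    Agree q s t :=
  ⟨fun a ha => h.1 a fun h' => ha (hn a h'), fun a ha => h.2 a fun h' => ha (hr a h')⟩

/-- The frame rule. The lists of modified arrays are computed from the syntax, so for a concrete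
program the side conditions are decidable. -/
theorem Exec.agree {p : Prog} {s t : State} {c : ℕ} (h : Exec p s t c) : Agree p s t := by
  induction h with
  | skip s => exact Agree.refl _ _
  | setNat s a i e =>
    refine ⟨fun b hb => ?_, fun b _ => rfl⟩
    have : b ≠ a := by simpa [Prog.natMods] using hb
    simp [State.writeNat, this]
  | setReal s a i e =>
    refine ⟨fun b _ => rfl, fun b hb => ?_⟩
    have : b ≠ a := by simpa [Prog.realMods] using hb
    simp [State.writeReal, this]
  | seq _ _ ihp ihq =>
    exact (ihp.mono (by simp +contextual [Prog.natMods]) (by simp +contextual [Prog.realMods])).trans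
      (ihq.mono (by simp +contextual [Prog.natMods]) (by simp +contextual [Prog.realMods]))
  | iteTrue _ _ ih =>
    exact ih.mono (by simp +contextual [Prog.natMods]) (by simp +contextual [Prog.realMods])
  | iteFalse _ _ ih =>
    exact ih.mono (by simp +contextual [Prog.natMods]) (by simp +contextual [Prog.realMods])
  | loopDone _ => exact Agree.refl _ _
  | loopStep _ _ _ ihp ihq => exact Agree.trans (p := .loop _ _) ihp ihq

/-- Started in `s`, the program `p` halts after at most `c` steps in a memory that satisfies `Q`. -/
def Runs (p : Prog) (s : State) (c : ℕ) (Q : State → Prop) : Prop :=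
  ∃ t k, Exec p s t k ∧ k ≤ c ∧ Q t

theorem Runs.mono {p : Prog} {s : State} {c d : ℕ} {Q R : State → Prop} (h : Runs p s c Q)
    (hcd : c ≤ d) (hQR : ∀ t, Agree p s t → Q t → R t) : Runs p s d R := by
  obtain ⟨t, k, ht, hk, hQ⟩ := h
  exact ⟨t, k, ht, hk.trans hcd, hQR t ht.agree hQ⟩

theorem Runs.seq {p q : Prog} {s : State} {c d : ℕ} {Q R : State → Prop} (h : Runs p s c Q)
    (h' : ∀ t, Agree p s t → Q t → Runs q t d R) : Runs (.seq p q) s (c + d) R := by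
  obtain ⟨t, k, ht, hk, hQ⟩ := h
  obtain ⟨u, k', hu, hk', hR⟩ := h' t ht.agree hQ
  exact ⟨u, k + k', .seq ht hu, add_le_add hk hk', hR⟩

/-- A loop halts if every iteration is paid for by a decrease of the potential `Φ`. -/
theorem Runs.loop {b : Test} {p : Prog} {s : State} (Inv : State → Prop) (Φ : State → ℕ)
    (h0 : Inv s)
    (step : ∀ t, Agree p s t → Inv t → b.Holds t →
      ∃ c, Runs p t c fun t' => Inv t' ∧ b.cost + c + Φ t' ≤ Φ t) :
    Runs (.loop b p) s (Φ s + b.cost) fun t => Inv t ∧ ¬ b.Holds t := by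
  -- Every test takes at least one step, so the potential decreases strictly and the induction on
  -- its bound terminates.
  have hb0 : 0 < b.cost := by cases b <;> simp [Test.cost]
  have key : ∀ (f : ℕ) (t : State), Φ t ≤ f → Agree p s t → Inv t →
      Runs (.loop b p) t (Φ t + b.cost) fun t => Inv t ∧ ¬ b.Holds t := by
    intro f
    induction f with
    | zero =>
      intro t hf hst hI
      by_cases hb : b.Holds t
      · obtain ⟨c, t', k, _, _, _, hΦ⟩ := step t hst hI hb
        omega
      · exact ⟨t, b.cost, .loopDone hb, by omega, hI, hb⟩
    | succ f ih =>
      intro t hf hst hI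
      by_cases hb : b.Holds t
      · obtain ⟨c, t', k, hp, hk, hI', hΦ⟩ := step t hst hI hb
        obtain ⟨u, k', hu, hk', hQ⟩ := ih t' (by omega) (hst.trans hp.agree) hI'
        exact ⟨u, b.cost + k + k', .loopStep hb hp hu, by omega, hQ⟩
      · exact ⟨t, b.cost, .loopDone hb, by omega, hI, hb⟩
  exact key (Φ s) s le_rfl (Agree.refl _ _) h0

/-- A loop with a fixed number `n` of iterations of bounded cost. -/
theorem Runs.forLoop {b : Test} {p : Prog} {s : State} (n c : ℕ) (Inv : ℕ → State → Prop)
    (h0 : Inv 0 s)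
    (hb : ∀ k ≤ n, ∀ t, Agree p s t → Inv k t → (b.Holds t ↔ k < n))
    (step : ∀ k < n, ∀ t, Agree p s t → Inv k t → Runs p t c (Inv (k + 1))) :
    Runs (.loop b p) s (n * (b.cost + c) + b.cost) (Inv n) := by
  have key : ∀ (d k : ℕ) (t : State), k + d = n → Agree p s t → Inv k t →
      Runs (.loop b p) t (d * (b.cost + c) + b.cost) (Inv n) := by
    intro d
    induction d with
    | zero =>
      intro k t hk hst hI
      have hkn : k = n := by omega
      subst hkn
      exact ⟨t, b.cost, .loopDone (by rw [hb k le_rfl t hst hI]; omega), by omega, hI⟩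
    | succ d ih =>
      intro k t hk hst hI
      obtain ⟨t', j, hp, hj, hI'⟩ := step k (by omega) t hst hI
      obtain ⟨u, j', hu, hj', hQ⟩ := ih (k + 1) t' (by omega) (hst.trans hp.agree) hI'
      refine ⟨u, b.cost + j + j', .loopStep ((hb k (by omega) t hst hI).2 (by omega)) hp hu, ?_, hQ⟩
      rw [Nat.succ_mul]
      omega
  exact key n 0 s (by omega) (Agree.refl _ _) h0

/-- Programs without loops. -/
def Prog.loopFree : Prog → Bool
  | .skip => true
  | .setNat _ _ _ => true
  | .setReal _ _ _ => true
  | .seq p q => p.loopFree && q.loopFree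
  | .ite _ p q => p.loopFree && q.loopFree
  | .loop _ _ => false

/-- A bound for the number of steps of a program without loops. -/
def Prog.bound : Prog → ℕ
  | .skip => 1
  | .setNat _ i e => i.cost + e.cost + 1
  | .setReal _ i e => i.cost + e.cost + 1
  | .seq p q => p.bound + q.bound
  | .ite b p q => b.cost + max p.bound q.bound
  | .loop _ _ => 0

open Classical in
/-- The final memory of a program without loops. -/
noncomputable def Prog.run : Prog → State → State
  | .skip, s => s
  | .setNat a i e, s => s.writeNat a (i.eval s) (e.eval s)
  | .setReal a i e, s => s.writeReal a (i.eval s) (e.eval s)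
  | .seq p q, s => q.run (p.run s)
  | .ite b p q, s => if b.Holds s then p.run s else q.run s
  | .loop _ _, s => s

theorem Prog.exec_run {p : Prog} (hp : p.loopFree = true) (s : State) :
    ∃ k, Exec p s (p.run s) k ∧ k ≤ p.bound := by
  induction p generalizing s with
  | skip => exact ⟨1, .skip s, le_rfl⟩
  | setNat a i e => exact ⟨_, .setNat s a i e, le_rfl⟩
  | setReal a i e => exact ⟨_, .setReal s a i e, le_rfl⟩
  | seq p q ihp ihq =>
    simp only [Prog.loopFree, Bool.and_eq_true] at hp
    obtain ⟨k, h, hk⟩ := ihp hp.1 s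
    obtain ⟨k', h', hk'⟩ := ihq hp.2 (p.run s)
    exact ⟨k + k', .seq h h', add_le_add hk hk'⟩
  | ite b p q ihp ihq =>
    simp only [Prog.loopFree, Bool.and_eq_true] at hp
    by_cases hb : b.Holds s
    · obtain ⟨k, h, hk⟩ := ihp hp.1 s
      refine ⟨b.cost + k, ?_, by simp only [Prog.bound]; omega⟩
      rw [Prog.run, if_pos hb]
      exact .iteTrue hb h
    · obtain ⟨k, h, hk⟩ := ihq hp.2 s
      refine ⟨b.cost + k, ?_, by simp only [Prog.bound]; omega⟩
      rw [Prog.run, if_neg hb]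
      exact .iteFalse hb h
  | loop b p _ => simp [Prog.loopFree] at hp

/-- Reduces straight-line code to symbolic evaluation: the postcondition is simplified on `p.run s`,
and the syntactic bound settles the cost. -/
theorem Runs.of_loopFree {p : Prog} {s : State} {Q : State → Prop} {c : ℕ}
    (hp : p.loopFree = true) (hc : p.bound ≤ c) (hQ : Q (p.run s)) : Runs p s c Q := by
  obtain ⟨k, h, hk⟩ := p.exec_run hp s
  exact ⟨p.run s, k, h, hk.trans hc, hQ⟩

end RealRAM

/-! ### Sorting and envelopes of lines -/

/-- A change that permutes the values on a part of `U` does not change the set of values on `U`. -/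
theorem Set.image_eq_image_of_eqOn_compl {α β : Type*} {f g : α → β} {S U : Set α} (hSU : S ⊆ U)
    (h : g '' S = f '' S) (h' : ∀ x ∉ S, g x = f x) : g '' U = f '' U := by
  rw [← Set.union_sdiff_cancel hSU, Set.image_union, Set.image_union, h,
    Set.image_congr fun x hx => h' x hx.2]

theorem Set.image_Ico_succ_of_eq {f g : ℕ → ℕ} {a o : ℕ} (ho : a ≤ o)
    (h : ∀ q < o, g q = f q) : g '' Set.Ico a (o + 1) = insert (g o) (f '' Set.Ico a o) := by
  rw [← Set.insert_Ico_right_eq_Ico_add_one ho, Set.image_insert_eq,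
    Set.image_congr fun x hx => h x hx.2]

/-- The state of merging the sorted blocks `[lo, mid)` and `[mid, hi)` of `A` into `B`: everything
below `i` and `k` has been merged. -/
structure MergeInv (key : ℕ → ℝ) (A : ℕ → ℕ) (lo mid hi i k o : ℕ) (B : ℕ → ℕ) : Prop where
  lo_le : lo ≤ i
  le_mid : i ≤ mid
  mid_le : mid ≤ k
  le_hi : k ≤ hi
  count : o + mid = i + k
  image : B '' Set.Ico lo o = A '' Set.Ico lo i ∪ A '' Set.Ico mid k
  sorted : MonotoneOn (key ∘ B) (Set.Ico lo o)
  left : ∀ q ∈ Set.Ico lo o, ∀ r ∈ Set.Ico i mid, key (B q) ≤ key (A r)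
  right : ∀ q ∈ Set.Ico lo o, ∀ r ∈ Set.Ico k hi, key (B q) ≤ key (A r)

namespace MergeInv

variable {key : ℕ → ℝ} {A : ℕ → ℕ} {lo mid hi i k o : ℕ} {B B' : ℕ → ℕ}

theorem start (h1 : lo ≤ mid) (h2 : mid ≤ hi) (B : ℕ → ℕ) :
    MergeInv key A lo mid hi lo mid lo B := by
  refine ⟨le_rfl, h1, le_rfl, h2, by omega, by simp, fun q hq => by simp at hq, ?_, ?_⟩ <;> simp

theorem monotoneOn_succ (h : MergeInv key A lo mid hi i k o B) {v : ℕ} (hB : ∀ q < o, B' q = B q)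
    (hv : B' o = v) (hle : ∀ q ∈ Set.Ico lo o, key (B q) ≤ key v) :
    MonotoneOn (key ∘ B') (Set.Ico lo (o + 1)) := by
  intro q hq r hr hqr
  obtain ⟨hq1, hq2⟩ := hq
  obtain ⟨hr1, hr2⟩ := hr
  simp only [Function.comp]
  rcases Nat.lt_succ_iff_lt_or_eq.1 hr2 with h1 | h1
  · rw [hB q (by omega), hB r h1]
    exact h.sorted ⟨hq1, by omega⟩ ⟨hr1, h1⟩ hqr
  · subst h1
    rw [hv]
    rcases Nat.lt_succ_iff_lt_or_eq.1 hq2 with h2 | h2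
    · rw [hB q h2]; exact hle q ⟨hq1, h2⟩
    · rw [h2, hv]

/-- The entry taken is the least one left: it heads its own sorted block, and it does not exceed the
head of the other block if there is one. This preserves the separation of written and remaining
entries. -/
theorem takeLeft (hA1 : MonotoneOn (key ∘ A) (Set.Ico lo mid))
    (hA2 : MonotoneOn (key ∘ A) (Set.Ico mid hi))
    (h : MergeInv key A lo mid hi i k o B) (hi' : i < mid) (hk : k < hi → key (A i) ≤ key (A k))
    (hB : ∀ q < o, B' q = B q) (hv : B' o = A i) :
    MergeInv key A lo mid hi (i + 1) k (o + 1) B' := by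
  have hlo := h.lo_le
  have hmid := h.mid_le
  have hc := h.count
  refine ⟨by omega, by omega, hmid, h.le_hi, by omega, ?_, ?_, ?_, ?_⟩
  · rw [Set.image_Ico_succ_of_eq (by omega) hB, h.image, hv,
      Set.image_Ico_succ_of_eq hlo fun _ _ => rfl, Set.insert_union]
  · exact h.monotoneOn_succ hB hv fun q hq => h.left q hq i ⟨le_rfl, hi'⟩
  · intro q hq r hr
    rcases Nat.lt_succ_iff_lt_or_eq.1 hq.2 with h1 | h1
    · rw [hB q h1]; exact h.left q ⟨hq.1, h1⟩ r ⟨by have := hr.1; omega, hr.2⟩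
    · subst h1
      rw [hv]
      exact hA1 ⟨hlo, hi'⟩ ⟨by have := hr.1; omega, hr.2⟩ (by have := hr.1; omega)
  · intro q hq r hr
    rcases Nat.lt_succ_iff_lt_or_eq.1 hq.2 with h1 | h1
    · rw [hB q h1]; exact h.right q ⟨hq.1, h1⟩ r hr
    · subst h1
      rw [hv]
      have hkhi : k < hi := lt_of_le_of_lt hr.1 hr.2
      exact (hk hkhi).trans (hA2 ⟨hmid, hkhi⟩ ⟨hmid.trans hr.1, hr.2⟩ hr.1)

theorem takeRight (hA1 : MonotoneOn (key ∘ A) (Set.Ico lo mid))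
    (hA2 : MonotoneOn (key ∘ A) (Set.Ico mid hi))
    (h : MergeInv key A lo mid hi i k o B) (hk : k < hi) (hi' : i < mid → key (A k) ≤ key (A i))
    (hB : ∀ q < o, B' q = B q) (hv : B' o = A k) :
    MergeInv key A lo mid hi i (k + 1) (o + 1) B' := by
  have hlo := h.lo_le
  have hmid := h.mid_le
  have hle := h.le_mid
  have hc := h.count
  refine ⟨hlo, h.le_mid, by omega, by omega, by omega, ?_, ?_, ?_, ?_⟩
  · rw [Set.image_Ico_succ_of_eq (by omega) hB, h.image, hv,
      Set.image_Ico_succ_of_eq hmid fun _ _ => rfl, Set.union_insert]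
  · exact h.monotoneOn_succ hB hv fun q hq => h.right q hq k ⟨le_rfl, hk⟩
  · intro q hq r hr
    rcases Nat.lt_succ_iff_lt_or_eq.1 hq.2 with h1 | h1
    · rw [hB q h1]; exact h.left q ⟨hq.1, h1⟩ r hr
    · subst h1
      rw [hv]
      have him : i < mid := lt_of_le_of_lt hr.1 hr.2
      exact (hi' him).trans (hA1 ⟨hlo, him⟩ ⟨hlo.trans hr.1, hr.2⟩ hr.1)
  · intro q hq r hr
    rcases Nat.lt_succ_iff_lt_or_eq.1 hq.2 with h1 | h1
    · rw [hB q h1]; exact h.right q ⟨hq.1, h1⟩ r ⟨by have := hr.1; omega, hr.2⟩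
    · subst h1
      rw [hv]
      exact hA2 ⟨hmid, hk⟩ ⟨by have := hr.1; omega, hr.2⟩ (by have := hr.1; omega)

theorem image_eq (h : MergeInv key A lo mid hi i k hi B) :
    B '' Set.Ico lo hi = A '' Set.Ico lo hi := by
  have h1 := h.le_mid
  have h2 := h.mid_le
  have h3 := h.le_hi
  have h4 := h.count
  have h5 := h.lo_le
  have hi' : i = mid := by omega
  have hk : k = hi := by omega
  rw [h.image, ← Set.image_union, hi', hk, Set.Ico_union_Ico_eq_Ico (by omega) (by omega)]

end MergeInv

/-- The state of the computation of the upper envelope on `[0, ε]` of the lines `C q + D q * t` for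
`q = Q 0, ..., Q (W - 1)`.  The first `i` lines are processed.  The envelope consists of the
lines `S k` that start at the times `Z k`, for `k < h`, and ends at time `E`; from then on the line
`Q i` is above the processed lines. -/
structure HullInv (C D : ℕ → ℝ) (Q : ℕ → ℕ) (W : ℕ) (ε : ℝ) (i h : ℕ) (S : ℕ → ℕ) (Z : ℕ → ℝ)
    (E : ℝ) : Prop where
  le_width : i ≤ W
  height_le : h ≤ i
  of_empty : h = 0 → E = 0 ∧ i < W
  start_eq : 0 < h → Z 0 = 0
  last_le : 0 < h → Z (h - 1) ≤ E
  mono : ∀ k, k + 1 < h → Z k ≤ Z (k + 1)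
  mem : ∀ k < h, ∃ r < i, S k = Q r
  max : ∀ k < h, ∀ t, Z k ≤ t → t ≤ (if k + 1 < h then Z (k + 1) else E) → ∀ r < i,
    C (Q r) + D (Q r) * t ≤ C (S k) + D (S k) * t
  nonneg : 0 ≤ E
  le_end : E ≤ ε
  done : i = W → E = ε
  next : i < W → (E = ε ∧ 0 < h) ∨ ∀ t, E ≤ t → t ≤ ε → ∀ r < i,
    C (Q r) + D (Q r) * t ≤ C (Q i) + D (Q i) * t

namespace HullInv

variable {C D : ℕ → ℝ} {Q : ℕ → ℕ} {W : ℕ} {ε : ℝ} {i h : ℕ} {S S' : ℕ → ℕ} {Z Z' : ℕ → ℝ} {E : ℝ}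

theorem start (hε : 0 ≤ ε) (hW : 0 < W) (S : ℕ → ℕ) (Z : ℕ → ℝ) :
    HullInv C D Q W ε 0 0 S Z 0 where
  le_width := by omega
  height_le := le_rfl
  of_empty _ := ⟨rfl, hW⟩
  start_eq h := by omega
  last_le h := by omega
  mono k h := by omega
  mem k h := by omega
  max k h := by omega
  nonneg := le_rfl
  le_end := hε
  done h := by omega
  next _ := Or.inr fun t _ _ r hr => by omega

theorem start_nonneg (H : HullInv C D Q W ε i h S Z E) {k : ℕ} (hk : k < h) : 0 ≤ Z k := by
  induction k with
  | zero => exact (H.start_eq hk).ge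
  | succ k ih => exact (ih (by omega)).trans (H.mono k hk)

/-- The new line is not below the top line where the top piece starts, and its slope is not smaller.
It therefore dominates from there on, and the top piece can be dropped. -/
theorem pop (H : HullInv C D Q W ε i h S Z E) (hD : ∀ r < i, D (Q r) ≤ D (Q i)) (hi : i < W)
    (hh : 0 < h)
    (hle : C (S (h - 1)) + D (S (h - 1)) * Z (h - 1) ≤ C (Q i) + D (Q i) * Z (h - 1)) :
    HullInv C D Q W ε i (h - 1) S Z (Z (h - 1)) where
  le_width := H.le_width
  height_le := by have := H.height_le; omega
  of_empty h0 := ⟨by rw [h0]; exact H.start_eq hh, hi⟩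
  start_eq h0 := H.start_eq hh
  last_le h0 := by
    have := H.mono (h - 1 - 1) (by omega)
    rwa [Nat.sub_add_cancel h0] at this
  mono k hk := H.mono k (by omega)
  mem k hk := H.mem k (by omega)
  max k hk t h1 h2 := by
    refine H.max k (by omega) t h1 ?_
    rw [if_pos (by omega)]
    split_ifs at h2 with h3
    · exact h2
    · rwa [show k + 1 = h - 1 by omega]
  nonneg := H.start_nonneg (by omega)
  le_end := (H.last_le hh).trans H.le_end
  done h0 := by omega
  next _ := Or.inr fun t h1 h2 r hr => by
    obtain ⟨r', hr', hS⟩ := H.mem (h - 1) (by omega)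
    have hd := hD r' hr'
    rw [← hS] at hd
    have htop : ∀ t, Z (h - 1) ≤ t → t ≤ E →
        C (Q r) + D (Q r) * t ≤ C (Q i) + D (Q i) * t := by
      intro t h1 h2
      refine (H.max (h - 1) (by omega) t h1 ?_ r hr).trans ?_
      · rwa [if_neg (by omega)]
      · nlinarith
    rcases le_total t E with h3 | h3
    · exact htop t h1 h3
    · rcases H.next hi with ⟨h4, _⟩ | h4
      · exact htop t h1 (by linarith)
      · exact h4 t h3 h2 r hr

/-- The new line does not exceed the finished part of the envelope. -/
theorem le_before (H : HullInv C D Q W ε i h S Z E) (hD : ∀ r < i, D (Q r) ≤ D (Q i))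
    (hlt : C (Q i) + D (Q i) * Z (h - 1) < C (S (h - 1)) + D (S (h - 1)) * Z (h - 1))
    {k : ℕ} (hk : k + 1 < h) {t : ℝ} (h2 : t ≤ Z (k + 1)) :
    C (Q i) + D (Q i) * t ≤ C (S k) + D (S k) * t := by
  -- Descend from the top of the stack. At the start of a piece the previous line is the maximum of
  -- the processed ones, and going left the new line falls at least as fast as any of them.
  have key : ∀ d k, k + 1 + d + 1 = h →
      C (Q i) + D (Q i) * Z (k + 1) ≤ C (S k) + D (S k) * Z (k + 1) := by
    intro d
    induction d with
    | zero =>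
      intro k hk
      obtain ⟨r, hr, hS⟩ := H.mem (h - 1) (by omega)
      have := H.max k (by omega) (Z (k + 1)) (H.mono k (by omega)) (by rw [if_pos (by omega)]) r hr
      rw [← hS] at this
      rw [show h - 1 = k + 1 by omega] at this hlt
      linarith
    | succ d ih =>
      intro k hk
      have h1 := ih (k + 1) (by omega)
      obtain ⟨r, hr, hS⟩ := H.mem (k + 1) (by omega)
      have h2 := H.max k (by omega) (Z (k + 1)) (H.mono k (by omega))
        (by rw [if_pos (by omega)]) r hr
      rw [← hS] at h2
      have h3 := hD r hr
      rw [← hS] at h3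
      have h4 := H.mono (k + 1) (by omega)
      nlinarith
  have h3 := key (h - k - 2) k (by omega)
  obtain ⟨r, hr, hS⟩ := H.mem k (by omega)
  have h4 := hD r hr
  rw [← hS] at h4
  nlinarith

/-- Being below the top line at both ends of the last piece, the new line is below it on the whole
piece. If pops have moved `E` to the left, the processed lines lie below the new line after `E`,
hence below the top line, so the envelope again extends to `ε`. -/
theorem discard (H : HullInv C D Q W ε i h S Z E) (hD : ∀ r < i, D (Q r) ≤ D (Q i)) (hi : i < W)
    (hh : 0 < h)
    (hlt : C (Q i) + D (Q i) * Z (h - 1) < C (S (h - 1)) + D (S (h - 1)) * Z (h - 1))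
    (hle : C (Q i) + D (Q i) * ε ≤ C (S (h - 1)) + D (S (h - 1)) * ε) :
    HullInv C D Q W ε (i + 1) h S Z ε where
  le_width := hi
  height_le := by have := H.height_le; omega
  of_empty h0 := by omega
  start_eq := H.start_eq
  last_le _ := (H.last_le hh).trans H.le_end
  mono := H.mono
  mem k hk := by
    obtain ⟨r, hr, hS⟩ := H.mem k hk
    exact ⟨r, by omega, hS⟩
  max k hk t h1 h2 r hr := by
    split_ifs at h2 with h3
    · rcases Nat.lt_succ_iff_lt_or_eq.1 hr with h4 | h4
      · exact H.max k hk t h1 (by rwa [if_pos h3]) r h4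
      · subst h4
        exact H.le_before hD hlt h3 h2
    · obtain rfl : k = h - 1 := by omega
      have hnew : C (Q i) + D (Q i) * t ≤ C (S (h - 1)) + D (S (h - 1)) * t := by
        rcases le_total (D (Q i)) (D (S (h - 1))) with h5 | h5 <;> nlinarith
      rcases Nat.lt_succ_iff_lt_or_eq.1 hr with h4 | h4
      · rcases le_total t E with h6 | h6
        · exact H.max (h - 1) hk t h1 (by rwa [if_neg h3]) r h4
        · rcases H.next hi with ⟨h7, _⟩ | h7
          · exact H.max (h - 1) hk t h1 (by rw [if_neg h3]; linarith) r h4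
          · exact (h7 t h6 h2 r h4).trans hnew
      · subst h4
        exact hnew
  nonneg := H.nonneg.trans H.le_end
  le_end := le_rfl
  done _ := rfl
  next _ := Or.inl ⟨rfl, hh⟩

/-- The new line is below the top line at the start of the last piece and above it at `ε`, so they
cross once in between. The top line rules before the crossing and the new line after it. -/
theorem push (H : HullInv C D Q W ε i h S Z E) (hD : ∀ r < i, D (Q r) ≤ D (Q i)) (hi : i < W)
    (hh : 0 < h)
    (hlt : C (Q i) + D (Q i) * Z (h - 1) < C (S (h - 1)) + D (S (h - 1)) * Z (h - 1))
    (hgt : C (S (h - 1)) + D (S (h - 1)) * ε < C (Q i) + D (Q i) * ε)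
    (hS : ∀ k, S' k = if k = h then Q i else S k)
    (hZ : ∀ k, Z' k = if k = h then (C (S (h - 1)) - C (Q i)) / (D (Q i) - D (S (h - 1)))
      else Z k) :
    HullInv C D Q W ε (i + 1) (h + 1) S' Z' ε := by
  have hlast : Z (h - 1) ≤ ε := (H.last_le hh).trans H.le_end
  -- The strict inequalities at both ends exclude equal slopes, so the division is legitimate.
  have hδ : 0 < D (Q i) - D (S (h - 1)) := by
    by_contra hc
    nlinarith
  set c := (C (S (h - 1)) - C (Q i)) / (D (Q i) - D (S (h - 1))) with hc
  have hcδ : c * (D (Q i) - D (S (h - 1))) = C (S (h - 1)) - C (Q i) := by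
    rw [hc, div_mul_cancel₀ _ hδ.ne']
  have hc1 : Z (h - 1) ≤ c := by
    rw [hc, le_div_iff₀ hδ]; linarith
  have hc2 : c ≤ ε := by
    rw [hc, div_le_iff₀ hδ]; linarith
  have hZ' : ∀ k < h, Z' k = Z k := fun k hk => by rw [hZ, if_neg (by omega)]
  have hS' : ∀ k < h, S' k = S k := fun k hk => by rw [hS, if_neg (by omega)]
  have hZh : Z' h = c := by rw [hZ, if_pos rfl]
  have hSh : S' h = Q i := by rw [hS, if_pos rfl]
  have hbelow : ∀ t, t ≤ c → C (Q i) + D (Q i) * t ≤ C (S (h - 1)) + D (S (h - 1)) * t := by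
    intro t ht
    nlinarith
  have habove : ∀ t, c ≤ t → C (S (h - 1)) + D (S (h - 1)) * t ≤ C (Q i) + D (Q i) * t := by
    intro t ht
    nlinarith
  have htop : ∀ t, Z (h - 1) ≤ t → t ≤ E → ∀ r < i,
      C (Q r) + D (Q r) * t ≤ C (S (h - 1)) + D (S (h - 1)) * t := fun t h1 h2 r hr =>
    H.max (h - 1) (by omega) t h1 (by rwa [if_neg (by omega)]) r hr
  refine ⟨hi, by have := H.height_le; omega, fun h0 => by omega, fun _ => ?_, fun _ => ?_,
    fun k hk => ?_, fun k hk => ?_, fun k hk t h1 h2 r hr => ?_, H.nonneg.trans H.le_end, le_rfl,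
    fun _ => rfl, fun _ => Or.inl ⟨rfl, by omega⟩⟩
  · rw [hZ' 0 hh]; exact H.start_eq hh
  · rw [Nat.add_sub_cancel, hZh]; exact hc2
  · rcases Nat.lt_succ_iff_lt_or_eq.1 hk with h1 | h1
    · rw [hZ' k (by omega), hZ' _ h1]; exact H.mono k h1
    · rw [h1, hZh, hZ' k (by omega), show k = h - 1 by omega]; exact hc1
  · rcases Nat.lt_succ_iff_lt_or_eq.1 hk with h1 | h1
    · obtain ⟨r, hr, hS1⟩ := H.mem k h1
      exact ⟨r, by omega, by rw [hS' k h1, hS1]⟩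
    · exact ⟨i, by omega, by rw [h1, hSh]⟩
  · rcases Nat.lt_succ_iff_lt_or_eq.1 hk with hk1 | hk1
    · rw [if_pos (by omega)] at h2
      rw [hZ' k hk1] at h1
      rw [hS' k hk1]
      rcases Nat.lt_or_ge (k + 1) h with h3 | h3
      · rw [hZ' _ h3] at h2
        rcases Nat.lt_succ_iff_lt_or_eq.1 hr with h4 | h4
        · exact H.max k hk1 t h1 (by rwa [if_pos h3]) r h4
        · rw [h4]; exact H.le_before hD hlt h3 h2
      · obtain rfl : k = h - 1 := by omega
        rw [show h - 1 + 1 = h by omega, hZh] at h2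
        rcases Nat.lt_succ_iff_lt_or_eq.1 hr with h4 | h4
        · rcases le_total t E with h6 | h6
          · exact htop t h1 h6 r h4
          · rcases H.next hi with ⟨h7, _⟩ | h7
            · exact htop t h1 (by linarith) r h4
            · exact (h7 t h6 (h2.trans hc2) r h4).trans (hbelow t h2)
        · rw [h4]; exact hbelow t h2
    · subst hk1
      rw [if_neg (by omega)] at h2
      rw [hZh] at h1
      rw [hSh]
      rcases Nat.lt_succ_iff_lt_or_eq.1 hr with h4 | h4
      · rcases le_total t E with h6 | h6
        · exact (htop t (hc1.trans h1) h6 r h4).trans (habove t h1)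
        · rcases H.next hi with ⟨h7, _⟩ | h7
          · exact (htop t (hc1.trans h1) (by linarith) r h4).trans (habove t h1)
          · exact h7 t h6 h2 r h4
      · rw [h4]

theorem push_empty (H : HullInv C D Q W ε i 0 S Z E) (hi : i < W)
    (hS : S' 0 = Q i) (hZ : Z' 0 = 0) : HullInv C D Q W ε (i + 1) 1 S' Z' ε := by
  have hE := (H.of_empty rfl).1
  have hε : 0 ≤ ε := H.nonneg.trans H.le_end
  refine ⟨hi, by omega, fun h0 => by omega, fun _ => hZ, fun _ => by simpa [hZ] using hε,
    fun k hk => by omega, fun k hk => ⟨i, by omega, ?_⟩, fun k hk t h1 h2 r hr => ?_, hε, le_rfl,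
    fun _ => rfl, fun _ => Or.inl ⟨rfl, by omega⟩⟩
  · obtain rfl : k = 0 := by omega
    exact hS
  · obtain rfl : k = 0 := by omega
    rw [if_neg (by omega)] at h2
    rw [hZ] at h1
    rw [hS]
    rcases Nat.lt_succ_iff_lt_or_eq.1 hr with h4 | h4
    · rcases H.next hi with ⟨_, h7⟩ | h7
      · omega
      · exact h7 t (by rwa [hE]) h2 r h4
    · rw [h4]

end HullInv

namespace RealRAM

/-! ### The program -/

/-- A variable: cell `0` of an array of natural numbers. -/
abbrev nv (a : ℕ) : NExpr := .get a (.lit 0)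

/-- A real variable: cell `0` of an array of real numbers. -/
abbrev rv (a : ℕ) : RExpr := .get a (.lit 0)

abbrev setN (a : ℕ) (e : NExpr) : Prog := .setNat a (.lit 0) e

abbrev setR (a : ℕ) (e : RExpr) : Prog := .setReal a (.lit 0) e

infixr:35 ";;" => Prog.seq
infixl:65 "+ₙ" => NExpr.add
infixl:65 "-ₙ" => NExpr.sub
infixl:65 "+ᵣ" => RExpr.add
infixl:65 "-ᵣ" => RExpr.sub
infixl:70 "*ᵣ" => RExpr.mul
infixl:70 "/ᵣ" => RExpr.div

abbrev inc (v : ℕ) : Prog := setN v (nv v +ₙ .lit 1)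

/-- Run `p` with `v = 0, 1, ...` as long as `v < e`. -/
def forTo (v : ℕ) (e : NExpr) (p : Prog) : Prog :=
  setN v (.lit 0) ;; .loop (.natLt (nv v) e) (p ;; inc v)

/-- The invariant must be insensitive to the cell of the counter, which is written between two
rounds. The round number is an argument of the invariant, and the counter's value is provided
separately. -/
theorem runs_forTo {v : ℕ} {e : NExpr} {p : Prog} {s : State} (n c : ℕ) (Inv : ℕ → State → Prop)
    (hv : v ∉ p.natMods) (he : ∀ t, Agree (forTo v e p) s t → e.eval t = n)
    (hInv : ∀ k t x, Inv k t → Inv k (t.writeNat v 0 x)) (h0 : Inv 0 s)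
    (step : ∀ k < n, ∀ t, Agree (forTo v e p) s t → t.nat v 0 = k → Inv k t →
      Runs p t c (Inv (k + 1))) :
    Runs (forTo v e p) s (n * (c + e.cost + 9) + e.cost + 6) (Inv n) := by
  have hinit : ∀ {t}, Agree (setN v (.lit 0)) s t → Agree (forTo v e p) s t := fun h =>
    h.mono (by simp [forTo, Prog.natMods]) (by simp [Prog.realMods])
  have hbody : ∀ {t u}, Agree (p ;; inc v) t u → Agree (forTo v e p) t u := fun h =>
    h.mono (fun a ha => by simp only [forTo, Prog.natMods, List.mem_append] at ha ⊢; tauto)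
      (by simp [forTo, Prog.realMods])
  unfold forTo
  refine (Runs.seq (Runs.of_loopFree (p := setN v (.lit 0)) (c := 3)
    (Q := fun t => Inv 0 t ∧ t.nat v 0 = 0) rfl le_rfl
    ⟨hInv 0 s 0 h0, by simp [Prog.run, NExpr.eval]⟩)
    fun t hst ht => Runs.forLoop n (c + 6) (fun k t => Inv k t ∧ t.nat v 0 = k) ht ?_ ?_).mono ?_
      fun t _ ht => ht.1
  · intro k _ u htu hu
    simp [Test.Holds, NExpr.eval, he u ((hinit hst).trans (hbody htu)), hu.2]
  · intro k hk u htu hu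
    refine Runs.seq (step k hk u ((hinit hst).trans (hbody htu)) hu.2 hu.1)
      fun w huw hw => Runs.of_loopFree rfl le_rfl ?_
    have hwv : w.nat v 0 = k := by rw [huw.1 v hv, hu.2]
    exact ⟨hInv _ _ _ hw, by simp [Prog.run, NExpr.eval, hwv]⟩
  · simp only [Test.cost, NExpr.cost]
    rw [show (1 + 1 + e.cost + 1 + (c + 6)) = c + e.cost + 9 by omega]
    omega

-- Arrays of natural and of real numbers are numbered independently, so some numbers occur twice.
-- The running values `aX` live in the output array for the values.
notation "aBase" => 9
notation "aRep" => 10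
notation "aPerm" => 11
notation "aTmp" => 12
notation "aStack" => 13
notation "vN" => 20
notation "vWidth" => 21
notation "vSlots" => 22
notation "vJ" => 23
notation "vLoc" => 24
notation "vR" => 25
notation "vE" => 26
notation "vRun" => 27
notation "vLo" => 28
notation "vI" => 29
notation "vK" => 30
notation "vO" => 31
notation "vH" => 32
notation "vB" => 33
notation "vQ" => 34
notation "aX" => 3
notation "aC" => 10
notation "aD" => 11
notation "aGrad" => 12
notation "aSgn" => 13
notation "aStart" => 14
notation "rEps" => 20
notation "rN" => 21
notation "rTime" => 22
notation "rAcc" => 23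

namespace Solver

abbrev nLoc : NExpr := .get 0 (.lit 0)
abbrev nAct : NExpr := .get 0 (.lit 1)
abbrev nTrans : NExpr := .get 0 (.lit 2)

/-- The number of intervals `N`, their length, and the current time `T`. -/
def gridProg : Prog :=
  setR rN (.lit 1) ;; setN vN (.lit 1) ;;
  .loop (.realLt (rv rN *ᵣ rv rN *ᵣ .get 0 (.lit 1)) (.lit 8 *ᵣ (rv 0 *ᵣ (rv 0 *ᵣ rv 0))))
    (setR rN (rv rN +ᵣ .lit 1) ;; inc vN) ;;
  setR rEps (rv 0 /ᵣ rv rN) ;; setR rTime (rv 0)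

/-- The least power of two that is at least the number of actions. -/
def widthProg : Prog :=
  setN vWidth (.lit 1) ;;
  .loop (.natLt (nv vWidth) nAct) (setN vWidth (nv vWidth +ₙ nv vWidth))

/-- The slots of a location, its sign, and its initial value. -/
def locBody : Prog :=
  .setNat aBase (nv vLoc) (nv vB) ;; setN vB (nv vB +ₙ nv vWidth) ;;
  .ite (.natLt (.lit 0) (.get 4 (nv vLoc))) (.setReal aSgn (nv vLoc) (.lit 1))
    (.setReal aSgn (nv vLoc) (.lit (-1))) ;;
  .ite (.natLt (.lit 0) (.get 5 (nv vLoc))) (.setReal aX (nv vLoc) (.lit 1))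
    (.setReal aX (nv vLoc) (.lit 0))

def locProg : Prog :=
  setN vB (.lit 0) ;; forTo vLoc nLoc locBody ;; setN vSlots (nv vB)

/-- The slot of the action of transition `vE`. -/
abbrev slot : NExpr := .get aBase (.get 1 (nv vE)) +ₙ .get 2 (nv vE)

/-- Any enabled slot serves as representative; the last transition of the location wins. -/
def repProg : Prog := forTo vE nTrans (.setNat aRep (.get 1 (nv vE)) slot)

/-- The slots of disabled actions and the padding up to the power of two are filled with copies of
an enabled slot, so that sorting and envelope never meet a disabled action. Duplicates are harmless.
-/
def fillProg : Prog :=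
  forTo vLoc nLoc (forTo vR (nv vWidth)
    (.setNat aPerm (.get aBase (nv vLoc) +ₙ nv vR) (.get aRep (nv vLoc))))

def permProg : Prog := forTo vE nTrans (.setNat aPerm slot slot)

def setupProg : Prog :=
  gridProg ;; widthProg ;; locProg ;; repProg ;; fillProg ;; permProg

def zeroProg (d : ℕ) : Prog := forTo vR (nv vSlots) (.setReal d (nv vR) (.lit 0))

/-- Add, to the slot of each action, the signed expectation of the values in the array `v`. -/
def scatterProg (d v : ℕ) : Prog :=
  forTo vE nTrans (.setReal d slot (.get d slot +ᵣ
    .get aSgn (.get 1 (nv vE)) *ᵣ (.get 1 (nv vE) *ᵣ .get v (.get 3 (nv vE)))))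

/-- The value in `aC` of the action at the place `vR` of the current location. -/
abbrev cand : RExpr := .get aC (.get aPerm (.get aBase (nv vLoc) +ₙ nv vR))

/-- The gradients of the linear approximation. -/
def gradProg : Prog :=
  forTo vLoc nLoc (
    .setReal aGrad (nv vLoc) (.get aC (.get aPerm (.get aBase (nv vLoc)))) ;;
    forTo vR (nv vWidth) (.ite (.realLt (.get aGrad (nv vLoc)) cand)
      (.setReal aGrad (nv vLoc) cand) .skip) ;;
    .setReal aGrad (nv vLoc)
      (.get aSgn (nv vLoc) *ᵣ .get aGrad (nv vLoc) -ᵣ .get aX (nv vLoc)))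

/-- One step of merging the blocks of length `vRun` that start at `vLo`. -/
def mergeBody : Prog :=
  .ite (.and (.natLt (nv vI) (nv vLo +ₙ nv vRun)) (.not (.and
      (.natLt (nv vK) (nv vLo +ₙ (nv vRun +ₙ nv vRun)))
      (.realLt (.get aD (.get aPerm (nv vK))) (.get aD (.get aPerm (nv vI)))))))
    (.setNat aTmp (nv vLo +ₙ nv vO) (.get aPerm (nv vI)) ;; inc vI)
    (.setNat aTmp (nv vLo +ₙ nv vO) (.get aPerm (nv vK)) ;; inc vK)

def mergeProg : Prog :=
  setN vI (nv vLo) ;; setN vK (nv vLo +ₙ nv vRun) ;;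
  forTo vO (nv vRun +ₙ nv vRun) mergeBody ;;
  forTo vO (nv vRun +ₙ nv vRun)
    (.setNat aPerm (nv vLo +ₙ nv vO) (.get aTmp (nv vLo +ₙ nv vO)))

def passProg : Prog :=
  setN vLo (nv vB) ;;
  .loop (.natLt (nv vLo) (nv vB +ₙ nv vWidth))
    (mergeProg ;; setN vLo (nv vLo +ₙ (nv vRun +ₙ nv vRun)))

/-- Sort the slots of a location by `aD`. -/
def sortProg : Prog :=
  setN vRun (.lit 1) ;;
  .loop (.natLt (nv vRun) (nv vWidth)) (passProg ;; setN vRun (nv vRun +ₙ nv vRun))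

/-- The value at time `t` of the line of slot `q`. -/
abbrev lineExpr (q : NExpr) (t : RExpr) : RExpr := .get aC q +ᵣ .get aD q *ᵣ t

abbrev top : NExpr := .get aStack (nv vH -ₙ .lit 1)

abbrev topStart : RExpr := .get aStart (nv vH -ₙ .lit 1)

/-- The branches are, in this order: push at the crossing, discard the new line, pop, push on the
empty stack. A pop leaves `vI` unchanged, so the same line is tried again. -/
def hullBody : Prog :=
  setN vQ (.get aPerm (nv vB +ₙ nv vI)) ;;
  .ite (.natLt (.lit 0) (nv vH))
    (.ite (.realLt (lineExpr (nv vQ) topStart) (lineExpr top topStart))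
      (.ite (.realLt (lineExpr top (rv rEps)) (lineExpr (nv vQ) (rv rEps)))
        (.setReal aStart (nv vH) ((.get aC top -ᵣ .get aC (nv vQ)) /ᵣ
            (.get aD (nv vQ) -ᵣ .get aD top)) ;;
          .setNat aStack (nv vH) (nv vQ) ;; inc vH ;; inc vI)
        (inc vI))
      (setN vH (nv vH -ₙ .lit 1)))
    (.setReal aStart (nv vH) (.lit 0) ;; .setNat aStack (nv vH) (nv vQ) ;; inc vH ;; inc vI)

/-- The upper envelope of the lines of a location. -/
def hullProg : Prog :=
  setN vI (.lit 0) ;; setN vH (.lit 0) ;;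
  .loop (.natLt (nv vI) (nv vWidth)) hullBody

/-- Integrate the piece `vR` of the envelope and write the corresponding row of the output. -/
def rowBody : Prog :=
  setR rAcc (rv rAcc +ᵣ (.get aC (.get aStack (nv vR)) *ᵣ
      (.get aStart (nv vR +ₙ .lit 1) -ᵣ .get aStart (nv vR)) +ᵣ
    .get aD (.get aStack (nv vR)) *ᵣ
      (.get aStart (nv vR +ₙ .lit 1) *ᵣ .get aStart (nv vR +ₙ .lit 1) -ᵣ
        .get aStart (nv vR) *ᵣ .get aStart (nv vR)) /ᵣ .lit 2)) ;;
  .setNat 7 (nv 6) (nv vLoc) ;;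
  .setNat 8 (nv 6) (.get aStack (nv vR) -ₙ nv vB) ;;
  .setReal 4 (nv 6) (rv rTime -ᵣ .get aStart (nv vR +ₙ .lit 1)) ;;
  .setReal 5 (nv 6) (rv rTime -ᵣ .get aStart (nv vR)) ;;
  inc 6

def rowsProg : Prog :=
  .setReal aStart (nv vH) (rv rEps) ;; setR rAcc (.lit 0) ;; forTo vR (nv vH) rowBody ;;
  .setReal aX (nv vLoc) (.get aX (nv vLoc) +ᵣ (.get aSgn (nv vLoc) *ᵣ rv rAcc -ᵣ
    rv rEps *ᵣ .get aX (nv vLoc) -ᵣ rv rEps *ᵣ rv rEps /ᵣ .lit 2 *ᵣ .get aGrad (nv vLoc)))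

/-- One interval of the double net. -/
def stepProg : Prog :=
  zeroProg aC ;; scatterProg aC aX ;; gradProg ;; zeroProg aD ;; scatterProg aD aGrad ;;
  forTo vLoc nLoc
    (setN vB (.get aBase (nv vLoc)) ;; sortProg ;; hullProg ;; rowsProg) ;;
  setR rTime (rv rTime -ᵣ rv rEps)

def outProg : Prog :=
  forTo vLoc nLoc (setR 6 (rv 6 +ᵣ .get 2 (nv vLoc) *ᵣ .get aX (nv vLoc)))

/-- The program that computes a double net and strategies that follow it. -/
def solverProg : Prog := setupProg ;; forTo vJ (nv vN) stepProg ;; outProg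

end Solver

end RealRAM

/-! ### The list of transitions and the input memory -/

namespace MarkovGame

variable {n m : ℕ}

theorem mem_transitions {M : MarkovGame (Fin n) (Fin m)} {e : Fin n × Fin m × Fin n} :
    e ∈ M.transitions ↔ M.rate e.1 e.2.1 e.2.2 ≠ 0 := by
  obtain ⟨l, a, l'⟩ := e
  simp [transitions]

theorem nodup_transitions (M : MarkovGame (Fin n) (Fin m)) : M.transitions.Nodup :=
  ((List.nodup_finRange n).product ((List.nodup_finRange m).product (List.nodup_finRange n))).filter
    _

theorem toFinset_transitions (M : MarkovGame (Fin n) (Fin m)) :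
    M.transitions.toFinset =
      Finset.univ.filter fun e : Fin n × Fin m × Fin n => M.rate e.1 e.2.1 e.2.2 ≠ 0 := by
  ext e
  simp [mem_transitions]

theorem length_transitions (M : MarkovGame (Fin n) (Fin m)) : M.transitions.length = M.size := by
  rw [size, ← toFinset_transitions, List.toFinset_card_of_nodup M.nodup_transitions]

/-- Links the sparse loops of the program, which run over non-zero rates only, to the full sums in
the definitions. -/
theorem sum_map_transitions (M : MarkovGame (Fin n) (Fin m))
    (f : Fin n × Fin m × Fin n → ℝ) (hf : ∀ e, M.rate e.1 e.2.1 e.2.2 = 0 → f e = 0) :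
    (M.transitions.map f).sum = ∑ e, f e := by
  rw [← List.sum_toFinset f M.nodup_transitions, toFinset_transitions, Finset.sum_filter_of_ne]
  intro e _ he h0
  exact he (hf e h0)

theorem mem_enabled_iff {M : MarkovGame (Fin n) (Fin m)} {l : Fin n} {a : Fin m} :
    a ∈ M.enabled l ↔ ∃ l', (l, a, l') ∈ M.transitions := by
  simp only [enabled, Finset.mem_filter, Finset.mem_univ, true_and, mem_transitions]
  rw [Finset.sum_pos_iff_of_nonneg fun l' _ => M.rate_nonneg l a l']
  simp only [Finset.mem_univ, true_and]
  exact exists_congr fun l' => (M.rate_nonneg l a l').lt_iff_ne.trans ne_comm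

/-- The sign of the optimisation at a location. -/
def sgn (M : MarkovGame (Fin n) (Fin m)) (l : Fin n) : ℝ := if l ∈ M.reach then 1 else -1

theorem sgn_mul_self (M : MarkovGame (Fin n) (Fin m)) (l : Fin n) : M.sgn l * M.sgn l = 1 := by
  unfold sgn; split_ifs <;> norm_num

/-- The input is in the memory. -/
structure HasInput (M : MarkovGame (Fin n) (Fin m)) (G : Finset (Fin n)) (T π : ℝ)
    (s : RealRAM.State) : Prop where
  loc : s.nat 0 0 = n
  act : s.nat 0 1 = m
  trans : s.nat 0 2 = M.transitions.length
  source : ∀ (e : ℕ) (h : e < M.transitions.length), s.nat 1 e = M.transitions[e].1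
  action : ∀ (e : ℕ) (h : e < M.transitions.length), s.nat 2 e = M.transitions[e].2.1
  target : ∀ (e : ℕ) (h : e < M.transitions.length), s.nat 3 e = M.transitions[e].2.2
  rate : ∀ (e : ℕ) (h : e < M.transitions.length), s.real 1 e =
    M.rate M.transitions[e].1 M.transitions[e].2.1 M.transitions[e].2.2
  reach : ∀ l : Fin n, s.nat 4 l = if l ∈ M.reach then 1 else 0
  goal : ∀ l : Fin n, s.nat 5 l = if l ∈ G then 1 else 0
  time : s.real 0 0 = T
  prec : s.real 0 1 = π
  init : ∀ l : Fin n, s.real 2 l = M.init l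

theorem hasInput_input (M : MarkovGame (Fin n) (Fin m)) (G : Finset (Fin n)) (T π : ℝ) :
    M.HasInput G T π (M.input G T π) := by
  constructor <;> intros <;> simp_all [input]

theorem HasInput.of_agree {M : MarkovGame (Fin n) (Fin m)} {G : Finset (Fin n)} {T π : ℝ}
    {p : RealRAM.Prog} {s t : RealRAM.State} (h : M.HasInput G T π s) (hst : RealRAM.Agree p s t)
    (hn : ∀ a < 6, a ∉ p.natMods) (hr : ∀ a < 3, a ∉ p.realMods) : M.HasInput G T π t := by
  have n0 := hst.1 0 (hn 0 (by norm_num))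
  have n1 := hst.1 1 (hn 1 (by norm_num))
  have n2 := hst.1 2 (hn 2 (by norm_num))
  have n3 := hst.1 3 (hn 3 (by norm_num))
  have n4 := hst.1 4 (hn 4 (by norm_num))
  have n5 := hst.1 5 (hn 5 (by norm_num))
  have r0 := hst.2 0 (hr 0 (by norm_num))
  have r1 := hst.2 1 (hr 1 (by norm_num))
  have r2 := hst.2 2 (hr 2 (by norm_num))
  cases h
  constructor <;> simp_all

end MarkovGame

namespace RealRAM

namespace Solver

open MarkovGame

variable {n m : ℕ}

theorem slot_inj {W l l' r r' : ℕ} (hr : r < W) (hr' : r' < W) (h : l * W + r = l' * W + r') :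
    l = l' ∧ r = r' := by
  have hW : 0 < W := by omega
  have h1 := congrArg (· / W) h
  have h2 := congrArg (· % W) h
  simp only [Nat.mul_comm _ W, Nat.mul_add_div hW, Nat.mul_add_mod, Nat.div_eq_of_lt hr,
    Nat.div_eq_of_lt hr', Nat.mod_eq_of_lt hr, Nat.mod_eq_of_lt hr'] at h1 h2
  exact ⟨by simpa using h1, h2⟩

/-- The slots of the enabled actions of a location. -/
def slots (M : MarkovGame (Fin n) (Fin m)) (W : ℕ) (l : Fin n) : Set ℕ :=
  {q | ∃ a ∈ M.enabled l, q = l * W + a}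

/-- The memory holds the input and the parameters of the computation. -/
structure Ready (M : MarkovGame (Fin n) (Fin m)) (G : Finset (Fin n)) (T π : ℝ) (N W : ℕ)
    (s : State) : Prop extends M.HasInput G T π s where
  steps : s.nat vN 0 = N
  width : s.nat vWidth 0 = W
  eps : s.real rEps 0 = T / N
  base : ∀ l : Fin n, s.nat aBase l = l * W
  sgn : ∀ l : Fin n, s.real aSgn l = M.sgn l
  slotCount : s.nat vSlots 0 = n * W

theorem Ready.of_agree {M : MarkovGame (Fin n) (Fin m)} {G : Finset (Fin n)} {T π : ℝ} {N W : ℕ}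
    {p : Prog} {s t : State} (h : Ready M G T π N W s) (hst : Agree p s t)
    (hn : ∀ a ∈ [0, 1, 2, 3, 4, 5, vN, vWidth, vSlots, aBase], a ∉ p.natMods)
    (hr : ∀ a ∈ [0, 1, 2, rEps, aSgn], a ∉ p.realMods) : Ready M G T π N W t := by
  have h20 := hst.1 vN (hn _ (by simp))
  have h21 := hst.1 vWidth (hn _ (by simp))
  have h22 := hst.1 vSlots (hn _ (by simp))
  have h9 := hst.1 aBase (hn _ (by simp))
  have r20 := hst.2 rEps (hr _ (by simp))
  have r13 := hst.2 aSgn (hr _ (by simp))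
  refine ⟨h.toHasInput.of_agree hst (fun a ha => hn a ?_) (fun a ha => hr a ?_), ?_, ?_, ?_, ?_, ?_,
    ?_⟩
  · interval_cases a <;> simp
  · interval_cases a <;> simp
  · rw [h20]; exact h.steps
  · rw [h21]; exact h.width
  · rw [r20]; exact h.eps
  · rw [h9]; exact h.base
  · rw [r13]; exact h.sgn
  · rw [h22]; exact h.slotCount

/-! ### Setup -/

/-- The program counts up to the least admissible `N`, which is affordable because the remaining
time is linear in `N` anyway. `N` is counted twice, as the machine cannot convert a natural number
to a real one. -/
theorem runs_gridProg {s : State} {T π : ℝ} (hT : 0 ≤ T) (hπ : 0 < π) (h0 : s.real 0 0 = T)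
    (h1 : s.real 0 1 = π) :
    ∃ N : ℕ, 0 < N ∧ 8 * T ^ 3 ≤ N ^ 2 * π ∧ (N : ℝ) ≤ 4 * (1 + T * √(T / π)) ∧
      Runs gridProg s (40 * N + 40) fun t => t.nat vN 0 = N ∧ t.real rEps 0 = T / N ∧
        t.real rTime 0 = T := by
  have hex : ∃ k : ℕ, 8 * T ^ 3 ≤ ((k : ℝ) + 1) ^ 2 * π := by
    obtain ⟨k, hk⟩ := exists_nat_ge (8 * T ^ 3 / π)
    refine ⟨k, ?_⟩
    rw [div_le_iff₀ hπ] at hk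
    refine hk.trans (mul_le_mul_of_nonneg_right ?_ hπ.le)
    nlinarith [(Nat.cast_nonneg k : (0 : ℝ) ≤ k)]
  classical
  set k := Nat.find hex with hk
  have hkspec := Nat.find_spec hex
  rw [← hk] at hkspec
  have hkmin : ∀ j < k, ((j : ℝ) + 1) ^ 2 * π < 8 * T ^ 3 := fun j hj => by
    have := Nat.find_min hex hj
    exact not_le.1 this
  refine ⟨k + 1, by omega, by push_cast; exact hkspec, ?_, ?_⟩
  · have hs : 0 ≤ T * √(T / π) := by positivity
    have hsq : (T * √(T / π)) ^ 2 * π = T ^ 3 := by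
      rw [mul_pow, Real.sq_sqrt (by positivity)]
      field_simp
    rcases Nat.eq_zero_or_pos k with h | h
    · rw [h]; push_cast; linarith
    · have h2 := hkmin (k - 1) (by omega)
      rw [Nat.cast_sub h] at h2
      -- Minimality of `N = k + 1` gives `k ^ 2 * π < 8 * T ^ 3`; the 8 is rounded up to the square
      -- 9.
      have h3 : (k : ℝ) ^ 2 ≤ (3 * (T * √(T / π))) ^ 2 := by
        refine le_of_mul_le_mul_right ?_ hπ
        have h4 : 0 ≤ T ^ 3 := by positivity
        calc (k : ℝ) ^ 2 * π ≤ 8 * T ^ 3 := by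
              refine le_trans (le_of_eq ?_) h2.le; push_cast; ring
          _ ≤ 9 * T ^ 3 := by linarith
          _ = (3 * (T * √(T / π))) ^ 2 * π := by rw [mul_pow, mul_assoc, hsq]; norm_num
      have h5 := le_of_sq_le_sq h3 (by positivity)
      push_cast
      linarith
  · unfold gridProg
    refine (Runs.seq (Runs.of_loopFree (c := 3)
      (Q := fun t => t = s.writeReal rN 0 1) rfl le_rfl (by simp [Prog.run, NExpr.eval, RExpr.eval]))
      fun t _ ht => Runs.seq (Runs.of_loopFree (c := 3)
      (Q := fun t' => t'.real 0 0 = T ∧ t'.real 0 1 = π ∧ t'.nat vN 0 = 1 ∧ t'.real rN 0 = 1)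
      rfl le_rfl (by subst ht; simp [Prog.run, NExpr.eval, h0, h1]))
      fun t' _ ht' => Runs.seq (Runs.forLoop k 13 (fun j u => u.real 0 0 = T ∧ u.real 0 1 = π ∧
        u.nat vN 0 = j + 1 ∧ u.real rN 0 = j + 1) (by simpa using ht') ?_ ?_) fun u _ hu =>
      Runs.of_loopFree (c := 20) rfl (by decide) ?_).mono ?_ fun _ _ h => h
    · intro j hj u _ hu
      simp only [Test.Holds, RExpr.eval, NExpr.eval, hu.1, hu.2.1, hu.2.2.2]
      rcases hj.lt_or_eq with h | h
      · have := hkmin j h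
        simp only [h, iff_true]
        push_cast
        nlinarith
      · rw [h]
        simp only [lt_self_iff_false, iff_false, not_lt]
        push_cast
        nlinarith
    · intro j hj u _ hu
      refine Runs.of_loopFree rfl (by decide) ?_
      simp [Prog.run, NExpr.eval, RExpr.eval, hu]
    · simp [Prog.run, NExpr.eval, RExpr.eval, hu]
    · simp only [Test.cost, NExpr.cost, RExpr.cost]
      omega

theorem exists_width {m : ℕ} (hm : 0 < m) :
    ∃ p : ℕ, m ≤ 2 ^ p ∧ 2 ^ p < 2 * m ∧ ∀ j < p, 2 ^ j < m := by
  have hex : ∃ p, m ≤ 2 ^ p := ⟨_, Nat.lt_two_pow_self.le⟩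
  classical
  have hmin : ∀ j < Nat.find hex, 2 ^ j < m := fun j hj => not_le.1 (Nat.find_min hex hj)
  refine ⟨Nat.find hex, Nat.find_spec hex, ?_, hmin⟩
  rcases Nat.eq_zero_or_pos (Nat.find hex) with h | h
  · rw [h]; omega
  · have h1 := hmin (Nat.find hex - 1) (by omega)
    obtain ⟨q, hq⟩ : ∃ q, Nat.find hex = q + 1 := ⟨Nat.find hex - 1, by omega⟩
    rw [hq, Nat.add_sub_cancel] at h1
    rw [hq, pow_succ]
    omega

theorem runs_widthProg {s : State} {p : ℕ} (hspec : s.nat 0 1 ≤ 2 ^ p)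
    (hmin : ∀ j < p, 2 ^ j < s.nat 0 1) :
    Runs widthProg s (20 * (p + 1)) fun t => t.nat vWidth 0 = 2 ^ p := by
  unfold widthProg
  refine (Runs.seq (Runs.of_loopFree (c := 3)
    (Q := fun t => t.nat vWidth 0 = 1) rfl le_rfl (by simp [Prog.run, NExpr.eval]))
    fun t hst ht => Runs.forLoop p 7 (fun j u => u.nat vWidth 0 = 2 ^ j) (by simpa using ht)
      ?_ ?_).mono ?_ fun _ _ h => h
  · intro j hj u htu hu
    have e : u.nat 0 1 = s.nat 0 1 := by rw [htu.1 0 (by decide), hst.1 0 (by decide)]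
    simp only [Test.Holds, NExpr.eval, hu, e]
    rcases hj.lt_or_eq with h | h
    · simp [h, hmin j h]
    · rw [h]; simp [hspec]
  · intro j hj u _ hu
    refine Runs.of_loopFree rfl (by decide) ?_
    simp [Prog.run, NExpr.eval, hu, pow_succ]
    omega
  · simp only [Test.cost, NExpr.cost]
    omega

end Solver

end RealRAM

namespace RealRAM

namespace Solver

open MarkovGame

variable {n m : ℕ} {M : MarkovGame (Fin n) (Fin m)} {G : Finset (Fin n)} {T π : ℝ} {N W : ℕ}

/-- Indices cannot be multiplied on this machine, so the bases `l * W` are accumulated by addition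
in `vB`. -/
theorem runs_locProg {s : State} (h : M.HasInput G T π s) (hW : s.nat vWidth 0 = W) :
    Runs locProg s (60 * n + 60) fun t => (∀ l : Fin n, t.nat aBase l = l * W) ∧
      (∀ l : Fin n, t.real aSgn l = M.sgn l) ∧ (∀ l : Fin n, t.real aX l = if l ∈ G then 1 else 0) ∧
      t.nat vSlots 0 = n * W := by
  unfold locProg
  refine (Runs.seq (Runs.of_loopFree (c := 3) (Q := fun t => t.nat vB 0 = 0) rfl le_rfl
    (by simp [Prog.run, NExpr.eval])) fun t hst ht =>
    Runs.seq (runs_forTo n 40 (fun k u => u.nat vB 0 = k * W ∧ ∀ l : Fin n, (l : ℕ) < k →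
      u.nat aBase l = l * W ∧ u.real aSgn l = M.sgn l ∧ u.real aX l = if l ∈ G then 1 else 0)
      (by decide) ?_ ?_ ?_ ?_) fun u _ hu => Runs.of_loopFree (c := 4) rfl le_rfl ?_).mono ?_
      fun _ _ h => h
  · intro u htu
    have hu := (h.of_agree hst (by decide) (by decide)).of_agree htu (by decide) (by decide)
    simp [NExpr.eval, hu.loc]
  · intro k u x hu
    simpa using hu
  · exact ⟨by simpa using ht, fun l hl => by omega⟩
  · intro k hk u htu hku hu
    have hin := (h.of_agree hst (by decide) (by decide)).of_agree htu (by decide) (by decide)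
    have hWu : u.nat vWidth 0 = W := by
      rw [htu.1 vWidth (by decide), hst.1 vWidth (by decide), hW]
    have hr := hin.reach ⟨k, hk⟩
    have hg := hin.goal ⟨k, hk⟩
    simp only at hr hg
    have hs : (locBody.run u).nat vB 0 = (k + 1) * W ∧
        (locBody.run u).nat aBase = Function.update (u.nat aBase) k (k * W) ∧
        (locBody.run u).real aSgn = Function.update (u.real aSgn) k (M.sgn ⟨k, hk⟩) ∧
        (locBody.run u).real aX = Function.update (u.real aX) k
          (if (⟨k, hk⟩ : Fin n) ∈ G then 1 else 0) := by
      refine ⟨?_, ?_, ?_, ?_⟩ <;> try ext l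
      all_goals
        by_cases h3 : (⟨k, hk⟩ : Fin n) ∈ M.reach <;> by_cases h4 : (⟨k, hk⟩ : Fin n) ∈ G <;>
        simp [Prog.run, locBody, NExpr.eval, RExpr.eval, Test.Holds, hku, hu.1, hr, hg, h3, h4, hWu,
          MarkovGame.sgn, Function.update_apply, Nat.succ_mul]
    refine Runs.of_loopFree rfl (by decide) ⟨hs.1, fun l hl => ?_⟩
    rw [hs.2.1, hs.2.2.1, hs.2.2.2]
    rcases Nat.lt_succ_iff_lt_or_eq.1 hl with h1 | h1
    · simpa [Function.update_apply, h1.ne] using hu.2 l h1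
    · obtain rfl : l = ⟨k, hk⟩ := Fin.ext h1
      simp
  · simp [Prog.run, NExpr.eval, hu.1]
    exact ⟨fun l => (hu.2 l l.2).1, fun l => (hu.2 l l.2).2.1, fun l => (hu.2 l l.2).2.2⟩
  · simp only [NExpr.cost]
    omega

theorem eval_slot {s : State} (h : Ready M G T π N W s) {e : ℕ} (he : e < M.transitions.length)
    (hse : s.nat vE 0 = e) :
    slot.eval s = (M.transitions[e].1 : ℕ) * W + M.transitions[e].2.1 := by
  simp [NExpr.eval, hse, h.source e he, h.action e he, h.base]

theorem runs_repProg {s : State} (h : Ready M G T π N W s) :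
    Runs repProg s (60 * M.transitions.length + 60) fun t =>
      ∀ l : Fin n, t.nat aRep l ∈ slots M W l := by
  unfold repProg
  refine (runs_forTo M.transitions.length 20 (fun k u => ∀ l : Fin n,
    (∃ e, ∃ he : e < M.transitions.length, e < k ∧ M.transitions[e].1 = l) →
      u.nat aRep l ∈ slots M W l) (by decide) ?_ ?_ ?_ ?_).mono ?_ ?_
  · intro u hsu
    simp [NExpr.eval, (h.of_agree hsu (by decide) (by decide)).trans]
  · intro k u x hu
    simpa using hu
  · rintro l ⟨e, _, he, _⟩
    omega
  · intro k hk u hsu hku hu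
    have hr := h.of_agree hsu (by decide) (by decide)
    refine Runs.of_loopFree rfl (by decide) fun l => ?_
    have hen : M.transitions[k].2.1 ∈ M.enabled M.transitions[k].1 :=
      mem_enabled_iff.2 ⟨_, List.getElem_mem hk⟩
    rintro ⟨e, he, hek, hel⟩
    have hrun : (Prog.setNat aRep (.get 1 (nv vE)) slot).run u = u.writeNat aRep
        M.transitions[k].1 (M.transitions[k].1 * W + M.transitions[k].2.1) := by
      rw [Prog.run, eval_slot hr hk hku]
      simp [NExpr.eval, hku, hr.source k hk]
    simp only [hrun, State.writeNat_nat]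
    by_cases h1 : M.transitions[k].1 = l
    · subst h1
      simp only [and_self, if_true]
      exact ⟨_, hen, rfl⟩
    · have h2 : (l : ℕ) ≠ M.transitions[k].1 := fun h' => h1 (Fin.ext h'.symm)
      simp only [h2, and_false, if_false]
      refine hu l ⟨e, he, ?_, hel⟩
      rcases Nat.lt_succ_iff_lt_or_eq.1 hek with h3 | h3
      · exact h3
      · subst h3; exact absurd hel h1
  · simp only [NExpr.cost]
    omega
  · intro t _ ht l
    obtain ⟨a, ha⟩ := M.enabled_nonempty l
    obtain ⟨l', hl'⟩ := mem_enabled_iff.1 ha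
    obtain ⟨e, he, hel⟩ := List.mem_iff_getElem.1 hl'
    exact ht l ⟨e, he, he, by rw [hel]⟩

theorem runs_fillProg {s : State} (h : Ready M G T π N W s)
    (hrep : ∀ l : Fin n, s.nat aRep l ∈ slots M W l) :
    Runs fillProg s (60 * (n * W) + 60 * n + 60) fun t =>
      ∀ l : Fin n, ∀ r < W, t.nat aPerm (l * W + r) ∈ slots M W l := by
  unfold fillProg
  refine (runs_forTo n (30 * W + 20) (fun k u => ∀ l : Fin n, (l : ℕ) < k → ∀ r < W,
    u.nat aPerm (l * W + r) ∈ slots M W l) (by decide) ?_ ?_ ?_ ?_).mono ?_ ?_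
  · intro u hsu
    simp [NExpr.eval, (h.of_agree hsu (by decide) (by decide)).loc]
  · intro k u x hu
    simpa using hu
  · intro l hl
    omega
  · intro k hk u hsu hku hu
    have hr := h.of_agree hsu (by decide) (by decide)
    have hrepu : ∀ l : Fin n, u.nat aRep l ∈ slots M W l := by
      rw [hsu.1 aRep (by decide)]; exact hrep
    refine (runs_forTo W 12 (fun j w => (∀ l : Fin n, (l : ℕ) < k → ∀ r < W,
      w.nat aPerm (l * W + r) ∈ slots M W l) ∧ ∀ r < j, w.nat aPerm (k * W + r) ∈ slots M W ⟨k, hk⟩)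
      (by decide) ?_ ?_ ?_ ?_).mono ?_ ?_
    · intro w huw
      simp [NExpr.eval, (hr.of_agree huw (by decide) (by decide)).width]
    · intro j w x hw
      simpa using hw
    · exact ⟨hu, fun r hr => by omega⟩
    · intro j hj w huw hjw hw
      have hrw := hr.of_agree huw (by decide) (by decide)
      have hkw : w.nat vLoc 0 = k := by rw [huw.1 vLoc (by decide), hku]
      have hbase := hrw.base ⟨k, hk⟩
      have hrepw := hrepu ⟨k, hk⟩
      rw [← huw.1 aRep (by decide)] at hrepw
      simp only at hbase hrepw
      refine Runs.of_loopFree rfl (by decide) ⟨fun l hl r hr => ?_, fun r hr => ?_⟩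
      · simp only [Prog.run, State.writeNat_nat, NExpr.eval, hkw, hjw, hbase, true_and]
        rw [if_neg fun h' => ?_]
        · exact hw.1 l hl r hr
        · have := (slot_inj hr hj h').1; omega
      · simp only [Prog.run, State.writeNat_nat, NExpr.eval, hkw, hjw, hbase, true_and]
        split_ifs with h1
        · exact hrepw
        · exact hw.2 r (by omega)
    · simp only [NExpr.cost]
      omega
    · intro w _ hw l hl r hr
      rcases Nat.lt_succ_iff_lt_or_eq.1 hl with h1 | h1
      · exact hw.1 l h1 r hr
      · obtain rfl : l = ⟨k, hk⟩ := Fin.ext h1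
        exact hw.2 r hr
  · simp only [NExpr.cost]
    rw [show n * (30 * W + 20 + (1 + 1) + 9) = 30 * (n * W) + 31 * n by ring]
    omega
  · intro t _ ht l
    exact ht l l.2

/-- Each enabled slot is written at its own place, so it occurs, and every other place holds an
enabled slot from the padding. Only this set of slots is tracked from here on, which makes later
reordering and repetitions irrelevant. -/
theorem runs_permProg {s : State} (h : Ready M G T π N W s) (hmW : m ≤ W)
    (hfill : ∀ l : Fin n, ∀ r < W, s.nat aPerm (l * W + r) ∈ slots M W l) :
    Runs permProg s (60 * M.transitions.length + 60) fun t =>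
      ∀ l : Fin n, t.nat aPerm '' Set.Ico (l * W) (l * W + W) = slots M W l := by
  unfold permProg
  refine (runs_forTo M.transitions.length 20 (fun k u =>
    (∀ l : Fin n, ∀ r < W, u.nat aPerm (l * W + r) ∈ slots M W l) ∧
    ∀ e, ∀ he : e < M.transitions.length, e < k →
      u.nat aPerm ((M.transitions[e].1 : ℕ) * W + M.transitions[e].2.1) =
        (M.transitions[e].1 : ℕ) * W + M.transitions[e].2.1) (by decide) ?_ ?_ ?_ ?_).mono ?_ ?_
  · intro u hsu
    simp [NExpr.eval, (h.of_agree hsu (by decide) (by decide)).trans]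
  · intro k u x hu
    simpa using hu
  · exact ⟨hfill, fun e _ he => by omega⟩
  · intro k hk u hsu hku hu
    have hr := h.of_agree hsu (by decide) (by decide)
    have hen : M.transitions[k].2.1 ∈ M.enabled M.transitions[k].1 :=
      mem_enabled_iff.2 ⟨_, List.getElem_mem hk⟩
    refine Runs.of_loopFree rfl (by decide) ⟨fun l r hr' => ?_, fun e he hek => ?_⟩
    · simp only [Prog.run, eval_slot hr hk hku, State.writeNat_nat, true_and]
      split_ifs with h1
      · have h2 := slot_inj hr' (M.transitions[k].2.1.2.trans_le hmW) h1
        obtain rfl : l = M.transitions[k].1 := Fin.ext h2.1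
        exact ⟨_, hen, rfl⟩
      · exact hu.1 l r hr'
    · simp only [Prog.run, eval_slot hr hk hku, State.writeNat_nat, true_and]
      split_ifs with h1
      · exact h1.symm
      · refine hu.2 e he ?_
        rcases Nat.lt_succ_iff_lt_or_eq.1 hek with h3 | h3
        · exact h3
        · subst h3; exact absurd rfl h1
  · simp only [NExpr.cost]
    omega
  · intro t _ ht l
    refine Set.Subset.antisymm ?_ ?_
    · rintro _ ⟨q, hq, rfl⟩
      obtain ⟨r, rfl⟩ := Nat.exists_eq_add_of_le hq.1
      exact ht.1 l r (by have := hq.2; omega)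
    · rintro _ ⟨a, ha, rfl⟩
      obtain ⟨l', hl'⟩ := mem_enabled_iff.1 ha
      obtain ⟨e, he, hel⟩ := List.mem_iff_getElem.1 hl'
      have h1 := ht.2 e he he
      rw [hel] at h1
      exact ⟨l * W + a, ⟨by omega, by have := a.2; omega⟩, h1⟩

theorem runs_setupProg {s : State} (h : M.HasInput G T π s) (hm : 0 < m) (hT : 0 ≤ T)
    (hπ : 0 < π) :
    ∃ N p : ℕ, 0 < N ∧ 8 * T ^ 3 ≤ N ^ 2 * π ∧ (N : ℝ) ≤ 4 * (1 + T * √(T / π)) ∧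
      m ≤ 2 ^ p ∧ 2 ^ p < 2 * m ∧
      Runs setupProg s
        (40 * N + 120 * M.transitions.length + 120 * n + 60 * (n * 2 ^ p) + 20 * p + 300)
        fun t => Ready M G T π N (2 ^ p) t ∧ t.real rTime 0 = T ∧
          (∀ l : Fin n, t.real aX l = if l ∈ G then 1 else 0) ∧
          ∀ l : Fin n, t.nat aPerm '' Set.Ico (l * 2 ^ p) (l * 2 ^ p + 2 ^ p) =
            slots M (2 ^ p) l := by
  obtain ⟨N, hN, hNπ, hNle, hgrid⟩ := runs_gridProg hT hπ h.time h.prec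
  obtain ⟨p, hp1, hp2, hmin⟩ := exists_width hm
  refine ⟨N, p, hN, hNπ, hNle, hp1, hp2, ?_⟩
  unfold setupProg
  refine (Runs.seq hgrid fun t1 a1 h1 => ?_).mono (d := 40 * N + 120 * M.transitions.length +
    120 * n + 60 * (n * 2 ^ p) + 20 * p + 300) (c := 40 * N + 40 + (20 * (p + 1) + (60 * n + 60 +
      (60 * M.transitions.length + 60 + (60 * (n * 2 ^ p) + 60 * n + 60 +
        (60 * M.transitions.length + 60)))))) (by omega) fun _ _ h => h
  have i1 := h.of_agree a1 (by decide) (by decide)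
  refine Runs.seq (runs_widthProg (p := p) (by rw [i1.act]; exact hp1)
    fun j hj => by rw [i1.act]; exact hmin j hj) fun t2 a2 h2 => ?_
  have i2 := i1.of_agree a2 (by decide) (by decide)
  refine Runs.seq (runs_locProg i2 h2) fun t3 a3 h3 => ?_
  have i3 : Ready M G T π N (2 ^ p) t3 := by
    refine ⟨i2.of_agree a3 (by decide) (by decide), ?_, ?_, ?_, h3.1, h3.2.1, h3.2.2.2⟩
    · rw [a3.1 vN (by decide), a2.1 vN (by decide)]; exact h1.1
    · rw [a3.1 vWidth (by decide)]; exact h2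
    · rw [a3.2 rEps (by decide), a2.2 rEps (by decide)]; exact h1.2.1
  refine Runs.seq (runs_repProg i3) fun t4 a4 h4 => ?_
  have i4 := i3.of_agree a4 (by decide) (by decide)
  refine Runs.seq (runs_fillProg i4 h4) fun t5 a5 h5 => ?_
  have i5 := i4.of_agree a5 (by decide) (by decide)
  refine (runs_permProg i5 hp1 h5).mono le_rfl fun t6 a6 h6 => ⟨i5.of_agree a6 (by decide)
    (by decide), ?_, fun l => ?_, h6⟩
  · rw [a6.2 rTime (by decide), a5.2 rTime (by decide), a4.2 rTime (by decide),
      a3.2 rTime (by decide), a2.2 rTime (by decide)]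
    exact h1.2.2
  · rw [a6.2 aX (by decide), a5.2 aX (by decide), a4.2 aX (by decide)]
    exact h3.2.2.1 l

end Solver

end RealRAM

/-! ### Coefficients of the lines and gradients at the end of an interval -/

namespace MarkovGame

variable {n m : ℕ} {M : MarkovGame (Fin n) (Fin m)}

/-- Turns both kinds of optimisation into a maximisation, so that one piece of code serves both
players. -/
theorem opt_eq_of_forall_sgn_mul_le {l : Fin n} {q : Fin m → ℝ} {a : Fin m}
    (ha : a ∈ M.enabled l) (h : ∀ b ∈ M.enabled l, M.sgn l * q b ≤ M.sgn l * q a) :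
    M.opt l q = q a := by
  obtain ⟨b, hb, hq⟩ := M.exists_eq_opt l q
  have h1 := h b hb
  unfold sgn at h1
  split_ifs at h1 with hl
  · exact le_antisymm (by linarith) (M.le_opt hl q ha)
  · exact le_antisymm (M.opt_le hl q ha) (by linarith)

end MarkovGame

namespace RealRAM

namespace Solver

open MarkovGame

variable {n m : ℕ} {M : MarkovGame (Fin n) (Fin m)} {G : Finset (Fin n)} {T π : ℝ} {N W : ℕ}

theorem runs_zeroProg {s : State} {d : ℕ} (hd : d = aC ∨ d = aD) (h : Ready M G T π N W s) :
    Runs (zeroProg d) s (30 * (n * W) + 30) fun t => ∀ q < n * W, t.real d q = 0 := by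
  unfold zeroProg
  refine (runs_forTo (n * W) 10 (fun k u => ∀ q < k, u.real d q = 0) (by simp [Prog.natMods])
    ?_ ?_ ?_ ?_).mono ?_ fun _ _ h => h
  · intro u hsu
    have hu := h.of_agree hsu (by simp [Prog.natMods, forTo]) (by
      rcases hd with rfl | rfl <;> decide)
    simp [NExpr.eval, hu.slotCount]
  · intro k u x hu
    simpa using hu
  · intro q hq
    omega
  · intro k hk u hsu hku hu
    refine Runs.of_loopFree rfl (by simp [Prog.bound, NExpr.cost, RExpr.cost]) fun q hq => ?_
    simp only [Prog.run, NExpr.eval, RExpr.eval, hku, State.writeReal_real, true_and]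
    split_ifs with h1
    · simp
    · exact hu q (by omega)
  · simp only [NExpr.cost]
    omega

theorem sum_transitions_slot (M : MarkovGame (Fin n) (Fin m)) (l : Fin n) (a : Fin m) (c : ℝ)
    (v : Fin n → ℝ) :
    (M.transitions.map fun e => if e.1 = l ∧ e.2.1 = a then
      c * ((M.rate e.1 e.2.1 e.2.2 : ℝ) * v e.2.2) else 0).sum =
      c * ∑ l', (M.rate l a l' : ℝ) * v l' := by
  rw [sum_map_transitions]
  · simp only [Fintype.sum_prod_type, ite_and]
    simp [Finset.sum_ite_eq', Finset.mul_sum]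
  · intro e he
    simp [he]

theorem runs_scatterProg {s : State} {d v : ℕ} (hd : d = aC ∨ d = aD) (hv : v ≠ d) (hmW : m ≤ W)
    (h : Ready M G T π N W s) (h0 : ∀ q < n * W, s.real d q = 0) :
    Runs (scatterProg d v) s (60 * M.transitions.length + 60) fun t =>
      ∀ (l : Fin n) (a : Fin m), t.real d (l * W + a) =
        M.sgn l * ∑ l', (M.rate l a l' : ℝ) * s.real v l' := by
  unfold scatterProg
  -- After `k` transitions each slot holds the partial sum over the first `k` list entries that
  -- belong to it. Because `m ≤ W`, different pairs have different slots.
  refine (runs_forTo M.transitions.length 40 (fun k u => ∀ (l : Fin n) (a : Fin m),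
    u.real d (l * W + a) = ((M.transitions.take k).map fun e => if e.1 = l ∧ e.2.1 = a then
      M.sgn l * ((M.rate e.1 e.2.1 e.2.2 : ℝ) * s.real v e.2.2) else 0).sum)
    (by simp [Prog.natMods]) ?_ ?_ ?_ ?_).mono ?_ ?_
  · intro u hsu
    have hu := h.of_agree hsu (by simp [Prog.natMods, forTo]) (by
      rcases hd with rfl | rfl <;> simp [forTo, Prog.realMods])
    simp [NExpr.eval, hu.trans]
  · intro k u x hu
    simpa using hu
  · intro l a
    rw [h0]
    · simp
    · have h1 := l.2
      have h2 := a.2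
      nlinarith
  · intro k hk u hsu hku hu
    have hr := h.of_agree hsu (by simp [Prog.natMods, forTo]) (by
      rcases hd with rfl | rfl <;> simp [forTo, Prog.realMods])
    have hvu : u.real v = s.real v := hsu.2 v (by simpa [forTo, Prog.realMods] using hv)
    refine Runs.of_loopFree rfl (by simp [Prog.bound, NExpr.cost, RExpr.cost]) fun l a => ?_
    rw [List.take_add_one, List.getElem?_eq_getElem hk, List.map_append, List.sum_append,
      ← hu l a]
    simp only [Prog.run, RExpr.eval, eval_slot hr hk hku, State.writeReal_real, true_and]
    simp only [NExpr.eval, hku, hr.source k hk, hr.target k hk, hr.rate k hk, hr.sgn, hvu,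
      Option.toList_some, List.map_cons, List.map_nil, List.sum_singleton]
    by_cases h1 : M.transitions[k].1 = l ∧ M.transitions[k].2.1 = a
    · obtain ⟨rfl, rfl⟩ := h1
      simp
    · rw [if_neg fun h' => h1 ?_, if_neg h1, add_zero]
      have h2 := slot_inj (a.2.trans_le hmW) (M.transitions[k].2.1.2.trans_le hmW) h'
      exact ⟨Fin.ext h2.1.symm, Fin.ext h2.2.symm⟩
  · simp only [NExpr.cost]
    omega
  · intro t _ ht l a
    rw [ht l a, List.take_length]
    exact sum_transitions_slot M l a (M.sgn l) fun l' => s.real v l'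

theorem runs_gradProg {s : State} (hM : M.IsNormed) (h : Ready M G T π N W s)
    (hperm : ∀ l : Fin n, s.nat aPerm '' Set.Ico (l * W) (l * W + W) = slots M W l)
    (hW : 0 < W)
    (hC : ∀ (l : Fin n) (a : Fin m), s.real aC (l * W + a) =
      M.sgn l * ∑ l', (M.rate l a l' : ℝ) * s.real aX l') :
    Runs gradProg s (60 * (n * W) + 70 * n + 60) fun t =>
      ∀ l : Fin n, t.real aGrad l = M.opt l (M.drift l fun l' => s.real aX l') := by
  unfold gradProg
  refine (runs_forTo n (50 * W + 50) (fun k u => ∀ l : Fin n, (l : ℕ) < k →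
    u.real aGrad l = M.opt l (M.drift l fun l' => s.real aX l')) (by decide) ?_ ?_ ?_ ?_).mono ?_ ?_
  · intro u hsu
    simp [NExpr.eval, (h.of_agree hsu (by decide) (by decide)).loc]
  · intro k u x hu
    simpa using hu
  · intro l hl
    omega
  · intro k hk u hsu hku hu
    have hr := h.of_agree hsu (by decide) (by decide)
    have hbase := hr.base ⟨k, hk⟩
    simp only at hbase
    have hpu : u.nat aPerm = s.nat aPerm := hsu.1 aPerm (by decide)
    have hCu : u.real aC = s.real aC := hsu.2 aC (by decide)
    have hXu : u.real aX = s.real aX := hsu.2 aX (by decide)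
    refine (Runs.seq (c := 20) (Q := fun w =>
        w.real aGrad k = s.real aC (s.nat aPerm (k * W)) ∧ ∀ l : Fin n, (l : ℕ) < k →
        w.real aGrad l = M.opt l (M.drift l fun l' => s.real aX l'))
      (Runs.of_loopFree rfl (by decide) ⟨?_, fun l hl => ?_⟩) fun w huw hw =>
      Runs.seq (runs_forTo W 30 (fun j y =>
        (∃ r < W, y.real aGrad k = s.real aC (s.nat aPerm (k * W + r))) ∧
        (∀ r < j, s.real aC (s.nat aPerm (k * W + r)) ≤ y.real aGrad k) ∧ ∀ l : Fin n,
        (l : ℕ) < k → y.real aGrad l = M.opt l (M.drift l fun l' => s.real aX l')) (by decide)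
        ?_ ?_ ?_ ?_) fun y hwy hy => Runs.of_loopFree (c := 20) rfl (by decide) fun l hl => ?_).mono
      ?_ fun _ _ h => h
    · simp [Prog.run, NExpr.eval, RExpr.eval, hku, hbase, hpu, hCu]
    · simpa [Prog.run, NExpr.eval, RExpr.eval, hku, hl.ne] using hu l hl
    · intro y hwy
      simp [NExpr.eval, ((hr.of_agree huw (by decide) (by decide)).of_agree hwy (by decide)
        (by decide)).width]
    · intro j y x hy
      simpa using hy
    · exact ⟨⟨0, hW, hw.1⟩, fun r hr => by omega, hw.2⟩
    · intro j hj y hwy hjy hy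
      have hry := (hr.of_agree huw (by decide) (by decide)).of_agree hwy (by decide) (by decide)
      have hky : y.nat vLoc 0 = k := by rw [hwy.1 vLoc (by decide), huw.1 vLoc (by decide), hku]
      have hby := hry.base ⟨k, hk⟩
      simp only at hby
      have hpy : y.nat aPerm = s.nat aPerm := by
        rw [hwy.1 aPerm (by decide), huw.1 aPerm (by decide), hpu]
      have hCy : y.real aC = s.real aC := by
        rw [hwy.2 aC (by decide), huw.2 aC (by decide), hCu]
      have hcand : cand.eval y = s.real aC (s.nat aPerm (k * W + j)) := by
        simp [RExpr.eval, NExpr.eval, hky, hby, hpy, hCy, hjy]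
      have hgk : (RExpr.get aGrad (nv vLoc)).eval y = y.real aGrad k := by
        simp [RExpr.eval, NExpr.eval, hky]
      refine Runs.of_loopFree rfl (by decide) ?_
      simp only [Prog.run, Test.Holds, hcand, hgk]
      split_ifs with h1
      · refine ⟨⟨j, hj, by simp [NExpr.eval, hky]⟩, fun r hr => ?_, fun l hl => ?_⟩
        · simp only [State.writeReal_real, NExpr.eval, hky, and_self, if_true]
          rcases Nat.lt_succ_iff_lt_or_eq.1 hr with h2 | h2
          · exact (hy.2.1 r h2).trans h1.le
          · rw [h2]
        · simpa [NExpr.eval, hky, hl.ne] using hy.2.2 l hl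
      · refine ⟨hy.1, fun r hr => ?_, hy.2.2⟩
        rcases Nat.lt_succ_iff_lt_or_eq.1 hr with h2 | h2
        · exact hy.2.1 r h2
        · rw [h2]; exact not_lt.1 h1
    · have hry := (hr.of_agree huw (by decide) (by decide)).of_agree hwy (by decide) (by decide)
      have hky : y.nat vLoc 0 = k := by rw [hwy.1 vLoc (by decide), huw.1 vLoc (by decide), hku]
      have hXy : y.real aX = s.real aX := by
        rw [hwy.2 aX (by decide), huw.2 aX (by decide), hXu]
      rcases Nat.lt_succ_iff_lt_or_eq.1 hl with h1 | h1
      · simpa [Prog.run, RExpr.eval, NExpr.eval, hky, h1.ne] using hy.2.2 l h1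
      · subst h1
        simp only [Prog.run, RExpr.eval, NExpr.eval, hky, State.writeReal_real, and_self, if_true,
          hry.sgn, hXy]
        obtain ⟨⟨r, hr', hval⟩, hmax, -⟩ := hy
        have hslot : s.nat aPerm (l * W + r) ∈ slots M W l := by
          rw [← hperm l]
          exact ⟨_, ⟨by omega, by omega⟩, rfl⟩
        obtain ⟨a, ha, hsa⟩ := hslot
        have hva : y.real aGrad l = M.sgn l * ∑ l', (M.rate l a l' : ℝ) * s.real aX l' := by
          rw [hval, hsa, hC]
        -- The loop found the maximal signed average; multiplying by the sign again and subtracting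
        -- `x l` gives the optimal drift.
        rw [opt_eq_of_forall_sgn_mul_le ha, hM.drift_eq ha, hva, ← mul_assoc, sgn_mul_self, one_mul]
        intro b hb
        have hslot : (l : ℕ) * W + b ∈ s.nat aPerm '' Set.Ico (l * W) (l * W + W) := by
          rw [hperm l]
          exact ⟨b, hb, rfl⟩
        obtain ⟨q, hq, hqb⟩ := hslot
        obtain ⟨r', rfl⟩ := Nat.exists_eq_add_of_le hq.1
        have h2 := hmax r' (by have := hq.2; omega)
        rw [hqb, hC, hva] at h2
        rw [hM.drift_eq ha, hM.drift_eq hb, mul_sub, mul_sub]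
        linarith
    · simp only [NExpr.cost]
      omega
  · simp only [NExpr.cost]
    rw [show n * (50 * W + 50 + (1 + 1) + 9) = 50 * (n * W) + 61 * n by ring]
    omega
  · intro t _ ht l
    exact ht l l.2

end Solver

end RealRAM

/-! ### Bottom-up merge sort of the slots by slope -/

namespace RealRAM

namespace Solver

theorem runs_mergeProg {s : State} {lo w : ℕ} (hlo : s.nat vLo 0 = lo) (hw : s.nat vRun 0 = w)
    (h1 : MonotoneOn (s.real aD ∘ s.nat aPerm) (Set.Ico lo (lo + w)))
    (h2 : MonotoneOn (s.real aD ∘ s.nat aPerm) (Set.Ico (lo + w) (lo + (w + w)))) :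
    Runs mergeProg s (190 * w + 60) fun t =>
      t.nat aPerm '' Set.Ico lo (lo + (w + w)) = s.nat aPerm '' Set.Ico lo (lo + (w + w)) ∧
      MonotoneOn (s.real aD ∘ t.nat aPerm) (Set.Ico lo (lo + (w + w))) ∧
      ∀ q ∉ Set.Ico lo (lo + (w + w)), t.nat aPerm q = s.nat aPerm q := by
  unfold mergeProg
  refine Runs.mono (c := 4 + (7 + ((w + w) * 60 + 11 + ((w + w) * 30 + 11)))) ?_ (by omega)
    fun _ _ h => h
  refine Runs.seq (c := 4) (Q := fun t => t.nat vI 0 = lo) (Runs.of_loopFree rfl le_rfl ?_)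
    fun t1 a1 e1 => Runs.seq (c := 7) (Q := fun t => t.nat vI 0 = lo ∧ t.nat vK 0 = lo + w)
      (Runs.of_loopFree rfl le_rfl ?_) fun t2 a2 e2 => Runs.seq (c := (w + w) * 60 + 11)
      (Q := fun t => ∃ i k, MergeInv (s.real aD) (s.nat aPerm) lo (lo + w) (lo + (w + w)) i k
        (lo + (w + w)) (t.nat aTmp))
      ((runs_forTo (v := vO) (e := nv vRun +ₙ nv vRun) (p := mergeBody) (w + w) 46 (fun j u => u.nat vI 0 + u.nat vK 0 = lo + j + (lo + w) ∧
        MergeInv (s.real aD) (s.nat aPerm) lo (lo + w) (lo + (w + w)) (u.nat vI 0) (u.nat vK 0)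
          (lo + j) (u.nat aTmp)) (by decide) ?_ ?_ ?_ ?_).mono ?_ ?_) fun t3 a3 e3 =>
      (runs_forTo (v := vO) (e := nv vRun +ₙ nv vRun)
        (p := .setNat aPerm (nv vLo +ₙ nv vO) (.get aTmp (nv vLo +ₙ nv vO))) (w + w) 13 (fun j u =>
        (∀ q < lo + j, lo ≤ q → u.nat aPerm q = t3.nat aTmp q) ∧
        ∀ q, q < lo ∨ lo + j ≤ q → u.nat aPerm q = s.nat aPerm q)
        (by decide) ?_ ?_ ?_ ?_).mono ?_ ?_
  · simp [Prog.run, NExpr.eval, hlo]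
  · simp [Prog.run, NExpr.eval, e1, a1.1 vLo (by decide), a1.1 vRun (by decide), hlo, hw]
  · intro u hu
    simp [NExpr.eval, hu.1 vRun (by decide), a2.1 vRun (by decide), a1.1 vRun (by decide), hw]
  · intro j u x hu
    simpa [State.writeNat_nat_ne] using hu
  · rw [e2.1, e2.2]
    exact ⟨by omega, MergeInv.start (by omega) (by omega) _⟩
  · intro j hj u hu hju hI
    have eLo : u.nat vLo 0 = lo := by
      rw [hu.1 vLo (by decide), a2.1 vLo (by decide), a1.1 vLo (by decide), hlo]
    have eRun : u.nat vRun 0 = w := by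
      rw [hu.1 vRun (by decide), a2.1 vRun (by decide), a1.1 vRun (by decide), hw]
    have eP : u.nat aPerm = s.nat aPerm := by
      rw [hu.1 aPerm (by decide), a2.1 aPerm (by decide), a1.1 aPerm (by decide)]
    have eD : u.real aD = s.real aD := by
      rw [hu.2 aD (by decide), a2.2 aD (by decide), a1.2 aD (by decide)]
    obtain ⟨hsum, hI⟩ := hI
    refine Runs.of_loopFree rfl (by decide) ?_
    simp only [mergeBody, Prog.run, Test.Holds, NExpr.eval, RExpr.eval, eLo, eRun, eP, eD, hju]
    split_ifs with hc
    · simp only [not_and, not_lt] at hc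
      have h3 := hI.takeLeft h1 h2 hc.1 hc.2 (B' := Function.update (u.nat aTmp) (lo + j)
        (s.nat aPerm (u.nat vI 0))) (fun q hq => Function.update_of_ne hq.ne _ _)
        (Function.update_self ..)
      constructor
      · simp
        omega
      · convert h3 using 1
        all_goals rfl
    · have hI1 := hI.le_mid
      have hI2 := hI.le_hi
      -- If the right block were exhausted, the number of entries still to be written would leave
      -- one in the left block, and the test would have taken it.
      have hk : u.nat vK 0 < lo + (w + w) := by
        by_contra hcon
        exact hc ⟨by omega, fun h' => hcon h'.1⟩
      have hkey : u.nat vI 0 < lo + w →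
          s.real aD (s.nat aPerm (u.nat vK 0)) ≤ s.real aD (s.nat aPerm (u.nat vI 0)) := by
        intro h4
        by_contra hcon
        exact hc ⟨h4, fun h' => hcon h'.2.le⟩
      have h3 := hI.takeRight h1 h2 hk hkey (B' := Function.update (u.nat aTmp) (lo + j)
        (s.nat aPerm (u.nat vK 0))) (fun q hq => Function.update_of_ne hq.ne _ _)
        (Function.update_self ..)
      constructor
      · simp
        omega
      · convert h3 using 1
        all_goals rfl
  · simp only [NExpr.cost]
    omega
  · exact fun t _ ht => ⟨_, _, ht.2⟩
  · intro u hu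
    simp [NExpr.eval, hu.1 vRun (by decide), a3.1 vRun (by decide), a2.1 vRun (by decide),
      a1.1 vRun (by decide), hw]
  · intro j u x hu
    simpa using hu
  · refine ⟨fun q hq hq' => by omega, fun q _ => ?_⟩
    rw [a3.1 aPerm (by decide), a2.1 aPerm (by decide), a1.1 aPerm (by decide)]
  · intro j hj u hu hju hI
    have eLo : u.nat vLo 0 = lo := by
      rw [hu.1 vLo (by decide), a3.1 vLo (by decide), a2.1 vLo (by decide), a1.1 vLo (by decide),
        hlo]
    have eT : u.nat aTmp = t3.nat aTmp := hu.1 aTmp (by decide)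
    refine Runs.of_loopFree rfl (by decide) ?_
    simp only [Prog.run, NExpr.eval, eLo, eT, hju, State.writeNat_nat, true_and]
    refine ⟨fun q hq hq' => ?_, fun q hq => ?_⟩
    · split_ifs with h3
      · rw [h3]
      · exact hI.1 q (by omega) hq'
    · rw [if_neg (by omega)]
      exact hI.2 q (by omega)
  · simp only [NExpr.cost]
    omega
  · intro t _ ht
    obtain ⟨i, k, hI⟩ := e3
    have heq : ∀ q ∈ Set.Ico lo (lo + (w + w)), t.nat aPerm q = t3.nat aTmp q := fun q hq =>
      ht.1 q hq.2 hq.1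
    refine ⟨?_, ?_, fun q hq => ht.2 q ?_⟩
    · rw [Set.image_congr heq]
      exact hI.image_eq
    · exact hI.sorted.congr fun q hq => by simp only [Function.comp, heq q hq]
    · simp only [Set.mem_Ico, not_and, not_lt] at hq
      omega

/-- One pass turns `2 * c` sorted blocks of length `w` into `c` blocks of twice the length. Blocks
not yet reached are unchanged, so the assumption on them still applies. -/
theorem runs_passProg {s : State} {b w c : ℕ} (hb : s.nat vB 0 = b) (hw : s.nat vRun 0 = w)
    (hw0 : 0 < w) (hW : s.nat vWidth 0 = c * (w + w))
    (h1 : ∀ i < c + c, MonotoneOn (s.real aD ∘ s.nat aPerm) (Set.Ico (b + i * w) (b + i * w + w))) :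
    Runs passProg s (200 * (c * (w + w)) + 60) fun t =>
      t.nat aPerm '' Set.Ico b (b + c * (w + w)) = s.nat aPerm '' Set.Ico b (b + c * (w + w)) ∧
      (∀ i < c, MonotoneOn (s.real aD ∘ t.nat aPerm)
        (Set.Ico (b + i * (w + w)) (b + i * (w + w) + (w + w)))) ∧
      ∀ q ∉ Set.Ico b (b + c * (w + w)), t.nat aPerm q = s.nat aPerm q := by
  unfold passProg
  refine (Runs.seq (c := 4) (Q := fun t => t.nat vLo 0 = b) (Runs.of_loopFree rfl le_rfl ?_)
    fun t1 a1 e1 => Runs.forLoop c (190 * w + 60 + 10) (fun j u =>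
      u.nat vLo 0 = b + j * (w + w) ∧
      u.nat aPerm '' Set.Ico b (b + c * (w + w)) = s.nat aPerm '' Set.Ico b (b + c * (w + w)) ∧
      (∀ i < j, MonotoneOn (s.real aD ∘ u.nat aPerm)
        (Set.Ico (b + i * (w + w)) (b + i * (w + w) + (w + w)))) ∧
      ∀ q ∉ Set.Ico b (b + j * (w + w)), u.nat aPerm q = s.nat aPerm q) ?_ ?_ ?_).mono ?_ ?_
  · simp [Prog.run, NExpr.eval, hb]
  · rw [a1.1 aPerm (by decide)]
    exact ⟨by omega, rfl, fun i hi => by omega, fun q _ => rfl⟩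
  · intro j hj u hu hI
    simp only [Test.Holds, NExpr.eval, hI.1, hu.1 vB (by decide), a1.1 vB (by decide), hb,
      hu.1 vWidth (by decide), a1.1 vWidth (by decide), hW, Nat.add_lt_add_iff_left]
    exact Nat.mul_lt_mul_right (by omega)
  · intro j hj u hu hI
    obtain ⟨hlo, himg, hsort, hout⟩ := hI
    have eRun : u.nat vRun 0 = w := by rw [hu.1 vRun (by decide), a1.1 vRun (by decide), hw]
    have eD : u.real aD = s.real aD := by rw [hu.2 aD (by decide), a1.2 aD (by decide)]
    have hge : ∀ q, b + j * (w + w) ≤ q → u.nat aPerm q = s.nat aPerm q := fun q hq =>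
      hout q fun h' => by have := h'.2; omega
    have hjc : j * (w + w) + (w + w) ≤ c * (w + w) := by
      rw [← Nat.succ_mul]; exact Nat.mul_le_mul_right _ hj
    have e1 : b + (j + j) * w = b + j * (w + w) := by ring
    have e2 : b + (j + j + 1) * w = b + j * (w + w) + w := by ring
    have m1 := h1 (j + j) (by omega)
    have m2 := h1 (j + j + 1) (by omega)
    rw [e1] at m1
    rw [e2] at m2
    refine Runs.seq (runs_mergeProg hlo eRun (by
      rw [eD]
      exact m1.congr fun q hq => by simp only [Function.comp, hge q hq.1]) (by
      rw [eD, ← add_assoc]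
      exact m2.congr fun q hq => by
        have := hq.1
        simp only [Function.comp, hge q (by omega)])) fun v huv hv =>
      Runs.of_loopFree rfl (by decide) ?_
    rw [eD] at hv
    have hsub : Set.Ico (b + j * (w + w)) (b + j * (w + w) + (w + w)) ⊆
        Set.Ico b (b + c * (w + w)) := fun q hq => ⟨by have := hq.1; omega, by have := hq.2; omega⟩
    have evLo : v.nat vLo 0 = b + j * (w + w) := by rw [huv.1 vLo (by decide), hlo]
    have evRun : v.nat vRun 0 = w := by rw [huv.1 vRun (by decide), eRun]
    refine ⟨?_, ?_, ?_, ?_⟩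
    · simp [Prog.run, NExpr.eval, evLo, evRun]
      ring
    · have := Set.image_eq_image_of_eqOn_compl hsub hv.1 hv.2.2
      simpa [Prog.run] using this.trans himg
    · intro i hi
      have hP : ((setN vLo (nv vLo +ₙ (nv vRun +ₙ nv vRun))).run v).nat aPerm = v.nat aPerm := by
        ext q; simp [Prog.run]
      rw [hP]
      rcases Nat.lt_succ_iff_lt_or_eq.1 hi with h3 | h3
      · refine (hsort i h3).congr fun q hq => ?_
        have h4 : i * (w + w) + (w + w) ≤ j * (w + w) := by
          rw [← Nat.succ_mul]; exact Nat.mul_le_mul_right _ h3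
        have := hq.2
        simp only [Function.comp]
        rw [hv.2.2 q fun h' => by have := h'.1; omega]
      · rw [h3]; exact hv.2.1
    · intro q hq
      have hP : ((setN vLo (nv vLo +ₙ (nv vRun +ₙ nv vRun))).run v).nat aPerm q = v.nat aPerm q := by
        simp [Prog.run]
      rw [Nat.succ_mul] at hq
      simp only [Set.mem_Ico, not_and, not_lt] at hq
      rw [hP, hv.2.2 q fun h' => by have := h'.1; have := h'.2; omega]
      exact hout q fun h' => by have := h'.1; have := h'.2; omega
  · simp only [Test.cost, NExpr.cost]
    have h3 : c * 1 ≤ c * w := Nat.mul_le_mul_left _ hw0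
    rw [show c * (1 + 1 + (1 + 1 + (1 + 1) + 1) + 1 + (190 * w + 60 + 10)) =
      190 * (c * w) + 78 * c by ring, show c * (w + w) = 2 * (c * w) by ring]
    omega
  · exact fun t _ ht => ht.2

/-- After `k` passes the blocks of length `2 ^ k` are sorted. Since the width is a power of two,
blocks always pair up exactly and `p` passes of linear cost suffice. -/
theorem runs_sortProg {s : State} {b p : ℕ} (hb : s.nat vB 0 = b) (hW : s.nat vWidth 0 = 2 ^ p) :
    Runs sortProg s (300 * (p * 2 ^ p) + 10) fun t =>
      t.nat aPerm '' Set.Ico b (b + 2 ^ p) = s.nat aPerm '' Set.Ico b (b + 2 ^ p) ∧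
      MonotoneOn (s.real aD ∘ t.nat aPerm) (Set.Ico b (b + 2 ^ p)) ∧
      ∀ q ∉ Set.Ico b (b + 2 ^ p), t.nat aPerm q = s.nat aPerm q := by
  unfold sortProg
  refine (Runs.seq (c := 3) (Q := fun t => t.nat vRun 0 = 1) (Runs.of_loopFree rfl le_rfl ?_)
    fun t1 a1 e1 => Runs.forLoop p (200 * 2 ^ p + 60 + 7) (fun k u => u.nat vRun 0 = 2 ^ k ∧
      u.nat aPerm '' Set.Ico b (b + 2 ^ p) = s.nat aPerm '' Set.Ico b (b + 2 ^ p) ∧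
      (∀ i < 2 ^ (p - k), MonotoneOn (s.real aD ∘ u.nat aPerm)
        (Set.Ico (b + i * 2 ^ k) (b + i * 2 ^ k + 2 ^ k))) ∧
      ∀ q ∉ Set.Ico b (b + 2 ^ p), u.nat aPerm q = s.nat aPerm q) ?_ ?_ ?_).mono ?_ ?_
  · simp [Prog.run, NExpr.eval]
  · rw [a1.1 aPerm (by decide)]
    refine ⟨e1, rfl, fun i _ x hx y hy _ => ?_, fun q _ => rfl⟩
    have h1 := hx.1
    have h2 := hx.2
    have h3 := hy.1
    have h4 := hy.2
    rw [show x = y by omega]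
  · intro k hk u hu hI
    simp only [Test.Holds, NExpr.eval, hI.1, hu.1 vWidth (by decide), a1.1 vWidth (by decide), hW]
    exact Nat.pow_lt_pow_iff_right (by norm_num)
  · intro k hk u hu hI
    obtain ⟨hrun, himg, hsort, hout⟩ := hI
    have eD : u.real aD = s.real aD := by rw [hu.2 aD (by decide), a1.2 aD (by decide)]
    have eB : u.nat vB 0 = b := by rw [hu.1 vB (by decide), a1.1 vB (by decide), hb]
    have hc : 2 ^ p = 2 ^ (p - (k + 1)) * (2 ^ k + 2 ^ k) := by
      rw [← two_mul, ← pow_succ', ← pow_add]; congr 1; omega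
    have hc2 : 2 ^ (p - k) = 2 ^ (p - (k + 1)) + 2 ^ (p - (k + 1)) := by
      rw [← two_mul, ← pow_succ']; congr 1; omega
    have h1 := runs_passProg eB hrun (by positivity) (c := 2 ^ (p - (k + 1))) (by
      rw [hu.1 vWidth (by decide), a1.1 vWidth (by decide), hW, hc]) (by
      rw [← hc2, eD]; exact hsort)
    rw [← hc, eD] at h1
    refine Runs.seq h1 fun v huv hv => Runs.of_loopFree rfl (by decide) ?_
    have evRun : v.nat vRun 0 = 2 ^ k := by rw [huv.1 vRun (by decide), hrun]
    have hP : ((setN vRun (nv vRun +ₙ nv vRun)).run v).nat aPerm = v.nat aPerm := by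
      ext q; simp [Prog.run]
    rw [hP]
    have hk2 : 2 ^ (k + 1) = 2 ^ k + 2 ^ k := by rw [pow_succ, mul_two]
    refine ⟨?_, hv.1.trans himg, ?_, fun q hq => (hv.2.2 q hq).trans (hout q hq)⟩
    · simp [Prog.run, NExpr.eval, evRun, hk2]
    · rw [hk2]; exact hv.2.1
  · simp only [Test.cost, NExpr.cost]
    have h1 : p * 1 ≤ p * 2 ^ p := Nat.mul_le_mul_left _ Nat.one_le_two_pow
    rw [show p * (1 + 1 + (1 + 1) + 1 + (200 * 2 ^ p + 60 + 7)) =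
      200 * (p * 2 ^ p) + 72 * p by ring]
    omega
  · rintro t _ ⟨-, himg, hsort, hout⟩
    refine ⟨himg, ?_, hout⟩
    simpa using hsort 0 (by simp)

end Solver

end RealRAM

/-! ### Gradients as lines, exact integration and the envelope scan -/

namespace MarkovGame

open MeasureTheory

variable {n m : ℕ} {M : MarkovGame (Fin n) (Fin m)}

/-- The gradients along an interval of the double net are given by lines. -/
theorem IsNormed.drift_linStep_eq (hM : M.IsNormed) {l : Fin n} {a : Fin m} (ha : a ∈ M.enabled l)
    (x : Fin n → ℝ) (τ : ℝ) :
    M.drift l (M.linStep x τ) a =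
      M.sgn l * (M.sgn l * (∑ l', (M.rate l a l' : ℝ) * x l') +
        M.sgn l * (∑ l', (M.rate l a l' : ℝ) * M.opt l' (M.drift l' x)) * τ) -
      x l - τ * M.opt l (M.drift l x) := by
  have h1 : ∀ y : ℝ, M.sgn l * (M.sgn l * y) = y := fun y => by
    rw [← mul_assoc, sgn_mul_self, one_mul]
  have h2 : ∀ y : ℝ, M.sgn l * (M.sgn l * y * τ) = y * τ := fun y => by
    rw [mul_assoc, h1]
  rw [hM.drift_eq ha, mul_add, h1, h2]
  simp only [linStep, mul_add, Finset.sum_add_distrib, Finset.sum_mul]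
  have h3 : ∀ l', (M.rate l a l' : ℝ) * (τ * M.opt l' (M.drift l' x)) =
      M.rate l a l' * M.opt l' (M.drift l' x) * τ := fun l' => by ring
  simp only [h3]
  ring

/-- The end of an interval of the double net, if the gradient is given by finitely many lines. -/
theorem quadStep_eq_of_pieces {l : Fin n} {x : Fin n → ℝ} {ε σ c d : ℝ} {h : ℕ} {Z C D : ℕ → ℝ}
    (h0 : Z 0 = 0) (hε : Z h = ε) (hZ : ∀ k < h, Z k ≤ Z (k + 1))
    (hopt : ∀ k < h, ∀ τ ∈ Set.Icc (Z k) (Z (k + 1)),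
      M.opt l (M.drift l (M.linStep x τ)) = σ * (C k + D k * τ) - c - τ * d) :
    M.quadStep x ε l = x l + (σ * (∑ k ∈ Finset.range h, (C k * (Z (k + 1) - Z k) +
      D k * (Z (k + 1) * Z (k + 1) - Z k * Z k) / 2)) - ε * c - ε * ε / 2 * d) := by
  have hc := fun a b => (M.continuous_opt_drift_linStep x l).intervalIntegrable (μ := volume) a b
  rw [quadStep, ← h0, ← hε, ← intervalIntegral.sum_integral_adjacent_intervals fun k _ => hc _ _]
  have h1 : ∀ k ∈ Finset.range h, ∫ s in (Z k)..(Z (k + 1)),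
      M.opt l (M.drift l (M.linStep x s)) =
      σ * (C k * (Z (k + 1) - Z k) + D k * (Z (k + 1) * Z (k + 1) - Z k * Z k) / 2) -
      ((Z (k + 1) * c + Z (k + 1) * Z (k + 1) / 2 * d) - (Z k * c + Z k * Z k / 2 * d)) := by
    intro k hk
    have hk' := Finset.mem_range.1 hk
    rw [intervalIntegral.integral_congr (g := fun τ => (σ * C k - c) + (σ * D k - d) * τ)
      fun τ hτ => by
        rw [Set.uIcc_of_le (hZ k hk')] at hτ
        simp only
        rw [hopt k hk' τ hτ]
        ring]
    rw [intervalIntegral.integral_add (by simp)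
      (by apply Continuous.intervalIntegrable; fun_prop), intervalIntegral.integral_const_mul,
      integral_id, intervalIntegral.integral_const, smul_eq_mul]
    ring
  -- The terms common to all actions telescope over the pieces and contribute only at the end `ε`.
  rw [Finset.sum_congr rfl h1, Finset.sum_sub_distrib, ← Finset.mul_sum,
    Finset.sum_range_sub fun k => Z k * c + Z k * Z k / 2 * d, h0]
  ring

end MarkovGame

namespace RealRAM

namespace Solver

open MarkovGame

/-- Linear time by amortisation: every line is pushed at most once, so it is popped at most once. -/
theorem runs_hullProg {s : State} {b W : ℕ} {ε : ℝ} (hb : s.nat vB 0 = b)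
    (hW : s.nat vWidth 0 = W) (hW0 : 0 < W) (hε : s.real rEps 0 = ε) (hε0 : 0 ≤ ε)
    (hsort : MonotoneOn (s.real aD ∘ s.nat aPerm) (Set.Ico b (b + W))) :
    Runs hullProg s (400 * W + 20) fun t =>
      HullInv (s.real aC) (s.real aD) (fun r => s.nat aPerm (b + r)) W ε W (t.nat vH 0)
        (t.nat aStack) (t.real aStart) ε := by
  unfold hullProg
  refine Runs.mono (c := 3 + (3 + (200 * (2 * W) + 5))) ?_ (by omega) fun _ _ h => h
  refine Runs.seq (Q := fun t => t.nat vI 0 = 0) (Runs.of_loopFree rfl le_rfl (by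
    simp [Prog.run, NExpr.eval])) fun t1 a1 e1 => Runs.seq (Q := fun t => t.nat vI 0 = 0 ∧
      t.nat vH 0 = 0) (Runs.of_loopFree rfl le_rfl (by simp [Prog.run, NExpr.eval, e1]))
    fun t2 a2 e2 => ?_
  have h0 : 200 * (2 * W) + 5 = 200 * (2 * (W - t2.nat vI 0) + t2.nat vH 0) +
      (Test.natLt (nv vI) (nv vWidth)).cost := by
    rw [e2.1, e2.2]; rfl
  rw [h0]
  refine (Runs.loop (fun u => ∃ E, HullInv (s.real aC) (s.real aD) (fun r => s.nat aPerm (b + r)) W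
    ε (u.nat vI 0) (u.nat vH 0) (u.nat aStack) (u.real aStart) E)
    -- An unprocessed line counts twice and a stack entry once. A push, a discard and a pop each
    -- lower this by at least 1, and 200 covers the cost of a round.
    (fun u => 200 * (2 * (W - u.nat vI 0) + u.nat vH 0)) ?_ ?_).mono le_rfl ?_
  · rw [e2.1, e2.2]
    exact ⟨0, HullInv.start hε0 hW0 _ _⟩
  · rintro u hu ⟨E, H⟩ hlt
    have eW : u.nat vWidth 0 = W := by
      rw [hu.1 vWidth (by decide), a2.1 vWidth (by decide), a1.1 vWidth (by decide), hW]
    have eB : u.nat vB 0 = b := by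
      rw [hu.1 vB (by decide), a2.1 vB (by decide), a1.1 vB (by decide), hb]
    have eP : u.nat aPerm = s.nat aPerm := by
      rw [hu.1 aPerm (by decide), a2.1 aPerm (by decide), a1.1 aPerm (by decide)]
    have eC : u.real aC = s.real aC := by
      rw [hu.2 aC (by decide), a2.2 aC (by decide), a1.2 aC (by decide)]
    have eD : u.real aD = s.real aD := by
      rw [hu.2 aD (by decide), a2.2 aD (by decide), a1.2 aD (by decide)]
    have eE : u.real rEps 0 = ε := by
      rw [hu.2 rEps (by decide), a2.2 rEps (by decide), a1.2 rEps (by decide), hε]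
    have hi : u.nat vI 0 < W := by simpa [Test.Holds, NExpr.eval, eW] using hlt
    have hD : ∀ r < u.nat vI 0, s.real aD (s.nat aPerm (b + r)) ≤
        s.real aD (s.nat aPerm (b + u.nat vI 0)) := fun r hr =>
      hsort ⟨by omega, by omega⟩ ⟨by omega, by omega⟩ (by omega)
    refine ⟨9 + 150, Runs.seq (Q := fun w => w = u.writeNat vQ 0 (s.nat aPerm (b + u.nat vI 0)))
      (Runs.of_loopFree rfl (by decide) (by simp [Prog.run, NExpr.eval, eB, eP]))
      fun w _ hw => Runs.of_loopFree rfl (by decide) ?_⟩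
    have wI : w.nat vI 0 = u.nat vI 0 := by simp [hw]
    have wH : w.nat vH 0 = u.nat vH 0 := by simp [hw]
    have wQ : w.nat vQ 0 = s.nat aPerm (b + u.nat vI 0) := by simp [hw]
    have wS : w.nat aStack = u.nat aStack := by rw [hw, State.writeNat_nat_ne _ _ _ (by decide)]
    have wR : w.real = u.real := by simp [hw]
    have hcost : (Test.natLt (nv vI) (nv vWidth)).cost = 5 := rfl
    simp only [Prog.run, Test.Holds, NExpr.eval, RExpr.eval, wI, wH, wQ, wS, wR, eC, eD, eE,
      hcost]
    generalize hqdef : s.nat aPerm (b + u.nat vI 0) = q at *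
    split_ifs with c1 c2 c3
    · have hS := H.push (by simpa only [hqdef] using hD) hi c1 (by simpa [hqdef] using c2) (by simpa [hqdef] using c3)
        (S' := Function.update (u.nat aStack) (u.nat vH 0) q)
        (Z' := Function.update (u.real aStart) (u.nat vH 0)
          ((s.real aC (u.nat aStack (u.nat vH 0 - 1)) - s.real aC q) /
            (s.real aD q - s.real aD (u.nat aStack (u.nat vH 0 - 1)))))
        (fun k => by simp [Function.update_apply, hqdef])
        (fun k => by simp [Function.update_apply, hqdef])
      refine ⟨⟨ε, ?_⟩, ?_⟩
      · simpa [State.writeNat_nat_ne, State.writeNat_nat_self, State.writeReal_real_self, wI, wH,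
          wQ, wS, wR] using hS
      · simp [wI, wH]
        omega
    · have hS := H.discard (by simpa only [hqdef] using hD) hi c1 (by simpa [hqdef] using c2)
        (by simpa [hqdef] using not_lt.1 c3)
      refine ⟨⟨ε, ?_⟩, ?_⟩
      · simpa [State.writeNat_nat_ne, wI, wH, wS, wR] using hS
      · simp [wH]
        omega
    · have hS := H.pop (by simpa only [hqdef] using hD) hi c1 (by simpa [hqdef] using not_lt.1 c2)
      refine ⟨⟨u.real aStart (u.nat vH 0 - 1), ?_⟩, ?_⟩
      · simpa [State.writeNat_nat_ne, wI, wH, wS, wR] using hS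
      · simp [wI]
        omega
    · have hH : u.nat vH 0 = 0 := by omega
      rw [hH] at H
      have hS := H.push_empty hi (S' := Function.update (u.nat aStack) 0 q)
        (Z' := Function.update (u.real aStart) 0 0) (by simp [hqdef]) (by simp)
      refine ⟨⟨ε, ?_⟩, ?_⟩
      · simpa [State.writeNat_nat_ne, State.writeNat_nat_self, State.writeReal_real_self, wI, wH,
          wQ, wS, wR, hH] using hS
      · simp [wI, wH, hH]
        omega
  · rintro t ht ⟨⟨E, H⟩, hlt⟩
    have eW : t.nat vWidth 0 = W := by
      rw [ht.1 vWidth (by decide), a2.1 vWidth (by decide), a1.1 vWidth (by decide), hW]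
    have hi : t.nat vI 0 = W := by
      have := H.le_width
      simp only [Test.Holds, NExpr.eval, eW] at hlt
      omega
    rw [hi] at H
    rwa [H.done rfl] at H

end Solver

end RealRAM

/-! ### From envelope pieces to optimal actions -/

namespace MarkovGame

variable {n m : ℕ} {M : MarkovGame (Fin n) (Fin m)}

/-- The pieces of the envelope of the lines of a location, closed by the end `ε` of the interval,
are played by optimal actions. -/
theorem IsNormed.optimal_of_hullInv (hM : M.IsNormed) {l : Fin n} {x : Fin n → ℝ} {C D : ℕ → ℝ}
    {P S : ℕ → ℕ} {W h : ℕ} {ε : ℝ} {Z : ℕ → ℝ}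
    (hP : P '' Set.Ico (l * W) (l * W + W) = RealRAM.Solver.slots M W l)
    (hC : ∀ a : Fin m, C (l * W + a) = M.sgn l * ∑ l', (M.rate l a l' : ℝ) * x l')
    (hD : ∀ a : Fin m, D (l * W + a) =
      M.sgn l * ∑ l', (M.rate l a l' : ℝ) * M.opt l' (M.drift l' x))
    (H : HullInv C D (fun r => P (l * W + r)) W ε W h S Z ε) {k : ℕ} (hk : k < h) :
    ∃ a ∈ M.enabled l, S k = l * W + a ∧
      ∀ τ ∈ Set.Icc (Function.update Z h ε k) (Function.update Z h ε (k + 1)),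
        M.drift l (M.linStep x τ) a = M.opt l (M.drift l (M.linStep x τ)) ∧
        M.opt l (M.drift l (M.linStep x τ)) =
          M.sgn l * (C (S k) + D (S k) * τ) - x l - τ * M.opt l (M.drift l x) := by
  obtain ⟨r, hr, hSr⟩ := H.mem k hk
  have hslot : P (l * W + r) ∈ RealRAM.Solver.slots M W l := by
    rw [← hP]
    exact ⟨_, ⟨by omega, by omega⟩, rfl⟩
  obtain ⟨a, ha, hSa⟩ := hslot
  have hSk : S k = l * W + a := hSr.trans hSa
  refine ⟨a, ha, hSk, fun τ hτ => ?_⟩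
  rw [Function.update_of_ne hk.ne] at hτ
  have hτ2 : τ ≤ if k + 1 < h then Z (k + 1) else ε := by
    refine hτ.2.trans (le_of_eq ?_)
    split_ifs with h1
    · rw [Function.update_of_ne h1.ne]
    · rw [show k + 1 = h by omega, Function.update_self]
  -- After multiplication by the sign, the drifts of two actions differ exactly as their lines do,
  -- so the maximal line belongs to an optimal action.
  have hopt : M.opt l (M.drift l (M.linStep x τ)) = M.drift l (M.linStep x τ) a := by
    refine opt_eq_of_forall_sgn_mul_le ha fun b hb => ?_
    have hslot : (l : ℕ) * W + b ∈ P '' Set.Ico (l * W) (l * W + W) := by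
      rw [hP]
      exact ⟨b, hb, rfl⟩
    obtain ⟨q, hq, hqb⟩ := hslot
    obtain ⟨r', rfl⟩ := Nat.exists_eq_add_of_le hq.1
    have h2 := H.max k hk τ hτ.1 hτ2 r' (by have := hq.2; omega)
    rw [hqb, hSk, hC, hC, hD, hD] at h2
    rw [hM.drift_linStep_eq ha, hM.drift_linStep_eq hb]
    have h3 : ∀ y z w : ℝ, M.sgn l * (M.sgn l * y - z - w) = y - M.sgn l * z - M.sgn l * w :=
      fun y z w => by rw [mul_sub, mul_sub, ← mul_assoc, sgn_mul_self, one_mul]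
    rw [h3, h3]
    linarith
  refine ⟨hopt.symm, ?_⟩
  rw [hopt, hM.drift_linStep_eq ha, hSk, hC, hD]

end MarkovGame

/-- Take the first `k` with `τ ≤ Z (k + 1)`; monotonicity of `Z` is not needed. -/
theorem exists_mem_Icc_succ {Z : ℕ → ℝ} {h : ℕ} {τ : ℝ} (hh : 0 < h) (h0 : Z 0 ≤ τ)
    (h1 : τ ≤ Z h) : ∃ k < h, τ ∈ Set.Icc (Z k) (Z (k + 1)) := by
  classical
  have hex : ∃ k, τ ≤ Z (k + 1) := ⟨h - 1, by rwa [Nat.sub_add_cancel hh]⟩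
  have hle : Nat.find hex ≤ h - 1 := Nat.find_min' hex (by rwa [Nat.sub_add_cancel hh])
  refine ⟨Nat.find hex, by omega, ?_, Nat.find_spec hex⟩
  rcases Nat.eq_zero_or_pos (Nat.find hex) with h2 | h2
  · rwa [h2]
  · have h3 := Nat.find_min hex (Nat.sub_lt h2 one_pos)
    rw [Nat.sub_add_cancel (m := 1) h2] at h3
    exact (not_le.1 h3).le

namespace HullInv

variable {C D : ℕ → ℝ} {Q : ℕ → ℕ} {W : ℕ} {ε : ℝ} {h : ℕ} {S : ℕ → ℕ} {Z : ℕ → ℝ}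

theorem height_pos (H : HullInv C D Q W ε W h S Z ε) : 0 < h := by
  rcases Nat.eq_zero_or_pos h with h0 | h0
  · exact absurd (H.of_empty h0).2 (lt_irrefl _)
  · exact h0

theorem update_zero (H : HullInv C D Q W ε W h S Z ε) : Function.update Z h ε 0 = 0 := by
  rw [Function.update_of_ne H.height_pos.ne, H.start_eq H.height_pos]

theorem update_le_succ (H : HullInv C D Q W ε W h S Z ε) {k : ℕ} (hk : k < h) :
    Function.update Z h ε k ≤ Function.update Z h ε (k + 1) := by
  rw [Function.update_of_ne hk.ne]
  by_cases h1 : k + 1 = h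
  · have := H.last_le (by omega)
    rwa [h1, Function.update_self, show k = h - 1 by omega]
  · rw [Function.update_of_ne h1]
    exact H.mono k (by omega)

theorem update_mem (H : HullInv C D Q W ε W h S Z ε) {k : ℕ} (hk : k ≤ h) :
    Function.update Z h ε k ∈ Set.Icc 0 ε := by
  have h1 : MonotoneOn (Function.update Z h ε) (Set.Iic h) :=
    monotoneOn_of_le_add_one Set.ordConnected_Iic fun a _ _ ha =>
      H.update_le_succ (Nat.lt_of_succ_le ha)
  have h2 := h1 (Nat.zero_le h) hk (Nat.zero_le k)
  have h3 := h1 hk Set.self_mem_Iic hk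
  rw [H.update_zero] at h2
  rw [Function.update_self] at h3
  exact ⟨h2, h3⟩

/-- Every time lies in one of the pieces. -/
theorem exists_piece (H : HullInv C D Q W ε W h S Z ε) {τ : ℝ} (hτ : τ ∈ Set.Icc 0 ε) :
    ∃ k < h, τ ∈ Set.Icc (Function.update Z h ε k) (Function.update Z h ε (k + 1)) :=
  exists_mem_Icc_succ H.height_pos (by rw [H.update_zero]; exact hτ.1)
    (by rw [Function.update_self]; exact hτ.2)

end HullInv

/-! ### The table of the strategies -/

namespace RealRAM

namespace Solver

open MarkovGame

variable {n m : ℕ} {M : MarkovGame (Fin n) (Fin m)} {G : Finset (Fin n)} {T π : ℝ} {N W : ℕ}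

/-- A row of the output table: location, action, and the ends of the time interval. -/
def row (s : State) (k : ℕ) : ℕ × ℕ × ℝ × ℝ := (s.nat 7 k, s.nat 8 k, s.real 4 k, s.real 5 k)

/-- The row prescribes an action that is optimal for the gradient of the double net. -/
def RowOptimal (M : MarkovGame (Fin n) (Fin m)) (G : Finset (Fin n)) (T : ℝ) (N : ℕ)
    (r : ℕ × ℕ × ℝ × ℝ) : Prop :=
  ∃ (l : Fin n) (a : Fin m), r.1 = l ∧ r.2.1 = a ∧ a ∈ M.enabled l ∧
    ∃ j < N, ∀ t ∈ Set.Icc r.2.2.1 r.2.2.2, ∃ τ ∈ Set.Icc 0 (T / N), t = T - j * (T / N) - τ ∧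
      M.drift l (M.linStep (M.doubleNet G (T / N) j) τ) a =
        M.opt l (M.drift l (M.linStep (M.doubleNet G (T / N) j) τ))

/-- All rows of the output table are optimal. -/
def TableOptimal (M : MarkovGame (Fin n) (Fin m)) (G : Finset (Fin n)) (T : ℝ) (N : ℕ)
    (s : State) : Prop :=
  ∀ k < s.nat 6 0, RowOptimal M G T N (row s k)

/-- Some row applies to location `l` at time `t`. -/
def Covered (s : State) (l : ℕ) (t : ℝ) : Prop :=
  ∃ k < s.nat 6 0, (row s k).1 = l ∧ t ∈ Set.Icc (row s k).2.2.1 (row s k).2.2.2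

/-- The table of `t` begins with the rows of the table of `s`. -/
def Extends (s t : State) : Prop :=
  s.nat 6 0 ≤ t.nat 6 0 ∧ ∀ k < s.nat 6 0, row t k = row s k

theorem Extends.trans {s t u : State} (h : Extends s t) (h' : Extends t u) : Extends s u :=
  ⟨h.1.trans h'.1, fun k hk => (h'.2 k (hk.trans_le h.1)).trans (h.2 k hk)⟩

theorem Covered.of_extends {s t : State} {l : ℕ} {τ : ℝ} (h : Covered s l τ) (hst : Extends s t) :
    Covered t l τ := by
  obtain ⟨k, hk, h1⟩ := h
  exact ⟨k, hk.trans_le hst.1, by rwa [hst.2 k hk]⟩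

/-- Writing `ε` into cell `h` of the starting times closes the last piece, so that the uniform
formula with `Z q` and `Z (q + 1)` applies to all pieces. The array then equals `Function.update Z h
ε`. -/
theorem runs_rowsProg {s : State} {l : Fin n} {h j : ℕ} (hM : M.IsNormed) (hj : j < N)
    (hr : Ready M G T π N W s) (hl : s.nat vLoc 0 = l) (hb : s.nat vB 0 = l * W)
    (hh : s.nat vH 0 = h)
    (hP : s.nat aPerm '' Set.Ico (l * W) (l * W + W) = slots M W l)
    (hC : ∀ a : Fin m, s.real aC (l * W + a) =
      M.sgn l * ∑ l', (M.rate l a l' : ℝ) * M.doubleNet G (T / N) j l')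
    (hD : ∀ a : Fin m, s.real aD (l * W + a) = M.sgn l * ∑ l', (M.rate l a l' : ℝ) *
      M.opt l' (M.drift l' (M.doubleNet G (T / N) j)))
    (H : HullInv (s.real aC) (s.real aD) (fun r => s.nat aPerm (l * W + r)) W (T / N) W h
      (s.nat aStack) (s.real aStart) (T / N))
    (hX : s.real aX l = M.doubleNet G (T / N) j l)
    (hgrad : s.real aGrad l = M.opt l (M.drift l (M.doubleNet G (T / N) j)))
    (htime : s.real rTime 0 = T - j * (T / N)) (hopt : TableOptimal M G T N s) :
    Runs rowsProg s (150 * W + 100) fun t =>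
      t.real aX l = M.doubleNet G (T / N) (j + 1) l ∧
      (∀ i ≠ (l : ℕ), t.real aX i = s.real aX i) ∧
      Extends s t ∧ TableOptimal M G T N t ∧
      ∀ τ ∈ Set.Icc 0 (T / N), Covered t l (T - j * (T / N) - τ) := by
  set ε : ℝ := T / N with hε
  set Z : ℕ → ℝ := Function.update (s.real aStart) h ε with hZ
  set S : ℕ → ℕ := s.nat aStack with hS
  set R := s.nat 6 0 with hR
  have hpieces := fun k (hk : k < h) => hM.optimal_of_hullInv hP hC hD H hk
  have hhW := H.height_le
  unfold rowsProg
  refine Runs.mono (c := 10 + (3 + ((h * (120 + 2 + 9) + 2 + 6) + 60))) ?_ (by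
    have : h * (120 + 2 + 9) ≤ W * 131 := Nat.mul_le_mul hhW le_rfl
    omega) fun _ _ h => h
  refine Runs.seq (Q := fun u => u.real aStart = Z) (Runs.of_loopFree rfl (by decide) ?_)
    fun u1 a1 e1 => Runs.seq (Q := fun u => u.real rAcc 0 = 0) (Runs.of_loopFree rfl (by decide) ?_)
    fun u2 a2 e2 => Runs.seq (runs_forTo (v := vR) (e := nv vH) (p := rowBody) h 120 (fun k u =>
      u.nat 6 0 = R + k ∧ u.real rAcc 0 = ∑ q ∈ Finset.range k,
        (s.real aC (S q) * (Z (q + 1) - Z q) +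
          s.real aD (S q) * (Z (q + 1) * Z (q + 1) - Z q * Z q) / 2) ∧
      (∀ q < R, row u q = row s q) ∧ ∀ q < k, row u (R + q) =
        ((l : ℕ), S q - l * W, T - j * ε - Z (q + 1), T - j * ε - Z q)) (by decide)
        ?_ ?_ ?_ ?_) fun t a3 ht => Runs.of_loopFree rfl (by decide) ?_
  · simp only [Prog.run, NExpr.eval, RExpr.eval, State.writeReal_real_self, hh, hr.eps]
    rfl
  · simp [Prog.run, NExpr.eval, RExpr.eval]
  · intro u a3
    simp [NExpr.eval, a3.1 vH (by decide), a2.1 vH (by decide), a1.1 vH (by decide), hh]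
  · intro k u x hu
    simpa [row] using hu
  · refine ⟨?_, by simpa using e2, fun q _ => ?_, fun q hq => by omega⟩
    · rw [a2.1 6 (by decide), a1.1 6 (by decide)]; rfl
    · simp only [row, a2.1 7 (by decide), a1.1 7 (by decide), a2.1 8 (by decide),
        a1.1 8 (by decide), a2.2 4 (by decide), a1.2 4 (by decide), a2.2 5 (by decide),
        a1.2 5 (by decide)]
  · rintro k hk u a3 hku ⟨h1, h2, h3, h4⟩
    have ul : u.nat vLoc 0 = l := by
      rw [a3.1 vLoc (by decide), a2.1 vLoc (by decide), a1.1 vLoc (by decide), hl]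
    have ub : u.nat vB 0 = l * W := by
      rw [a3.1 vB (by decide), a2.1 vB (by decide), a1.1 vB (by decide), hb]
    have uS : u.nat aStack = S := by
      rw [a3.1 aStack (by decide), a2.1 aStack (by decide), a1.1 aStack (by decide)]
    have uZ : u.real aStart = Z := by
      rw [a3.2 aStart (by decide), a2.2 aStart (by decide), e1]
    have uC : u.real aC = s.real aC := by
      rw [a3.2 aC (by decide), a2.2 aC (by decide), a1.2 aC (by decide)]
    have uD : u.real aD = s.real aD := by
      rw [a3.2 aD (by decide), a2.2 aD (by decide), a1.2 aD (by decide)]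
    have uT : u.real rTime 0 = T - j * ε := by
      rw [a3.2 rTime (by decide), a2.2 rTime (by decide), a1.2 rTime (by decide), htime]
    refine Runs.of_loopFree rfl (by decide) ⟨?_, ?_, fun q hq => ?_, fun q hq => ?_⟩
    · simp [rowBody, Prog.run, NExpr.eval, h1, add_assoc]
    · simp [rowBody, Prog.run, NExpr.eval, RExpr.eval, hku, uS, uZ, uC, uD, h2, Finset.sum_range_succ]
    · rw [← h3 q hq]
      have : q ≠ R + k := by omega
      simp [row, rowBody, Prog.run, NExpr.eval, RExpr.eval, h1, this]
    · rcases Nat.lt_succ_iff_lt_or_eq.1 hq with hq | rfl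
      · rw [← h4 q hq]
        simp [row, rowBody, Prog.run, NExpr.eval, RExpr.eval, h1, hq.ne]
      · simp [row, rowBody, Prog.run, NExpr.eval, RExpr.eval, h1, hku, uS, uZ, uT, ub, ul]
  · obtain ⟨h1, h2, h3, h4⟩ := ht
    have tr := (((hr.of_agree a1 (by decide) (by decide)).of_agree a2 (by decide)
      (by decide)).of_agree a3 (by decide) (by decide))
    have tl : t.nat vLoc 0 = l := by
      rw [a3.1 vLoc (by decide), a2.1 vLoc (by decide), a1.1 vLoc (by decide), hl]
    have tX : t.real aX = s.real aX := by
      rw [a3.2 aX (by decide), a2.2 aX (by decide), a1.2 aX (by decide)]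
    have tG : t.real aGrad = s.real aGrad := by
      rw [a3.2 aGrad (by decide), a2.2 aGrad (by decide), a1.2 aGrad (by decide)]
    set w := Prog.run _ t with hw
    have wrow : ∀ q, row w q = row t q := fun q => by
      simp [hw, row, Prog.run]
    have w6 : w.nat 6 0 = R + h := by simpa [hw, Prog.run] using h1
    refine ⟨?_, fun i hi => ?_, ⟨by omega, fun k hk => by rw [wrow, h3 k hk]⟩, fun k hk => ?_,
      fun τ hτ => ?_⟩
    · rw [doubleNet, quadStep_eq_of_pieces (σ := M.sgn l) (c := M.doubleNet G ε j l)
        (d := M.opt l (M.drift l (M.doubleNet G ε j))) (C := fun k => s.real aC (S k))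
        (D := fun k => s.real aD (S k)) H.update_zero (Function.update_self ..)
        (fun k hk => H.update_le_succ hk) fun k hk τ hτ => by
          obtain ⟨a, -, -, ha⟩ := hpieces k hk
          exact (ha τ hτ).2]
      simp [hw, Prog.run, NExpr.eval, RExpr.eval, tl, tX, tG, tr.sgn, tr.eps, h2, hX, hgrad,
        ← hε, ← hZ]
    · simp [hw, Prog.run, NExpr.eval, tl, hi, tX]
    · rw [wrow]
      rcases Nat.lt_or_ge k R with hk' | hk'
      · rw [h3 k hk']
        exact hopt k hk'
      · obtain ⟨k, rfl⟩ := Nat.exists_eq_add_of_le hk'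
        have hkh : k < h := by omega
        rw [h4 k hkh]
        obtain ⟨a, ha, hSa, hτ⟩ := hpieces k hkh
        -- Time runs backwards along an interval, so the piece from `Z k` to `Z (k + 1)` becomes the
        -- row from `T - j * ε - Z (k + 1)` to `T - j * ε - Z k`. The action number is the slot
        -- minus the base of the location.
        refine ⟨l, a, rfl, by simp [hSa], ha, j, hj, fun t ht => ⟨T - j * ε - t, ?_, by ring, ?_⟩⟩
        · have h5 := H.update_mem hkh.le
          have h6 := H.update_mem (k := k + 1) hkh
          have h7 := ht.1
          have h8 := ht.2
          simp only [← hZ] at h5 h6 h7 h8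
          exact ⟨by linarith [h5.1], by linarith [h6.2]⟩
        · have h7 := ht.1
          have h8 := ht.2
          simp only at h7 h8
          exact (hτ _ ⟨by linarith, by linarith⟩).1
    · obtain ⟨k, hk, hτ1, hτ2⟩ := H.exists_piece hτ
      refine ⟨R + k, by omega, ?_⟩
      rw [wrow, h4 k hk]
      exact ⟨rfl, by simp only; linarith, by simp only; linarith⟩

end Solver

end RealRAM

/-! ### One interval of the double net, and the final average -/

namespace RealRAM

namespace Solver

open MarkovGame

variable {n m : ℕ} {M : MarkovGame (Fin n) (Fin m)} {G : Finset (Fin n)} {T π : ℝ} {N W : ℕ}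

/-- The part of a step that computes the new value and the rows of the location `vLoc`. -/
abbrev envelopeProg : Prog :=
  setN vB (.get aBase (nv vLoc)) ;; sortProg ;; hullProg ;; rowsProg

theorem runs_envelopeProg {s : State} {l : Fin n} {j p : ℕ} (hM : M.IsNormed) (hj : j < N)
    (hT : 0 ≤ T) (hr : Ready M G T π N (2 ^ p) s) (hl : s.nat vLoc 0 = l)
    (hP : ∀ l' : Fin n, s.nat aPerm '' Set.Ico (l' * 2 ^ p) (l' * 2 ^ p + 2 ^ p) =
      slots M (2 ^ p) l')
    (hC : ∀ a : Fin m, s.real aC (l * 2 ^ p + a) =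
      M.sgn l * ∑ l', (M.rate l a l' : ℝ) * M.doubleNet G (T / N) j l')
    (hD : ∀ a : Fin m, s.real aD (l * 2 ^ p + a) = M.sgn l * ∑ l', (M.rate l a l' : ℝ) *
      M.opt l' (M.drift l' (M.doubleNet G (T / N) j)))
    (hX : s.real aX l = M.doubleNet G (T / N) j l)
    (hgrad : s.real aGrad l = M.opt l (M.drift l (M.doubleNet G (T / N) j)))
    (htime : s.real rTime 0 = T - j * (T / N)) (hopt : TableOptimal M G T N s) :
    Runs envelopeProg s (300 * (p * 2 ^ p) + 550 * 2 ^ p + 140) fun t =>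
      (∀ l' : Fin n, t.nat aPerm '' Set.Ico (l' * 2 ^ p) (l' * 2 ^ p + 2 ^ p) =
        slots M (2 ^ p) l') ∧
      t.real aX l = M.doubleNet G (T / N) (j + 1) l ∧
      (∀ i ≠ (l : ℕ), t.real aX i = s.real aX i) ∧
      Extends s t ∧ TableOptimal M G T N t ∧
      ∀ τ ∈ Set.Icc 0 (T / N), Covered t l (T - j * (T / N) - τ) := by
  refine Runs.mono (c := 10 + ((300 * (p * 2 ^ p) + 10) + ((400 * 2 ^ p + 20) +
    (150 * 2 ^ p + 100)))) ?_ (by omega) fun _ _ h => h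
  refine Runs.seq (Q := fun t => t.nat vB 0 = l * 2 ^ p) (Runs.of_loopFree rfl (by decide)
    (by simp [Prog.run, NExpr.eval, hl, hr.base])) fun t1 a1 e1 => ?_
  have r1 := hr.of_agree a1 (by decide) (by decide)
  refine Runs.seq (runs_sortProg e1 r1.width) fun t2 a2 ⟨e2, e3, e4⟩ => ?_
  have r2 := r1.of_agree a2 (by decide) (by decide)
  have b2 : t2.nat vB 0 = l * 2 ^ p := by rw [a2.1 vB (by decide), e1]
  have D2 : t2.real aD = s.real aD := by rw [a2.2 aD (by decide), a1.2 aD (by decide)]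
  have C2 : t2.real aC = s.real aC := by rw [a2.2 aC (by decide), a1.2 aC (by decide)]
  have P1 : t1.nat aPerm = s.nat aPerm := a1.1 aPerm (by decide)
  have P2 : ∀ l' : Fin n, t2.nat aPerm '' Set.Ico (l' * 2 ^ p) (l' * 2 ^ p + 2 ^ p) =
      slots M (2 ^ p) l' := by
    intro l'
    rw [← hP l', ← P1]
    -- Sorting permutes the places of `l` without changing their set of slots, and the places of
    -- other locations are disjoint from them.
    by_cases hll : l' = l
    · rw [hll, e2]
    · refine Set.image_congr fun q hq => e4 q fun hq' => hll ?_
      obtain ⟨r, rfl⟩ := Nat.exists_eq_add_of_le hq.1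
      obtain ⟨r', h'⟩ := Nat.exists_eq_add_of_le hq'.1
      have h1 := hq.2
      have h2 := hq'.2
      exact Fin.ext (slot_inj (by omega) (by omega) h').1
  refine Runs.seq (runs_hullProg b2 r2.width (by positivity) r2.eps (by positivity)
    (by rw [D2]; rwa [a1.2 aD (by decide)] at e3)) fun t3 a3 H => ?_
  have P3 : t3.nat aPerm = t2.nat aPerm := a3.1 aPerm (by decide)
  have C3 : t3.real aC = s.real aC := by rw [a3.2 aC (by decide), C2]
  have D3 : t3.real aD = s.real aD := by rw [a3.2 aD (by decide), D2]
  have X3 : t3.real aX = s.real aX := by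
    rw [a3.2 aX (by decide), a2.2 aX (by decide), a1.2 aX (by decide)]
  have row3 : ∀ k, row t3 k = row s k := fun k => by
    simp only [row, a3.1 7 (by decide), a2.1 7 (by decide), a1.1 7 (by decide),
      a3.1 8 (by decide), a2.1 8 (by decide), a1.1 8 (by decide), a3.2 4 (by decide),
      a2.2 4 (by decide), a1.2 4 (by decide), a3.2 5 (by decide), a2.2 5 (by decide),
      a1.2 5 (by decide)]
  have n3 : t3.nat 6 0 = s.nat 6 0 := by
    rw [a3.1 6 (by decide), a2.1 6 (by decide), a1.1 6 (by decide)]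
  refine (runs_rowsProg (l := l) hM hj (r2.of_agree a3 (by decide) (by decide)) ?_ ?_ rfl
    ?_ ?_ ?_ ?_ ?_ ?_ ?_ ?_).mono le_rfl ?_
  · rw [a3.1 vLoc (by decide), a2.1 vLoc (by decide), a1.1 vLoc (by decide), hl]
  · rw [a3.1 vB (by decide), b2]
  · rw [P3, P2]
  · rwa [C3]
  · rwa [D3]
  · rwa [P3, C3, D3, ← C2, ← D2]
  · rwa [X3]
  · rwa [a3.2 aGrad (by decide), a2.2 aGrad (by decide), a1.2 aGrad (by decide)]
  · rwa [a3.2 rTime (by decide), a2.2 rTime (by decide), a1.2 rTime (by decide)]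
  · intro k hk
    rw [row3]
    exact hopt k (by omega)
  · rintro t a4 ⟨h1, h2, h3, h4, h5⟩
    refine ⟨fun l' => by rw [a4.1 aPerm (by decide), P3, P2], h1, fun i hi => by rw [h2 i hi, X3],
      ⟨by have := h3.1; omega, fun k hk => by rw [h3.2 k (by omega), row3]⟩, h4, h5⟩

/-- The state after `j` intervals. -/
structure StepInv (M : MarkovGame (Fin n) (Fin m)) (G : Finset (Fin n)) (T π : ℝ) (N W j : ℕ)
    (s : State) : Prop where
  ready : Ready M G T π N W s
  value : ∀ l : Fin n, s.real aX l = M.doubleNet G (T / N) j l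
  perm : ∀ l : Fin n, s.nat aPerm '' Set.Ico (l * W) (l * W + W) = slots M W l
  optimal : TableOptimal M G T N s
  covered : ∀ j' < j, ∀ l : Fin n, ∀ τ ∈ Set.Icc 0 (T / N), Covered s l (T - j' * (T / N) - τ)
  time : s.real rTime 0 = T - j * (T / N)

theorem runs_stepProg {s : State} {j p : ℕ} (hM : M.IsNormed) (hT : 0 ≤ T) (hm : m ≤ 2 ^ p)
    (hj : j < N) (h : StepInv M G T π N (2 ^ p) j s) :
    Runs stepProg s (120 * M.transitions.length + 900 * (n * 2 ^ p) + 300 * (n * (p * 2 ^ p)) + 400)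
      (StepInv M G T π N (2 ^ p) (j + 1)) := by
  set W := 2 ^ p with hW
  have hW0 : 0 < W := by positivity
  set len := M.transitions.length with hlen
  have hnW : n * 1 ≤ n * W := Nat.mul_le_mul_left _ hW0
  refine Runs.mono (c := (30 * (n * W) + 30) + ((60 * len + 60) + ((60 * (n * W) + 70 * n + 60) +
    ((30 * (n * W) + 30) + ((60 * len + 60) +
    ((n * ((300 * (p * W) + 550 * W + 140) + 2 + 9) + 2 + 6) + 10)))))) ?_ (by
      have : n * ((300 * (p * W) + 550 * W + 140) + 2 + 9) =
        300 * (n * (p * W)) + 550 * (n * W) + 151 * n := by ring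
      omega) fun _ _ h => h
  have hx : (fun l' : Fin n => s.real aX l') = M.doubleNet G (T / N) j := funext h.value
  refine Runs.seq (runs_zeroProg (Or.inl rfl) h.ready) fun t1 a1 e1 => ?_
  have r1 := h.ready.of_agree a1 (by decide) (by decide)
  refine Runs.seq (runs_scatterProg (Or.inl rfl) (by decide) hm r1 e1) fun t2 a2 e2 => ?_
  have r2 := r1.of_agree a2 (by decide) (by decide)
  have X1 : t1.real aX = s.real aX := a1.2 aX (by decide)
  have X2 : t2.real aX = s.real aX := by rw [a2.2 aX (by decide), X1]
  have P2 : t2.nat aPerm = s.nat aPerm := by rw [a2.1 aPerm (by decide), a1.1 aPerm (by decide)]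
  refine Runs.seq (runs_gradProg hM r2 (by rw [P2]; exact h.perm) hW0
    (by rw [X2, ← X1]; exact e2)) fun t3 a3 e3 => ?_
  have r3 := r2.of_agree a3 (by decide) (by decide)
  refine Runs.seq (runs_zeroProg (Or.inr rfl) r3) fun t4 a4 e4 => ?_
  have r4 := r3.of_agree a4 (by decide) (by decide)
  refine Runs.seq (runs_scatterProg (Or.inr rfl) (by decide) hm r4 e4) fun t5 a5 e5 => ?_
  have r5 := r4.of_agree a5 (by decide) (by decide)
  have P5 : t5.nat aPerm = s.nat aPerm := by
    rw [a5.1 aPerm (by decide), a4.1 aPerm (by decide), a3.1 aPerm (by decide), P2]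
  have X5 : t5.real aX = s.real aX := by
    rw [a5.2 aX (by decide), a4.2 aX (by decide), a3.2 aX (by decide), X2]
  have G4 : ∀ l : Fin n, t4.real aGrad l = M.opt l (M.drift l (M.doubleNet G (T / N) j)) := by
    intro l
    rw [a4.2 aGrad (by decide), e3, X2, hx]
  have C5 : ∀ (l : Fin n) (a : Fin m), t5.real aC (l * W + a) =
      M.sgn l * ∑ l', (M.rate l a l' : ℝ) * M.doubleNet G (T / N) j l' := by
    intro l a
    rw [a5.2 aC (by decide), a4.2 aC (by decide), a3.2 aC (by decide), e2]
    simp only [X1, h.value]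
  have D5 : ∀ (l : Fin n) (a : Fin m), t5.real aD (l * W + a) =
      M.sgn l * ∑ l', (M.rate l a l' : ℝ) * M.opt l' (M.drift l' (M.doubleNet G (T / N) j)) := by
    intro l a
    rw [e5]
    simp only [G4]
  have row5 : ∀ k, row t5 k = row s k := fun k => by
    simp only [row, a5.1 7 (by decide), a4.1 7 (by decide), a3.1 7 (by decide), a2.1 7 (by decide),
      a1.1 7 (by decide), a5.1 8 (by decide), a4.1 8 (by decide), a3.1 8 (by decide),
      a2.1 8 (by decide), a1.1 8 (by decide), a5.2 4 (by decide), a4.2 4 (by decide),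
      a3.2 4 (by decide), a2.2 4 (by decide), a1.2 4 (by decide), a5.2 5 (by decide),
      a4.2 5 (by decide), a3.2 5 (by decide), a2.2 5 (by decide), a1.2 5 (by decide)]
  have n5 : t5.nat 6 0 = s.nat 6 0 := by
    rw [a5.1 6 (by decide), a4.1 6 (by decide), a3.1 6 (by decide), a2.1 6 (by decide),
      a1.1 6 (by decide)]
  have T5 : t5.real rTime 0 = T - j * (T / N) := by
    rw [a5.2 rTime (by decide), a4.2 rTime (by decide), a3.2 rTime (by decide),
      a2.2 rTime (by decide), a1.2 rTime (by decide), h.time]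
  refine Runs.seq (runs_forTo (v := vLoc) (e := nLoc) (p := envelopeProg) n
    (300 * (p * W) + 550 * W + 140) (fun k u =>
      (∀ l : Fin n, u.nat aPerm '' Set.Ico (l * W) (l * W + W) = slots M W l) ∧
      -- The values are overwritten in place. This is safe because all lines and gradients were
      -- computed beforehand from the old values, and the update of a location reads only its own
      -- value.
      (∀ l : Fin n, u.real aX l = M.doubleNet G (T / N) (if (l : ℕ) < k then j + 1 else j) l) ∧
      Extends s u ∧ TableOptimal M G T N u ∧ ∀ l : Fin n, (l : ℕ) < k →
        ∀ τ ∈ Set.Icc 0 (T / N), Covered u l (T - j * (T / N) - τ))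
    (by decide) ?_ ?_ ?_ ?_) fun t a6 ht => Runs.of_loopFree rfl (by decide) ?_
  · intro u a6
    simp [NExpr.eval, (r5.of_agree a6 (by decide) (by decide)).loc]
  · intro k u x hu
    simpa [row, Extends, TableOptimal, Covered, State.writeNat_nat_ne] using hu
  · refine ⟨by rw [P5]; exact h.perm, fun l => by simpa [X5] using h.value l,
      ⟨n5.ge, fun k _ => row5 k⟩, fun k hk => ?_, fun l hl => by omega⟩
    rw [row5]
    exact h.optimal k (by omega)
  · rintro k hk u a6 hku ⟨h1, h2, h3, h4, h5⟩
    have hXu := h2 ⟨k, hk⟩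
    simp only [lt_irrefl, if_false] at hXu
    refine (runs_envelopeProg (l := ⟨k, hk⟩) hM hj hT (r5.of_agree a6 (by decide) (by decide)) hku
      h1 (fun a => ?_) (fun a => ?_) hXu ?_ ?_ h4).mono le_rfl ?_
    · rw [a6.2 aC (by decide), C5 ⟨k, hk⟩]
    · rw [a6.2 aD (by decide), D5 ⟨k, hk⟩]
    · rw [a6.2 aGrad (by decide), a5.2 aGrad (by decide), G4 ⟨k, hk⟩]
    · rw [a6.2 rTime (by decide), T5]
    · rintro w a7 ⟨f1, f2, f3, f4, f5, f6⟩
      refine ⟨f1, fun l => ?_, h3.trans f4, f5, fun l hl => ?_⟩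
      · by_cases hlk : (l : ℕ) = k
        · have : l = ⟨k, hk⟩ := Fin.ext hlk
          subst this
          simpa using f2
        · rw [f3 l hlk, h2 l]
          congr 1
          by_cases h6 : (l : ℕ) < k
          · rw [if_pos h6, if_pos (by omega)]
          · rw [if_neg h6, if_neg (by omega)]
      · by_cases hlk : (l : ℕ) = k
        · have : l = ⟨k, hk⟩ := Fin.ext hlk
          subst this
          exact f6
        · exact fun τ hτ => (h5 l (by omega) τ hτ).of_extends f4
  · obtain ⟨h1, h2, h3, h4, h5⟩ := ht
    have r6 := r5.of_agree a6 (by decide) (by decide)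
    set w := Prog.run _ t with hw
    have aw : Agree (setR rTime (rv rTime -ᵣ rv rEps)) t w := by
      refine ⟨fun a _ => rfl, fun a ha => ?_⟩
      rw [hw, Prog.run, State.writeReal_real_ne]
      simpa [Prog.realMods] using ha
    have wrow : ∀ k, row w k = row t k := fun k => by simp [hw, row, Prog.run]
    have tw : Extends t w := ⟨le_rfl, fun k _ => wrow k⟩
    refine ⟨r6.of_agree aw (by decide) (by decide), fun l => ?_, h1, fun k hk => ?_,
      fun j' hj' l τ hτ => ?_, ?_⟩
    · rw [aw.2 aX (by decide), h2, if_pos l.2]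
    · rw [wrow]
      exact h4 k hk
    · rcases Nat.lt_succ_iff_lt_or_eq.1 hj' with h6 | rfl
      · exact ((h.covered j' h6 l τ hτ).of_extends h3).of_extends tw
      · exact (h5 l l.2 τ hτ).of_extends tw
    · have T6 : t.real rTime 0 = T - j * (T / N) := by rw [a6.2 rTime (by decide), T5]
      simp only [hw, Prog.run, NExpr.eval, RExpr.eval, State.writeReal_real, and_self, if_true, T6,
        r6.eps]
      push_cast
      ring

theorem runs_outProg {s : State} {f : Fin n → ℝ} (h : Ready M G T π N W s)
    (hf : ∀ l : Fin n, s.real aX l = f l) (h6 : s.real 6 0 = 0) :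
    Runs outProg s (40 * n + 20) fun t => t.real 6 0 = ∑ l, M.init l * f l := by
  unfold outProg
  refine (runs_forTo n 20 (fun k u => u.real 6 0 =
    ∑ l : Fin n, if (l : ℕ) < k then M.init l * f l else 0) (by decide) ?_ ?_ ?_ ?_).mono ?_ ?_
  · intro u hu
    simp [NExpr.eval, (h.of_agree hu (by decide) (by decide)).loc]
  · intro k u x hu
    simpa using hu
  · simpa using h6
  · intro k hk u hsu hku hu
    have hr := h.of_agree hsu (by decide) (by decide)
    refine Runs.of_loopFree rfl (by decide) ?_
    have e1 := hr.init ⟨k, hk⟩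
    have e2 : u.real aX k = f ⟨k, hk⟩ := by rw [hsu.2 aX (by decide)]; exact hf ⟨k, hk⟩
    simp only at e1
    simp only [Prog.run, NExpr.eval, RExpr.eval, State.writeReal_real, and_self, if_true, hku, hu,
      e1, e2]
    -- The new summand is written as a sum with a single non-zero term, and the two sums are
    -- compared termwise.
    rw [← Fintype.sum_ite_eq (⟨k, hk⟩ : Fin n) fun l => M.init l * f l, ← Finset.sum_add_distrib]
    refine Finset.sum_congr rfl fun l _ => ?_
    rcases lt_trichotomy (l : ℕ) k with h1 | h1 | h1
    · have : (⟨k, hk⟩ : Fin n) ≠ l := fun h => by simp [← h] at h1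
      rw [if_pos h1, if_neg this, if_pos (by omega), add_zero]
    · have : (⟨k, hk⟩ : Fin n) = l := Fin.ext h1.symm
      rw [if_neg h1.not_lt, if_pos this, if_pos (by omega), zero_add]
    · have : (⟨k, hk⟩ : Fin n) ≠ l := fun h => by simp [← h] at h1
      rw [if_neg h1.not_gt, if_neg this, if_neg (by omega), add_zero]
  · simp only [NExpr.cost]
    omega
  · intro t _ ht
    simpa using ht

end Solver

end RealRAM

/-! ### Extraction of the scheduler and the total running time -/

namespace RealRAM

namespace Solver

open MarkovGame

variable {n m : ℕ} {M : MarkovGame (Fin n) (Fin m)} {G : Finset (Fin n)} {T π : ℝ} {N W : ℕ}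

theorem exists_grid_interval (hN : 0 < N) {t : ℝ} (ht : t ∈ Set.Icc 0 T) :
    ∃ j < N, ∃ τ ∈ Set.Icc 0 (T / N), t = T - j * (T / N) - τ := by
  have hN' : (N : ℝ) ≠ 0 := by positivity
  obtain ⟨j, hj, h1, h2⟩ := exists_mem_Icc_succ (Z := fun j : ℕ => j * (T / N)) (τ := T - t) hN
    (by simpa using ht.2) (by rw [mul_div_cancel₀ _ hN']; linarith [ht.1])
  push_cast at h2
  exact ⟨j, hj, T - t - j * (T / N), ⟨by linarith, by linarith⟩, by ring⟩

/-- An optimal table that covers all locations and times describes a scheduler. -/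
theorem exists_scheduler {s : State} (hm : 0 < m) (hopt : TableOptimal M G T N s)
    (hcov : ∀ l : Fin n, ∀ t ∈ Set.Icc 0 T, Covered s l t) :
    ∃ σ : Fin n → ℝ → Fin m, OutputsScheduler s T σ ∧ M.FollowsDoubleNet G T N σ ∧
      ∀ P, M.IsStrategy P T σ := by
  classical
  -- The first alternative makes the search for a row succeed at every real time, so that the first
  -- index is a total function of `t`. On `[0, T]` coverage ensures that a genuine row is found.
  let p : Fin n → ℝ → ℕ → Prop := fun l t k =>
    s.nat 6 0 ≤ k ∨ s.nat 7 k = l ∧ t ∈ Set.Icc (s.real 4 k) (s.real 5 k)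
  have hex : ∀ l t, ∃ k, p l t k := fun l t => ⟨s.nat 6 0, Or.inl le_rfl⟩
  let act : ℕ → Fin m := fun k => if h : s.nat 8 k < m then ⟨s.nat 8 k, h⟩ else ⟨0, hm⟩
  let σ : Fin n → ℝ → Fin m := fun l t => act (Nat.find (hex l t))
  have hlt : ∀ l, ∀ t ∈ Set.Icc 0 T, Nat.find (hex l t) < s.nat 6 0 := by
    intro l t ht
    obtain ⟨k, hk, h1⟩ := hcov l t ht
    exact (Nat.find_min' (hex l t) (Or.inr h1)).trans_lt hk
  have happ : ∀ l, ∀ t ∈ Set.Icc 0 T, s.nat 7 (Nat.find (hex l t)) = l ∧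
      t ∈ Set.Icc (s.real 4 (Nat.find (hex l t))) (s.real 5 (Nat.find (hex l t))) := fun l t ht =>
    (Nat.find_spec (hex l t)).resolve_left (not_le.2 (hlt l t ht))
  have hrow : ∀ l, ∀ t ∈ Set.Icc 0 T, s.nat 8 (Nat.find (hex l t)) = σ l t ∧
      σ l t ∈ M.enabled l ∧ ∃ j < N, ∃ τ ∈ Set.Icc 0 (T / N), t = T - j * (T / N) - τ ∧
        M.drift l (M.linStep (M.doubleNet G (T / N) j) τ) (σ l t) =
          M.opt l (M.drift l (M.linStep (M.doubleNet G (T / N) j) τ)) := by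
    intro l t ht
    obtain ⟨l', a, h1, h2, h3, j, hj, h4⟩ := hopt _ (hlt l t ht)
    obtain ⟨h5, h6⟩ := happ l t ht
    have hl : l' = l := Fin.ext (h1.symm.trans h5)
    subst hl
    have hσ : σ l' t = a := by
      have h2' : s.nat 8 (Nat.find (hex l' t)) = a := h2
      have h8 : s.nat 8 (Nat.find (hex l' t)) < m := h2' ▸ a.2
      exact Fin.ext (by simp only [σ, act, dif_pos h8, h2'])
    rw [hσ]
    exact ⟨h2, h3, j, hj, h4 t h6⟩
  refine ⟨σ, fun l t ht => ⟨_, hlt l t ht, happ l t ht, (hrow l t ht).1, fun k' hk' h =>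
    Nat.find_min (hex l t) hk' (Or.inr h)⟩, fun l t ht => (hrow l t ht).2,
    fun P l _ => ⟨fun t ht => (hrow l t ht).2.1, fun a => ?_⟩⟩
  -- The first applicable index is measurable in `t`, since each row applies on a closed interval or
  -- nowhere.
  have hmeas : Measurable (σ l) := (measurable_from_top (f := act)).comp
    (measurable_find (hex l) fun k => (MeasurableSet.const _).union
      ((MeasurableSet.const _).inter measurableSet_Icc))
  exact measurableSet_Icc.inter (hmeas (measurableSet_singleton a))

theorem runs_solverProg (hM : M.IsNormed) (hn : 0 < n) (hm : 0 < m) (hT : 0 ≤ T) (hπ : 0 < π) :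
    ∃ N p : ℕ, 0 < N ∧ 8 * T ^ 3 ≤ N ^ 2 * π ∧ (N : ℝ) ≤ 4 * (1 + T * √(T / π)) ∧
      m ≤ 2 ^ p ∧ 2 ^ p < 2 * m ∧
      Runs solverProg (M.input G T π) (3000 * (N * (M.size + n * (2 ^ p * (p + 1))))) fun t =>
        TableOptimal M G T N t ∧ (∀ l : Fin n, ∀ τ ∈ Set.Icc 0 T, Covered t l τ) ∧
        (∀ l : Fin n, t.real aX l = M.doubleNet G (T / N) N l) ∧
        t.real 6 0 = ∑ l, M.init l * M.doubleNet G (T / N) N l := by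
  obtain ⟨N, p, hN, hNπ, hNle, hp1, hp2, hset⟩ :=
    runs_setupProg (M.hasInput_input G T π) hm hT hπ
  refine ⟨N, p, hN, hNπ, hNle, hp1, hp2, ?_⟩
  rw [length_transitions] at hset
  refine (Runs.seq hset fun t1 a1 ⟨r1, e1, e2, e3⟩ => Runs.seq (runs_forTo (v := vJ) (e := nv vN)
    (p := stepProg) N
    (120 * M.transitions.length + 900 * (n * 2 ^ p) + 300 * (n * (p * 2 ^ p)) + 400)
    (StepInv M G T π N (2 ^ p)) (by decide) ?_ ?_ ?_ fun j hj u _ _ hu =>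
      runs_stepProg hM hT hp1 hj hu) fun t2 a2 h2 =>
    (runs_outProg h2.ready h2.value ?_).mono le_rfl ?_).mono ?_ fun _ _ h => h
  · intro u hu
    simp [NExpr.eval, (r1.of_agree hu (by decide) (by decide)).steps]
  · rintro k u x ⟨f1, f2, f3, f4, f5, f6⟩
    have au : Agree (setN vJ (.lit x)) u (u.writeNat vJ 0 x) :=
      ⟨fun a ha => State.writeNat_nat_ne _ _ _ (by simpa [Prog.natMods] using ha), fun _ _ => rfl⟩
    refine ⟨f1.of_agree au (by simp [Prog.natMods]) (by simp [Prog.realMods]), f2, ?_, ?_, ?_, f6⟩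
    · rwa [State.writeNat_nat_ne _ _ _ (by decide)]
    · simpa [TableOptimal, row] using f4
    · simpa [Covered, row] using f5
  · have n6 : t1.nat 6 0 = 0 := by rw [a1.1 6 (by decide)]; rfl
    refine ⟨r1, fun l => ?_, e3, fun k hk => by omega, fun j hj => by omega, by simp [e1]⟩
    rw [e2, doubleNet]
  · rw [a2.2 6 (by decide), a1.2 6 (by decide)]
    rfl
  · intro t a3 h3
    have hrow : ∀ k, row t k = row t2 k := fun k => by
      simp only [row, a3.1 7 (by decide), a3.1 8 (by decide), a3.2 4 (by decide),
        a3.2 5 (by decide)]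
    have n6 : t.nat 6 0 = t2.nat 6 0 := by rw [a3.1 6 (by decide)]
    refine ⟨fun k hk => ?_, fun l τ hτ => ?_, fun l => ?_, h3⟩
    · rw [hrow]
      exact h2.optimal k (by omega)
    · obtain ⟨j, hj, τ', hτ', rfl⟩ := exists_grid_interval hN hτ
      exact (h2.covered j hj l τ' hτ').of_extends ⟨n6.ge, fun k _ => hrow k⟩
    · rw [a3.2 aX (by decide), h2.value]
  · rw [length_transitions]
    simp only [NExpr.cost]
    set B := M.size + n * (2 ^ p * (p + 1)) with hB
    have hW : 1 ≤ 2 ^ p := Nat.one_le_two_pow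
    have hBe : B = M.size + n * 2 ^ p + n * (p * 2 ^ p) := by rw [hB]; ring
    have h1 : n * 1 ≤ n * 2 ^ p := Nat.mul_le_mul_left _ hW
    have h2 : 1 * (p * 1) ≤ n * (p * 2 ^ p) :=
      Nat.mul_le_mul hn (Nat.mul_le_mul_left _ hW)
    have h3 : 1 * B ≤ N * B := Nat.mul_le_mul_right _ hN
    have h4 : N * 1 ≤ N * B := Nat.mul_le_mul_left _ (by omega)
    have h5 : N * (120 * M.size + 900 * (n * 2 ^ p) + 300 * (n * (p * 2 ^ p)) + 400 + (1 + 1) + 9) ≤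
        N * (1400 * B) := Nat.mul_le_mul_left _ (by omega)
    have h6 : N * (1400 * B) = 1400 * (N * B) := by ring
    omega

/-- The summand 1 is needed for `m = 1`, where the logarithm vanishes. For `m ≥ 2` the width is at
most `2 * m`, and `p + 1` is at most `6 * log m` because `log 2 > 1 / 2`. -/
theorem two_pow_mul_succ_le {m p : ℕ} (h1 : m ≤ 2 ^ p) (h2 : 2 ^ p < 2 * m) :
    (2 ^ p * (p + 1) : ℝ) ≤ 12 * (m * Real.log m) + 1 := by
  have hm : 0 < m := by omega
  rcases Nat.lt_or_ge m 2 with h | h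
  · have hm1 : m = 1 := by omega
    subst hm1
    have hp : p = 0 := by
      by_contra hp
      have := Nat.pow_le_pow_right (n := 2) two_pos (Nat.one_le_iff_ne_zero.2 hp)
      omega
    subst hp
    norm_num
  · have h2' : (2 : ℝ) ^ p ≤ 2 * m := by exact_mod_cast h2.le
    have hm' : (2 : ℝ) ≤ m := by exact_mod_cast h
    have hlog2 : Real.log 2 ≤ Real.log m := Real.log_le_log two_pos hm'
    have hp : p * Real.log 2 ≤ Real.log 2 + Real.log m := by
      rw [← Real.log_pow, ← Real.log_mul two_ne_zero (by positivity)]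
      exact Real.log_le_log (by positivity) h2'
    have hl := Real.log_two_gt_d9
    have hp' : (p + 1 : ℝ) ≤ 6 * Real.log m := by nlinarith
    have := mul_le_mul h2' hp' (by positivity) (by positivity)
    linarith

end Solver

end RealRAM

/-- Every location has an enabled action, hence a non-zero rate. Costs proportional to the number of
locations are thereby absorbed in the size. -/
theorem MarkovGame.card_le_size {n m : ℕ} (M : MarkovGame (Fin n) (Fin m)) : n ≤ M.size := by
  have h : ∀ l : Fin n, ∃ e ∈ M.transitions, e.1 = l := fun l => by
    obtain ⟨a, ha⟩ := M.enabled_nonempty l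
    obtain ⟨l', hl'⟩ := mem_enabled_iff.1 ha
    exact ⟨_, hl', rfl⟩
  rw [← length_transitions, ← List.length_map (f := Prod.fst)]
  have h1 : (Finset.univ : Finset (Fin n)) ⊆ (M.transitions.map Prod.fst).toFinset := fun l _ => by
    obtain ⟨e, he, rfl⟩ := h l
    simpa using ⟨_, _, he⟩
  calc n = (Finset.univ : Finset (Fin n)).card := by simp
    _ ≤ _ := Finset.card_le_card h1
    _ ≤ _ := List.toFinset_card_le _

theorem mainTheorem1 :
    ∃ (prog : RealRAM.Prog) (C : ℝ), ∀ (n m : ℕ) (M : MarkovGame (Fin n) (Fin m)),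
      M.IsNormed → ∀ (G : Finset (Fin n)) (T π : ℝ), 0 ≤ T → 0 < π → π ≤ 1 →
      ∃ (s : RealRAM.State) (steps N : ℕ) (σ : Fin n → ℝ → Fin m),
        -- the program halts, within the claimed running time
        RealRAM.Exec prog (M.input G T π) s steps ∧
        (steps : ℝ) ≤ C * ((1 + T * √(T / π)) * (M.size + n * (m * Real.log m))) ∧
        -- its output describes a memoryless strategy for each of the two players
        MarkovGame.OutputsScheduler s T σ ∧
        M.IsStrategy {l | l ∈ M.reach} T σ ∧
        M.IsStrategy {l | l ∉ M.reach} T σ ∧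
        -- the values and strategies are those of a double net
        0 < N ∧
        (∀ l, MarkovGame.outputAt s l = M.doubleNet G (T / N) N l) ∧
        M.FollowsDoubleNet G T N σ ∧
        -- precision, for each initial location and for the initial distribution of the game
        (∀ l, M.IsSolution G T π (Pi.single l 1) σ σ (MarkovGame.outputAt s l)) ∧
        M.IsSolution G T π M.init σ σ (MarkovGame.outputInit s) := by
  -- The constant is `3000 * 4 * 12`: the cost of the program, the bound on `N`, and the passage
  -- from `2 ^ p * (p + 1)` to `m * log m`.
  refine ⟨RealRAM.Solver.solverProg, 144000, fun n m M hM G T π hT hπ hπ1 => ?_⟩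
  -- An initial distribution sums to 1, so there is a location; its enabled action shows that there
  -- is an action.
  have hn : 0 < n := by
    rcases Nat.eq_zero_or_pos n with rfl | hn
    · simpa using M.init_mem.2
    · exact hn
  have hm : 0 < m := (M.exists_enabled ⟨0, hn⟩).choose.pos
  obtain ⟨N, p, hN, hNπ, hNle, hp1, hp2, s, steps, hexec, hsteps, hopt, hcov, hval, hinit⟩ :=
    RealRAM.Solver.runs_solverProg (G := G) hM hn hm hT hπ
  obtain ⟨σ, hout, hfol, hstrat⟩ := RealRAM.Solver.exists_scheduler hm hopt hcov
  have hsol := fun μ hμ => hM.isSolution_of_followsDoubleNet hT hπ1 hN hNπ (hstrat _) (hstrat _)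
    hfol (μ := μ) hμ
  refine ⟨s, steps, N, σ, hexec, ?_, hout, hstrat _, hstrat _, hN, hval, hfol, fun l => ?_, ?_⟩
  · have h1 : (steps : ℝ) ≤ 3000 * (N * (M.size + n * (2 ^ p * (p + 1)))) := by
      exact_mod_cast hsteps
    have h2 := RealRAM.Solver.two_pow_mul_succ_le hp1 hp2
    have h3 : (n : ℝ) ≤ M.size := by exact_mod_cast M.card_le_size
    have h4 : (0 : ℝ) ≤ n * (m * Real.log m) := by
      have := Real.log_natCast_nonneg m
      positivity
    have h5 : (M.size + n * (2 ^ p * (p + 1)) : ℝ) ≤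
        12 * (M.size + n * (m * Real.log m)) := by
      have := mul_le_mul_of_nonneg_left h2 (Nat.cast_nonneg (α := ℝ) n)
      linarith
    have h6 := mul_le_mul hNle h5 (by positivity) (by positivity)
    linarith
  · have h := hsol _ (single_mem_stdSimplex ℝ l)
    have h1 : ∑ l', (Pi.single l 1 : Fin n → ℝ) l' * M.doubleNet G (T / N) N l' =
        MarkovGame.outputAt s l := by
      rw [MarkovGame.outputAt, hval l]
      simp [Pi.single_apply]
    rwa [h1] at h
  · have h := hsol _ M.init_mem
    rwa [← hinit] at h
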